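/- Let $\Sigma$ be a closed connected oriented surface of genus $g\ge 2$ with a triangulation $\mathcal T$ (loops and parallel edges allowed, all valences at least $3$) whose lift $\widetilde{\mathcal T}$ to the universal covering has neither loops nor parallel edges; let $E$ be its set of edges. Identify the open round disks of $\mathbb{CP}^1$ with the Hermitian $2\times2$ matrices $X$ with $\det X=-1$, via $X\mapsto\{[z_0:z_1] : \sum X_{ij}z_i\bar z_j<0\}$; $\mathrm{PSL}(2,\mathbb C)$ acts by $B\cdot X=(B^{-1})^{T}X\,\overline{B^{-1}}$. Let $\hat{\mathcal P}_{\mathcal T}$ be the set of pairs $(\rho,S)$ where $\rho:\pi_1(\Sigma)\to \mathrm{PSL}(2,\mathbb C)$ is a non-elementary representation and $S$ is a $\rho$-equivariant map from the vertices of $\widetilde{\mathcal T}$ to disks, such that disks at the endpoints of each edge $\varepsilon$ are tangent (at a point denoted $p(\varepsilon)$), and such that around each vertex $\alpha$ the tangency points of the successive edges at $\alpha$, taken in counterclockwise order, turn exactly once counterclockwise around $\partial S(\alpha)$. Let $\mathcal P_{\mathcal T}=\hat{\mathcal P}_{\mathcal T}/\mathrm{PSL}(2,\mathbb C)$ (where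 $A\cdot(\rho,S)=(A\rho A^{-1},A\cdot S)$), with the quotient topology; it is the moduli space of marked complex projective structures on $\Sigma$ with a circle packing with nerve $\mathcal T$. For an edge $\varepsilon$ of $\widetilde{\mathcal T}$ with adjacent triangles $\tau_1,\tau_2$, let $\varepsilon_1,\varepsilon_2,\varepsilon_3,\varepsilon_4$ be the edges of $\partial(\tau_1\cup\tau_2)$ in counterclockwise order, with $\varepsilon_1,\varepsilon_2\subset\tau_1$, and put $\mathbf{cr}_{(\rho,S)}(\varepsilon)=i\,[p(\varepsilon):p(\varepsilon_1):p(\varepsilon_2):p(\varepsilon_4)]$, where $[a:b:c:d]$ is the value at $d$ of the affine coordinate that is $\infty,0,1$ at $a,b,c$. Then: 1. The number $\mathbf{cr}_{(\rho,S)}(\varepsilon)$ is real and depends only on $[\rho,S]$ and on the projection of $\varepsilon$ to $\Sigma$, so that there is an induced map $\mathbf{cr}:\mathcal P_{\mathcal T}\to\mathbb R^{E}$. 2. $\mathcal P_{\mathcal T}$ has its natural structure of smooth (Hausdorff, second countable) manifold of dimension $6g-6$: the one for which a real function on an open subset is smooth if and only if its pull-back to $\hat{\mathcal P}_{\mathcal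 T}$ is locally a smooth function of finitely many of the coordinates of $(\rho,S)$ (entries of the matrices $S(\alpha)$ and of the action of $\rho(h)$ on $2\times 2$ matrices). 3. For this structure $\mathbf{cr}:\mathcal P_{\mathcal T}\to\mathbb R^{E}$ is a smooth immersion. 4. For $(\rho,S)\in\hat{\mathcal P}_{\mathcal T}$ let $\mathcal H_{\mathbb R}^{(\rho,S)}$ be the real vector space of maps $Q$ from the oriented edges of $\widetilde{\mathcal T}$ to $\mathfrak{sl}(2,\mathbb C)$ that are $\mathrm{Ad}\circ\rho$-equivariant, satisfy $Q(\varepsilon^*)=-Q(\varepsilon)$ for the reversed edge $\varepsilon^*$, satisfy $\sum_{\varepsilon_-=\alpha}Q(\varepsilon)=0$ for each vertex $\alpha$ (the sum being over the oriented edges with initial vertex $\alpha$), and are such that the projective vector field of $Q(\varepsilon)$ is tangent to the boundary circles of the disks at both endpoints of $\varepsilon$. There is a linear isomorphism $T_{[\rho,S]}\mathcal P_{\mathcal T}\cong\mathcal H_{\mathbb R}^{(\rho,S)}$ that sends the velocity at $t=0$ of a smooth curve $[\rho_t,S_t]$, with $(\rho_0,S_0)=(\rho,S)$, to $Q(\varepsilon)=R(\tau(\varepsilon))-R(\tau(\varepsilon^*))$,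 where $\tau(\varepsilon)$ is the triangle on the left of $\varepsilon$ and $R(\tau)\in\mathfrak{sl}(2,\mathbb C)$ is an infinitesimal motion inducing $\dot S$ at the three vertices of $\tau$. For the tangent vector corresponding to $Q$ and every edge $\varepsilon$, the derivative $d_{[\rho,S]}\mathbf{cr}(Q)$ vanishes at the projection of $\varepsilon$ if and only if $Q(\varepsilon)=0$. -/

import Mathlib

open scoped Manifold ContDiff MatrixGroups LinearAlgebra.Projectivization Topology Matrix ComplexOrder

noncomputable section

namespace CirclePacking

/-! ## Triangulated oriented surfaces and their universal coverings -/

/-- An oriented surface without boundary with a (locally finite) triangulation, described by the set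
`D` of its oriented edges. `rev e` is `e` with the reversed orientation; `next e` is the oriented
edge following `e` in the counterclockwise boundary of the triangle lying on the left of `e`.
Loops and parallel edges are allowed. Every vertex has finite valence at least `3`. -/
structure Triangulation (D : Type*) where
  rev : Equiv.Perm D
  next : Equiv.Perm D
  rev_rev : ∀ e, rev (rev e) = e
  rev_ne : ∀ e, rev e ≠ e
  next_next_next : ∀ e, next (next (next e)) = e
  next_ne : ∀ e, next e ≠ e
  three_le_valence : ∀ e, 3 ≤ Function.minimalPeriod (fun e => rev (next (next e))) e

namespace Triangulation

variable {D : Type*} (M : Triangulation D)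

/-- Counterclockwise rotation of the oriented edges around their initial vertex. -/
def rot : Equiv.Perm D := M.rev * M.next * M.next

/-- The number of oriented edges issuing from the initial vertex of `e`. -/
def valence (e : D) : ℕ := Function.minimalPeriod M.rot e

/-- Vertices are the cycles of the rotation. -/
def Vertex : Type _ := Quotient (Equiv.Perm.SameCycle.setoid M.rot)

/-- Unoriented edges. -/
def Edge : Type _ := Quotient (Equiv.Perm.SameCycle.setoid M.rev)

/-- Triangles are the cycles of `next`. -/
def Face : Type _ := Quotient (Equiv.Perm.SameCycle.setoid M.next)

/-- The initial vertex of an oriented edge. -/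
def tail (e : D) : M.Vertex := Quotient.mk _ e

/-- The terminal vertex of an oriented edge. -/
def head (e : D) : M.Vertex := M.tail (M.rev e)

/-- The unoriented edge underlying an oriented edge. -/
def edge (e : D) : M.Edge := Quotient.mk _ e

/-- The triangle on the left of an oriented edge. -/
def face (e : D) : M.Face := Quotient.mk _ e

instance [Finite D] : Fintype M.Edge :=
  haveI : Finite M.Edge := inferInstanceAs (Finite (Quotient _))
  Fintype.ofFinite _

/-- `l` is an edge path from `v` to `w`. -/
def IsEdgePath : M.Vertex → List D → M.Vertex → Prop
  | v, [], w => v = w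
  | v, e :: l, w => M.tail e = v ∧ IsEdgePath (M.head e) l w

/-- Any two vertices are joined by an edge path. -/
def IsConnected : Prop := ∀ v w : M.Vertex, ∃ l, M.IsEdgePath v l w

/-- The closed edge path `l'` based at `v` is obtained from the closed edge path `l` based at `v`
by inserting a backtracking `e, rev e` or the boundary of a triangle. -/
def ElementaryHomotopy (v : M.Vertex) (l l' : List D) : Prop :=
  M.IsEdgePath v l v ∧ M.IsEdgePath v l' v ∧ ∃ p q : List D, ∃ e : D, l = p ++ q ∧
    (l' = p ++ [e, M.rev e] ++ q ∨ l' = p ++ [e, M.next e, M.next (M.next e)] ++ q)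

/-- The surface is connected and every closed edge path is homotopic to the constant one. -/
def IsSimplyConnected : Prop :=
  M.IsConnected ∧ ∀ (v : M.Vertex) (l : List D), M.IsEdgePath v l v →
    Relation.EqvGen (M.ElementaryHomotopy v) l []

/-- The triangulation has neither loops nor parallel edges. -/
def IsSimplicial : Prop :=
  (∀ e, M.tail e ≠ M.head e) ∧
    ∀ e e', M.tail e = M.tail e' → M.head e = M.head e' → e = e'

/-- The triangulated surface is closed and connected, of genus `g`. -/
def IsClosedOfGenus (g : ℕ) : Prop :=
  Finite D ∧ M.IsConnected ∧
    (Nat.card M.Vertex : ℤ) - Nat.card M.Edge + Nat.card M.Face = 2 - 2 * g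

end Triangulation

/-- A universal covering of a triangulated surface `M`, with the lifted triangulation `cover`:
a simply connected triangulated surface with a projection that is compatible with the
triangulations and is injective around each vertex (that is, unbranched). -/
structure UniversalCovering {D : Type*} (M : Triangulation D) (D' : Type*) where
  cover : Triangulation D'
  proj : D' → D
  proj_rev : ∀ e, proj (cover.rev e) = M.rev (proj e)
  proj_next : ∀ e, proj (cover.next e) = M.next (proj e)
  proj_surjective : Function.Surjective proj
  proj_injective : ∀ e e', cover.tail e = cover.tail e' → proj e = proj e' → e = e'
  simplyConnected : cover.IsSimplyConnected

/-! ## Disks of the Riemann sphere as points of de Sitter space -/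

/-- `2 × 2` complex matrices. -/
abbrev Mat : Type := Matrix (Fin 2) (Fin 2) ℂ

/-- The complex projective line. -/
abbrev CP1 : Type := ℙ ℂ (Fin 2 → ℂ)

/-- Entrywise complex conjugation. -/
def conjMat (X : Mat) : Mat := X.map star

/-- The Hermitian form `∑ X i j * z i * conj (z j)`. The open disk of `CP1` attached to a Hermitian
matrix `X` of determinant `-1` is the set where this form is negative. -/
def hermForm (X : Mat) (z : Fin 2 → ℂ) : ℂ := z ⬝ᵥ (X *ᵥ star z)

/-- De Sitter space: the Hermitian matrices of determinant `-1`, that is the disks of `CP1`. -/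
def deSitter : Set Mat := {X | X.IsHermitian ∧ X.det = -1}

/-- The Minkowski product on Hermitian matrices: the polarization of `X ↦ - det X`. -/
def mink (X Y : Mat) : ℝ := -(1 / 2) * ((X + Y).det - X.det - Y.det).re

/-- The action `B · X = (B⁻¹)ᵀ X conj(B⁻¹)` of `SL(2, ℂ)`. -/
def slAct : SL(2, ℂ) →* Module.End ℂ Mat where
  toFun B :=
    { toFun := fun X => ((B⁻¹ : SL(2, ℂ)) : Mat)ᵀ * X * conjMat ((B⁻¹ : SL(2, ℂ)) : Mat)
      map_add' := fun X Y => by simp [mul_add, add_mul]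
      map_smul' := fun c X => by simp }
  map_one' := by
    ext X : 1
    simp [conjMat]
  map_mul' B C := by
    ext X : 1
    have h : conjMat ((C⁻¹ : SL(2, ℂ)) * (B⁻¹ : SL(2, ℂ)) : Mat)
        = conjMat ((C⁻¹ : SL(2, ℂ)) : Mat) * conjMat ((B⁻¹ : SL(2, ℂ)) : Mat) := by
      ext i j
      simp [conjMat, Matrix.mul_apply]
    simp only [mul_inv_rev, Matrix.SpecialLinearGroup.coe_mul, LinearMap.coe_mk, AddHom.coe_mk,
      Module.End.mul_apply, h, Matrix.transpose_mul, Matrix.mul_assoc]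

/-- The adjoint action `B · A = B A B⁻¹` of `SL(2, ℂ)`. -/
def slAd : SL(2, ℂ) →* Module.End ℂ Mat where
  toFun B :=
    { toFun := fun A => (B : Mat) * A * ((B⁻¹ : SL(2, ℂ)) : Mat)
      map_add' := fun X Y => by simp [mul_add, add_mul]
      map_smul' := fun c X => by simp }
  map_one' := by
    ext X : 1
    simp
  map_mul' B C := by
    ext X : 1
    simp only [mul_inv_rev, Matrix.SpecialLinearGroup.coe_mul, LinearMap.coe_mk, AddHom.coe_mk,
      Module.End.mul_apply, Matrix.mul_assoc]

theorem center_cases {B : SL(2, ℂ)} (hB : B ∈ Subgroup.center SL(2, ℂ)) : B = 1 ∨ B = -1 := by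
  obtain ⟨r, hr, h⟩ := Matrix.SpecialLinearGroup.mem_center_iff.1 hB
  have hr' : r = 1 ∨ r = -1 := by simpa using hr
  rcases hr' with rfl | rfl
  · left
    ext i j
    simp [← h]
  · right
    ext i j
    simp only [← h, Matrix.scalar_apply, Matrix.diagonal_apply, Matrix.SpecialLinearGroup.coe_neg,
      Matrix.SpecialLinearGroup.coe_one, Matrix.neg_apply, Matrix.one_apply]
    split_ifs <;> simp

/-- The action of `PSL(2, ℂ)` on Hermitian matrices. -/
def act : PSL(2, ℂ) →* Module.End ℂ Mat :=
  QuotientGroup.lift _ slAct fun B hB => by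
    rcases center_cases hB with rfl | rfl
    · exact MonoidHom.mem_ker.2 (map_one _)
    · refine MonoidHom.mem_ker.2 ?_
      ext X : 1
      ext i j
      simp [slAct, conjMat, Matrix.mul_apply, Matrix.SpecialLinearGroup.coe_inv,
        Matrix.adjugate_fin_two, Fin.sum_univ_two]
      fin_cases i <;> fin_cases j <;> simp

/-- The adjoint action of `PSL(2, ℂ)`. -/
def Ad : PSL(2, ℂ) →* Module.End ℂ Mat :=
  QuotientGroup.lift _ slAd fun B hB => by
    rcases center_cases hB with rfl | rfl
    · exact MonoidHom.mem_ker.2 (map_one _)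
    · refine MonoidHom.mem_ker.2 ?_
      ext X : 1
      ext i j
      simp [slAd, Matrix.mul_apply, Matrix.SpecialLinearGroup.coe_inv,
        Matrix.adjugate_fin_two, Fin.sum_univ_two]
      fin_cases i <;> fin_cases j <;> simp

/-- The infinitesimal action of a trace-free matrix `A` at `X`: the derivative at `t = 0` of
`exp (t A) · X`. -/
def infAct (A X : Mat) : Mat := -(Aᵀ * X + X * conjMat A)

/-- The projective vector field `[z] ↦ d/dt exp (t A) [z]` is tangent to the boundary circle
of the disk `X`. -/
def TangentToBoundary (A X : Mat) : Prop :=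
  ∀ z : Fin 2 → ℂ, hermForm X z = 0 → ((A *ᵥ z) ⬝ᵥ (X *ᵥ star z)).re = 0

theorem TangentToBoundary.zero (X : Mat) : TangentToBoundary 0 X := fun z _ => by
  rw [Matrix.zero_mulVec, zero_dotProduct, Complex.zero_re]

theorem TangentToBoundary.add {A B X : Mat} (hA : TangentToBoundary A X)
    (hB : TangentToBoundary B X) : TangentToBoundary (A + B) X := fun z hz => by
  rw [Matrix.add_mulVec, add_dotProduct, Complex.add_re, hA z hz, hB z hz, add_zero]

theorem TangentToBoundary.smul {A X : Mat} (c : ℝ) (hA : TangentToBoundary A X) :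
    TangentToBoundary (c • A) X := fun z hz => by
  rw [Matrix.smul_mulVec, smul_dotProduct, Complex.smul_re, hA z hz, smul_zero]

/-- The point of `CP1` with homogeneous coordinates `[z : w]`, for `(z, w) ≠ 0`. -/
def point (z w : ℂ) (h : ![z, w] ≠ 0) : CP1 := Projectivization.mk ℂ ![z, w] h

/-- The point at infinity `[1 : 0]`. -/
def infinityPoint : CP1 := point 1 0 fun h => by simpa using congrFun h 0

/-- The real point `[x : 1]`. -/
def realPoint (x : ℝ) : CP1 := point x 1 fun h => by simpa using congrFun h 1

/-- The upper half-plane, as a point of de Sitter space. -/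
def upperHalfPlane : Mat := !![0, Complex.I; -Complex.I, 0]

/-- The tangency point of two tangent disks `X`, `Y`: the kernel of the Hermitian form `X + Y`. -/
def tangencyPoint (X Y : Mat) : CP1 :=
  Classical.epsilon fun p : CP1 => p.rep ᵥ* (X + Y) = 0

/-- The cross ratio `[a : b : c : d]` of four points of `CP1`: the value at `d` of the affine
coordinate that is `∞`, `0`, `1` at `a`, `b`, `c`. -/
def crossRatio (a b c d : CP1) : ℂ :=
  let det (p q : CP1) : ℂ := p.rep 0 * q.rep 1 - p.rep 1 * q.rep 0
  det d b * det c a / (det d a * det c b)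

/-- A representation of a group in `PSL(2, ℂ)` is non-elementary if it has no finite orbit on the
union of hyperbolic space and its boundary `CP1`, realized as the set of rays of nonzero
positive semidefinite Hermitian matrices. -/
def NonElementary {G : Type*} [Group G] (ρ : G →* PSL(2, ℂ)) : Prop :=
  ∀ X : Mat, X.PosSemidef → X ≠ 0 →
    ¬ (Set.range fun g : G => {Y : Mat | ∃ c : ℝ, 0 < c ∧ Y = c • act (ρ g) X}).Finite

/-! ## The space of circle packings with a given nerve -/

namespace UniversalCovering

variable {D D' : Type*} {M : Triangulation D} (U : UniversalCovering M D')

/-- The fundamental group of the surface, as the group of deck transformations. -/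
def Deck : Subgroup (Equiv.Perm D') where
  carrier := {h | (∀ e, h (U.cover.rev e) = U.cover.rev (h e)) ∧
    (∀ e, h (U.cover.next e) = U.cover.next (h e)) ∧ ∀ e, U.proj (h e) = U.proj e}
  mul_mem' := by
    rintro a b ⟨h1, h2, h3⟩ ⟨k1, k2, k3⟩
    exact ⟨fun e => by simp [k1, h1], fun e => by simp [k2, h2], fun e => by simp [k3, h3]⟩
  one_mem' := by simp
  inv_mem' := by
    rintro a ⟨h1, h2, h3⟩
    refine ⟨fun e => ?_, fun e => ?_, fun e => ?_⟩
    · rw [Equiv.Perm.inv_eq_iff_eq, h1]; simp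
    · rw [Equiv.Perm.inv_eq_iff_eq, h2]; simp
    · rw [← h3]; simp

/-- The tangency point of the disks at the endpoints of an edge. -/
def tangency (S : U.cover.Vertex → Mat) (e : D') : CP1 :=
  tangencyPoint (S (U.cover.tail e)) (S (U.cover.head e))

/-- In a chart where the disk at the initial vertex of `e` is the upper half-plane and the tangency
point along `e` is `∞`, the tangency points along the other edges issuing from that vertex, taken in
counterclockwise order, form a strictly increasing sequence of real numbers. In other words the
tangency points turn exactly once around the boundary of the disk. -/
def TurnsOnce (S : U.cover.Vertex → Mat) (e : D') : Prop :=
  ∃ (A : PSL(2, ℂ)) (x : ℕ → ℝ), act A (S (U.cover.tail e)) = upperHalfPlane ∧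
    A • U.tangency S e = infinityPoint ∧
    (∀ i, 1 ≤ i → i < U.cover.valence e →
      A • U.tangency S ((U.cover.rot)^[i] e) = realPoint (x i)) ∧
    ∀ i j, 1 ≤ i → i < j → j < U.cover.valence e → x i < x j

/-- A developed circle packing with nerve `M`: a non-elementary representation of the fundamental
group together with an equivariant selection map from the vertices of the universal covering to the
space of disks, such that disks at the endpoints of an edge are tangent and the disks around
each vertex turn exactly once around the disk at that vertex. -/
structure DevelopedPacking where
  hol : U.Deck →* PSL(2, ℂ)
  disk : U.cover.Vertex → Mat
  nonElementary : NonElementary hol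
  disk_mem : ∀ v, disk v ∈ deSitter
  equivariant : ∀ (h : U.Deck) (e : D'),
    disk (U.cover.tail ((h : Equiv.Perm D') e)) = act (hol h) (disk (U.cover.tail e))
  mink_eq : ∀ e, mink (disk (U.cover.tail e)) (disk (U.cover.head e)) = -1
  not_neg : ∀ e, ¬ (-(disk (U.cover.tail e) + disk (U.cover.head e))).PosSemidef
  turnsOnce : ∀ e, U.TurnsOnce disk e

/-- Index set of the coordinates on the space of developed packings: the entries of the disks and
the entries of the holonomies (acting on matrices). -/
abbrev CoordIndex : Type _ :=
  (U.cover.Vertex × Fin 2 × Fin 2) ⊕ (U.Deck × (Fin 2 × Fin 2) × Fin 2 × Fin 2)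

variable {U}

namespace DevelopedPacking

/-- The coordinates of a developed packing. -/
def coord (p : U.DevelopedPacking) : U.CoordIndex → ℂ
  | Sum.inl (v, i, j) => p.disk v i j
  | Sum.inr (h, (k, l), i, j) => act (p.hol h) (Matrix.single k l 1) i j

/-- The topology of pointwise convergence of the selection map and of the holonomy. -/
instance : TopologicalSpace U.DevelopedPacking := TopologicalSpace.induced coord inferInstance

/-- A real function on the space of developed packings is smooth at `p` if near `p` it is a smooth
function of finitely many coordinates. -/
def SmoothAt (F : U.DevelopedPacking → ℝ) (p : U.DevelopedPacking) : Prop :=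
  ∃ (s : Finset U.CoordIndex) (G : (s → ℂ) → ℝ), ContDiff ℝ ∞ G ∧
    ∀ᶠ q in 𝓝 p, F q = G fun i => q.coord i

/-- A curve of developed packings is smooth if all its coordinates are. -/
def SmoothCurve (γ : ℝ → U.DevelopedPacking) : Prop :=
  ∀ i, ContDiff ℝ ∞ fun t => (γ t).coord i

/-- Two developed packings are equivalent if they differ by an element of `PSL(2, ℂ)`. -/
instance setoid (U : UniversalCovering M D') : Setoid U.DevelopedPacking where
  r p q := ∃ A : PSL(2, ℂ), (∀ h, q.hol h = A * p.hol h * A⁻¹) ∧ ∀ v, q.disk v = act A (p.disk v)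
  iseqv :=
    { refl := fun p => ⟨1, by simp, by simp⟩
      symm := by
        rintro p q ⟨A, h1, h2⟩
        refine ⟨A⁻¹, fun h => ?_, fun v => ?_⟩
        · rw [h1]; group
        · rw [h2, ← Module.End.mul_apply, ← map_mul]; simp
      trans := by
        rintro p q r ⟨A, h1, h2⟩ ⟨B, k1, k2⟩
        refine ⟨B * A, fun h => ?_, fun v => ?_⟩
        · rw [k1, h1]; group
        · rw [k2, h2, map_mul, Module.End.mul_apply] }

/-- The number `i [p(ε) : p(ε₁) : p(ε₂) : p(ε₄)]` of the edge `ε` underlying `e`, where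
`ε₁, ε₂, ε₃, ε₄` are the edges of the boundary of the union of the two triangles adjacent to `ε`, in
counterclockwise order and with `ε₁, ε₂` in the triangle on the left of `e`. -/
def edgeCrossRatio (p : U.DevelopedPacking) (e : D') : ℂ :=
  Complex.I * crossRatio (U.tangency p.disk e) (U.tangency p.disk (U.cover.next e))
    (U.tangency p.disk (U.cover.next (U.cover.next e)))
    (U.tangency p.disk (U.cover.next (U.cover.next (U.cover.rev e))))

/-- The discrete `sl(2, ℂ)`-valued one-forms `Q` on the oriented edges of the universal covering
that are equivariant and coclosed and such that `Q e` is tangent to the boundaries of both disks at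
the endpoints of `e`. -/
def tangentForms (p : U.DevelopedPacking) : Submodule ℝ (D' → Mat) where
  carrier := {Q | (∀ e, (Q e).trace = 0) ∧ (∀ e, Q (U.cover.rev e) = -Q e) ∧
    (∀ (h : U.Deck) (e : D'), Q ((h : Equiv.Perm D') e) = Ad (p.hol h) (Q e)) ∧
    (∀ e, ∑ i ∈ Finset.range (U.cover.valence e), Q ((U.cover.rot)^[i] e) = 0) ∧
    ∀ e, TangentToBoundary (Q e) (p.disk (U.cover.tail e)) ∧
      TangentToBoundary (Q e) (p.disk (U.cover.head e))}
  add_mem' := by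
    rintro P Q ⟨a1, a2, a3, a4, a5⟩ ⟨b1, b2, b3, b4, b5⟩
    refine ⟨fun e => by simp [a1, b1], fun e => ?_, fun h e => by simp [a3, b3],
      fun e => by simp [Finset.sum_add_distrib, a4, b4], fun e => ⟨(a5 e).1.add (b5 e).1, (a5 e).2.add (b5 e).2⟩⟩
    simp only [Pi.add_apply, a2, b2]; abel
  zero_mem' := by
    refine ⟨fun e => by simp, fun e => by simp, fun h e => by simp, fun e => by simp,
      fun e => ⟨TangentToBoundary.zero _, TangentToBoundary.zero _⟩⟩
  smul_mem' := by
    rintro c Q ⟨a1, a2, a3, a4, a5⟩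
    refine ⟨fun e => by simp [a1], fun e => by simp [a2], fun h e => ?_,
      fun e => by simp [← Finset.smul_sum, a4], fun e => ⟨(a5 e).1.smul c, (a5 e).2.smul c⟩⟩
    simp only [Pi.smul_apply, a3]
    exact (LinearMap.map_smul_of_tower _ c _).symm

end DevelopedPacking

variable (U)

/-- The space of circle packings with nerve `M`. -/
def PackingSpace : Type _ := Quotient (DevelopedPacking.setoid U)

/-- The quotient topology. -/
instance : TopologicalSpace U.PackingSpace := inferInstanceAs (TopologicalSpace (Quotient _))

variable {U}

/-- The point of the space of circle packings given by a developed packing. -/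
def DevelopedPacking.toSpace (p : U.DevelopedPacking) : U.PackingSpace := Quotient.mk _ p

variable (U)

/-- The cross ratio map. It is defined by choosing a representative of the point and a lift of the
edge. -/
def crossRatioMap (x : U.PackingSpace) (ε : M.Edge) : ℝ :=
  ((Quotient.out x).edgeCrossRatio
    (Function.surjInv U.proj_surjective (Quotient.out ε))).re

/-- A manifold structure (atlas) on the space of circle packings is the natural one if it is
Hausdorff, second countable and smooth, and if its smooth functions are those induced by the
coordinates: a function on an open set `W` is smooth if and only if its pull-back to the developed
packings is locally a smooth function of finitely many coordinates. -/
def IsNaturalManifoldStructure (n : ℕ)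
    (_ : ChartedSpace (EuclideanSpace ℝ (Fin n)) U.PackingSpace) : Prop :=
  T2Space U.PackingSpace ∧ SecondCountableTopology U.PackingSpace ∧
    IsManifold (𝓡 n) ∞ U.PackingSpace ∧
    ∀ (W : Set U.PackingSpace) (f : U.PackingSpace → ℝ), IsOpen W →
      (ContMDiffOn (𝓡 n) 𝓘(ℝ, ℝ) ∞ f W ↔
        ∀ p : U.DevelopedPacking, p.toSpace ∈ W →
          DevelopedPacking.SmoothAt (fun q => f q.toSpace) p)

/-- The family of linear maps `Φ` from tangent vectors to discrete one-forms is the one induced by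
deformations: if a tangent vector is the velocity at `t = 0` of a smooth curve `γ` of developed
packings, and `R τ` is the infinitesimal motion of the three disks at the vertices of the
triangle `τ`, then the value of its one-form on `e` is the difference of `R` on the triangles to the
left and to the right of `e`. -/
def IsInducedByDeformations (n : ℕ)
    [ChartedSpace (EuclideanSpace ℝ (Fin n)) U.PackingSpace]
    (Φ : ∀ p : U.DevelopedPacking, TangentSpace (𝓡 n) p.toSpace ≃ₗ[ℝ] p.tangentForms) : Prop :=
  ∀ γ : ℝ → U.DevelopedPacking, DevelopedPacking.SmoothCurve γ →
    ∃ R : U.cover.Face → Mat, (∀ τ, (R τ).trace = 0) ∧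
      (∀ e i j, HasDerivAt (fun t => (γ t).disk (U.cover.tail e) i j)
        (infAct (R (U.cover.face e)) ((γ 0).disk (U.cover.tail e)) i j) 0) ∧
      ∀ e, (Φ (γ 0) (mfderiv 𝓘(ℝ, ℝ) (𝓡 n) (fun t => (γ t).toSpace) 0 (1 : ℝ)) : D' → Mat) e
        = R (U.cover.face e) - R (U.cover.face (U.cover.rev e))

end UniversalCovering

end CirclePacking

end

/-! The theorem is true because a packing is determined, up to `PSL(2, ℂ)`, by one positive number
per edge, and the numbers that occur form a submanifold of `ℝ^E` cut out by three independent
equations per vertex.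

Any triangle of mutually tangent disks can be moved by a unique Möbius map, its frame, to a standard
triple: the half-planes `Im z > 0` and `Im z < -1`, and a disk of diameter one between them. The
third disk of the neighbouring triangle then touches the real line at a point `t`, and `t` is the
cross ratio of the edge (`edgeCrossRatio_eq`). Passing to the next edge around a vertex multiplies
the frame by `z ↦ t - 1 / z`. Hence the product of the corresponding real matrices around each
vertex is `-1`, and turning exactly once is a positivity condition (`DevelopedPacking.closing`).
Conversely, over the simply connected covering every solution of these closing equations integrates
to a system of frames (`exists_section`, `develop`), with an equivariant family of disks whose
entries are smooth functions of `t`. Non-elementarity is an open condition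
(`exists_isClosed_nonElementary_iff`). So the cross ratio map is a topological embedding, and
locally its image is a fibre of the map `vertexMap : ℝ^E → ℝ^(3V)`.

The heart of the proof is that `vertexMap` is a submersion there
(`Closing.fderiv_vertexMap_surjective`). A functional that annihilates the image of the differential
is a binary quadratic form at every vertex. Evaluated on the vectors representing the tangency
points, these forms give a function on oriented edges that is odd under reversal. Along a half-turn
a non-zero quadratic form changes sign at most twice (`sum_cornerWeight_le`), whereas oddness forces
a sign change in every triangle. Counting corners, there are at most two triangles per vertex,
against `2V + 4g - 4` triangles in all. If some of the forms vanish, the count is localized to the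
star of a minimal set of vertices. There it leaves only a star whose boundary has length at most
two, which lifts to the universal covering and contradicts the absence of loops and parallel edges,
or else a star that is the whole surface (`sign_rigidity`).

Since `E - 3V = 6g - 6`, the image is a submanifold of that dimension. Its slice charts give the
manifold structure, and its smooth functions are the natural ones because cross ratios and
normalized packings depend smoothly on each other. In slice charts `cr` is a linear inclusion, so it
is an immersion.

For the last part, tangency to both circles forces `Q(ε)` to be a real multiple of an explicit
non-zero field along `ε`. Equivariance makes the coefficients a vector `q` in `ℝ^E`, and
coclosedness is the linearized closing equation (`edgeForm_mem_iff`). Hence `q ∈ ker d(vertexMap)`,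
the image of `d cr`. Comparing infinitesimal motions of adjacent triangles shows that the
coefficient of `Q(ε)` is the derivative of the cross ratio (`faceMotion_sub`). -/

noncomputable section

namespace CirclePacking

/-! ## Combinatorics of triangulations -/

namespace Triangulation

variable {D : Type*} (M : Triangulation D)

theorem rot_apply (e : D) : M.rot e = M.rev (M.next (M.next e)) := rfl

theorem three_le (e : D) : 3 ≤ M.valence e := M.three_le_valence e

theorem valence_pos (e : D) : 0 < M.valence e := by have := M.three_le e; omega

theorem rot_iterate_valence (e : D) : M.rot^[M.valence e] e = e :=
  Function.iterate_minimalPeriod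

theorem rot_next (e : D) : M.rot (M.next e) = M.rev e := by
  rw [rot_apply, M.next_next_next]

theorem valence_rot (e : D) : M.valence (M.rot e) = M.valence e :=
  Function.minimalPeriod_apply (Function.mk_mem_periodicPts (M.valence_pos e)
    (M.rot_iterate_valence e))

theorem valence_rot_iterate (e : D) (i : ℕ) : M.valence (M.rot^[i] e) = M.valence e := by
  induction i with
  | zero => rfl
  | succ i ih => rw [Function.iterate_succ_apply', valence_rot, ih]

theorem tail_eq_iff {e e' : D} : M.tail e = M.tail e' ↔ M.rot.SameCycle e e' :=
  Quotient.eq (r := Equiv.Perm.SameCycle.setoid M.rot)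

theorem edge_eq_iff_sameCycle {e e' : D} : M.edge e = M.edge e' ↔ M.rev.SameCycle e e' :=
  Quotient.eq (r := Equiv.Perm.SameCycle.setoid M.rev)

theorem face_eq_iff_sameCycle {e e' : D} : M.face e = M.face e' ↔ M.next.SameCycle e e' :=
  Quotient.eq (r := Equiv.Perm.SameCycle.setoid M.next)

theorem tail_surjective (v : M.Vertex) : ∃ e, M.tail e = v := Quotient.exists_rep v

theorem face_surjective (v : M.Face) : ∃ e, M.face e = v := Quotient.exists_rep v

theorem edge_surjective (v : M.Edge) : ∃ e, M.edge e = v := Quotient.exists_rep v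

theorem tail_rot (e : D) : M.tail (M.rot e) = M.tail e :=
  M.tail_eq_iff.2 (Equiv.Perm.SameCycle.symm ⟨1, by simp⟩)

theorem tail_rot_iterate (e : D) (i : ℕ) : M.tail (M.rot^[i] e) = M.tail e := by
  induction i with
  | zero => rfl
  | succ i ih => rw [Function.iterate_succ_apply', tail_rot, ih]

theorem head_eq (e : D) : M.head e = M.tail (M.rev e) := rfl

theorem head_rev (e : D) : M.head (M.rev e) = M.tail e := by rw [head_eq, M.rev_rev]

theorem tail_next (e : D) : M.tail (M.next e) = M.head e := by
  rw [head_eq, ← rot_next, tail_rot]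

theorem head_next_next (e : D) : M.head (M.next (M.next e)) = M.tail e := by
  rw [← tail_next, M.next_next_next]

theorem head_rot (e : D) : M.head (M.rot e) = M.head (M.next e) := by
  rw [rot_apply, head_rev, tail_next]

/-- Since the valence is a period of `rot` at `e`, the integer power given by `SameCycle` can be
reduced modulo the valence. -/
theorem exists_rot_of_tail_eq {e e' : D} (h : M.tail e = M.tail e') :
    ∃ i < M.valence e, M.rot^[i] e = e' := by
  obtain ⟨z, hz⟩ := M.tail_eq_iff.1 h
  have hk := M.valence_pos e
  have hfix : (M.rot ^ (M.valence e)) e = e := by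
    rw [← Equiv.Perm.iterate_eq_pow]; exact M.rot_iterate_valence e
  have hfixz : ∀ q : ℤ, ((M.rot ^ (M.valence e)) ^ q) e = e := fun q =>
    (Equiv.Perm.zpow_apply_eq_self_of_apply_eq_self hfix q)
  refine ⟨(z % (M.valence e : ℤ)).toNat, ?_, ?_⟩
  · have := Int.emod_lt_of_pos z (by exact_mod_cast hk : (0 : ℤ) < M.valence e)
    have := Int.emod_nonneg z (by exact_mod_cast hk.ne' : (M.valence e : ℤ) ≠ 0)
    omega
  · have h0 := Int.emod_nonneg z (by exact_mod_cast hk.ne' : (M.valence e : ℤ) ≠ 0)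
    rw [Equiv.Perm.iterate_eq_pow, ← zpow_natCast, Int.toNat_of_nonneg h0, ← hz]
    conv_rhs => rw [← Int.emod_add_mul_ediv z (M.valence e), zpow_add, Equiv.Perm.mul_apply,
      zpow_mul, zpow_natCast, hfixz]

theorem rot_iterate_injOn (e : D) {i j : ℕ} (hi : i < M.valence e) (hj : j < M.valence e)
    (h : M.rot^[i] e = M.rot^[j] e) : i = j :=
  Function.iterate_injOn_Iio_minimalPeriod hi hj h

theorem edge_rev (e : D) : M.edge (M.rev e) = M.edge e :=
  M.edge_eq_iff_sameCycle.2 (Equiv.Perm.SameCycle.symm ⟨1, by simp⟩)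

theorem face_next (e : D) : M.face (M.next e) = M.face e :=
  M.face_eq_iff_sameCycle.2 (Equiv.Perm.SameCycle.symm ⟨1, by simp⟩)

theorem edge_eq_iff {e e' : D} : M.edge e = M.edge e' ↔ e' = e ∨ e' = M.rev e := by
  constructor
  · intro h
    obtain ⟨z, hz⟩ := M.edge_eq_iff_sameCycle.1 h
    have h2 : M.rev * M.rev = 1 := by ext x; simp [M.rev_rev]
    rcases Int.even_or_odd' z with ⟨k, rfl | rfl⟩
    · left; rw [← hz, zpow_mul]
      rw [show M.rev ^ (2 : ℤ) = 1 by rw [zpow_two, h2]]; simp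
    · right; rw [← hz, zpow_add, zpow_mul]
      rw [show M.rev ^ (2 : ℤ) = 1 by rw [zpow_two, h2]]; simp
  · rintro (rfl | rfl)
    · rfl
    · exact (M.edge_rev e).symm

theorem face_eq_iff {e e' : D} :
    M.face e = M.face e' ↔ e' = e ∨ e' = M.next e ∨ e' = M.next (M.next e) := by
  constructor
  · intro h
    obtain ⟨z, hz⟩ := M.face_eq_iff_sameCycle.1 h
    have h3 : M.next ^ (3 : ℤ) = 1 := by
      ext x
      rw [show (3 : ℤ) = ((3 : ℕ) : ℤ) by rfl, zpow_natCast]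
      simp [pow_succ, M.next_next_next]
    have h0 := Int.emod_add_mul_ediv z 3
    have h1 : M.next ^ z = M.next ^ (z % 3) := by
      conv_lhs => rw [← h0, zpow_add, zpow_mul, h3]
      simp
    rw [h1] at hz
    have hc : z % 3 = 0 ∨ z % 3 = 1 ∨ z % 3 = 2 := by omega
    rcases hc with hc | hc | hc <;> rw [hc] at hz
    · left; simpa using hz.symm
    · right; left; simpa using hz.symm
    · right; right; rw [← hz, zpow_two]; rfl
  · rintro (rfl | rfl | rfl)
    · rfl
    · exact (M.face_next e).symm
    · rw [M.face_next, M.face_next]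

theorem next_next_ne (e : D) : M.next (M.next e) ≠ e := fun h =>
  M.next_ne e (by have := M.next_next_next e; rw [h] at this; exact this)

variable {M}

theorem IsEdgePath.append {u v w : M.Vertex} {l l' : List D} (h : M.IsEdgePath u l v)
    (h' : M.IsEdgePath v l' w) : M.IsEdgePath u (l ++ l') w := by
  induction l generalizing u with
  | nil => cases h; exact h'
  | cons e l ih => exact ⟨h.1, ih h.2⟩

theorem IsEdgePath.reverse {u v : M.Vertex} {l : List D} (h : M.IsEdgePath u l v) :
    M.IsEdgePath v (l.map M.rev).reverse u := by
  induction l generalizing u with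
  | nil => exact Eq.symm h
  | cons e l ih =>
    rw [List.map_cons, List.reverse_cons]
    refine (ih h.2).append ⟨rfl, ?_⟩
    rw [head_rev]; exact h.1

/-- Induction over the vertices of a connected triangulated surface. -/
theorem IsConnected.vertex_induction (hM : M.IsConnected) {P : M.Vertex → Prop} {v : M.Vertex}
    (hv : P v) (h : ∀ e, P (M.tail e) → P (M.head e)) (w : M.Vertex) : P w := by
  obtain ⟨l, hl⟩ := hM v w
  induction l generalizing v with
  | nil => cases hl; exact hv
  | cons e l ih => exact ih (h e (hl.1 ▸ hv)) hl.2

/-- Induction over the oriented edges of a connected triangulated surface. -/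
theorem IsConnected.dart_induction (hM : M.IsConnected) {P : D → Prop} {e₀ : D} (h₀ : P e₀)
    (hrev : ∀ e, P e → P (M.rev e)) (hnext : ∀ e, P e → P (M.next e)) (e : D) : P e := by
  have hrot : ∀ (e : D) (i : ℕ), P e → P (M.rot^[i] e) := fun e i he => by
    induction i with
    | zero => exact he
    | succ i ih => rw [Function.iterate_succ_apply']; exact hrev _ (hnext _ (hnext _ ih))
  have hstar : ∀ e e', M.tail e = M.tail e' → P e → P e' := fun e e' h he => by
    obtain ⟨i, -, rfl⟩ := M.exists_rot_of_tail_eq h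
    exact hrot e i he
  refine hM.vertex_induction (P := fun v => ∀ e, M.tail e = v → P e) (v := M.tail e₀)
    (fun e he => hstar e₀ e he.symm h₀) (fun e he e' he' => ?_) (M.tail e) e rfl
  exact hstar (M.rev e) e' he'.symm (hrev _ (he e rfl))

end Triangulation

/-! ## Sections over simply connected surfaces -/

section Section

open Triangulation

variable {D' Y : Type*} {C : Triangulation D'}

/-- An unbranched covering of a triangulated surface, as a pair of permutations of the set `Y` of
oriented edges upstairs. -/
structure Unbranched (C : Triangulation D') (Y : Type*) where
  r : Equiv.Perm Y
  n : Equiv.Perm Y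
  π : Y → D'
  r_r : ∀ y, r (r y) = y
  n_n_n : ∀ y, n (n (n y)) = y
  π_r : ∀ y, π (r y) = C.rev (π y)
  π_n : ∀ y, π (n y) = C.next (π y)
  -- This is the absence of branching: upstairs the rotation closes up after one turn around the
  -- vertex downstairs.
  period : ∀ y, (fun y => r (n (n y)))^[C.valence (π y)] y = y

namespace Unbranched

variable (B : Unbranched C Y)

def rot : Equiv.Perm Y := B.r * B.n * B.n

theorem rot_apply (y : Y) : B.rot y = B.r (B.n (B.n y)) := rfl

theorem π_rot (y : Y) : B.π (B.rot y) = C.rot (B.π y) := by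
  rw [rot_apply, B.π_r, B.π_n, B.π_n, Triangulation.rot_apply]

theorem π_rot_iterate (y : Y) (i : ℕ) : B.π (B.rot^[i] y) = C.rot^[i] (B.π y) := by
  induction i with
  | zero => rfl
  | succ i ih => rw [Function.iterate_succ_apply', Function.iterate_succ_apply', π_rot, ih]

theorem rot_period (y : Y) : B.rot^[C.valence (B.π y)] y = y := B.period y

/-- `y` and `y'` have the same initial vertex upstairs. -/
def Star (y y' : Y) : Prop := ∃ i : ℕ, B.rot^[i] y = y'

theorem Star.refl (y : Y) : B.Star y y := ⟨0, rfl⟩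

variable {B}

theorem Star.trans {x y z : Y} (h : B.Star x y) (h' : B.Star y z) : B.Star x z := by
  obtain ⟨i, rfl⟩ := h
  obtain ⟨j, rfl⟩ := h'
  exact ⟨j + i, by rw [Function.iterate_add_apply]⟩

theorem Star.symm {x y : Y} (h : B.Star x y) : B.Star y x := by
  obtain ⟨i, rfl⟩ := h
  have hk := C.valence_pos (B.π x)
  refine ⟨i * (C.valence (B.π x) - 1), ?_⟩
  have : ∀ j : ℕ, B.rot^[j * C.valence (B.π x)] x = x := fun j => by
    induction j with
    | zero => simp
    | succ j ih => rw [Nat.succ_mul, Function.iterate_add_apply, rot_period, ih]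
  rw [← Function.iterate_add_apply]
  convert this i using 2
  obtain ⟨k, hk⟩ := Nat.exists_eq_add_of_lt hk
  rw [hk]; simp; ring

theorem Star.tail_eq {x y : Y} (h : B.Star x y) : C.tail (B.π x) = C.tail (B.π y) := by
  obtain ⟨i, rfl⟩ := h
  rw [π_rot_iterate, tail_rot_iterate]

theorem Star.exists {x : Y} {e : D'} (h : C.tail (B.π x) = C.tail e) :
    ∃ y, B.Star x y ∧ B.π y = e := by
  obtain ⟨i, -, hi⟩ := C.exists_rot_of_tail_eq h
  exact ⟨B.rot^[i] x, ⟨i, rfl⟩, by rw [π_rot_iterate, hi]⟩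

/-- A return below takes a multiple of the valence, and by `period` it is also a return above.
Uniqueness of lifted paths rests on this. -/
theorem Star.eq_of_π {x y : Y} (h : B.Star x y) (hπ : B.π x = B.π y) : x = y := by
  obtain ⟨i, rfl⟩ := h
  have h1 : Function.IsPeriodicPt C.rot i (B.π x) := by
    rw [Function.IsPeriodicPt, Function.IsFixedPt, ← π_rot_iterate, ← hπ]
  obtain ⟨k, rfl⟩ := h1.minimalPeriod_dvd
  have : ∀ j : ℕ, B.rot^[C.valence (B.π x) * j] x = x := fun j => by
    induction j with
    | zero => simp
    | succ j ih => rw [Nat.mul_succ, Function.iterate_add_apply, rot_period, ih]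
  exact (this k).symm

theorem star_r_n (y : Y) : B.Star (B.n y) (B.r y) := ⟨1, by simp [rot_apply, B.n_n_n]⟩

variable (B)

/-- `y'` is issuing from the end of the lift of the edge path `l` that starts at the initial vertex
of `y`. -/
def Lift : Y → List D' → Y → Prop
  | y, [], y' => B.Star y y'
  | y, e :: l, y' => ∃ z, B.Star y z ∧ B.π z = e ∧ Lift (B.r z) l y'

variable {B}

theorem Lift.star_left {x y z : Y} {l : List D'} (h : B.Star x y) (hl : B.Lift y l z) :
    B.Lift x l z := by
  cases l with
  | nil => exact h.trans hl
  | cons e l => obtain ⟨w, h1, h2, h3⟩ := hl; exact ⟨w, h.trans h1, h2, h3⟩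

theorem Lift.append {x y z : Y} {l l' : List D'} (h : B.Lift x l y) (h' : B.Lift y l' z) :
    B.Lift x (l ++ l') z := by
  induction l generalizing x with
  | nil => exact h'.star_left h
  | cons e l ih => obtain ⟨w, h1, h2, h3⟩ := h; exact ⟨w, h1, h2, ih h3⟩

theorem Lift.split {x z : Y} {l l' : List D'} (h : B.Lift x (l ++ l') z) :
    ∃ y, B.Lift x l y ∧ B.Lift y l' z := by
  induction l generalizing x with
  | nil => exact ⟨x, Star.refl B x, h⟩
  | cons e l ih =>
    obtain ⟨w, h1, h2, h3⟩ := h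
    obtain ⟨y, h4, h5⟩ := ih h3
    exact ⟨y, ⟨w, h1, h2, h4⟩, h5⟩

theorem Lift.unique {x y z : Y} {l : List D'} (h : B.Lift x l y) (h' : B.Lift x l z) :
    B.Star y z := by
  induction l generalizing x with
  | nil => exact Star.trans (Star.symm h) h'
  | cons e l ih =>
    obtain ⟨w, h1, h2, h3⟩ := h
    obtain ⟨w', k1, k2, k3⟩ := h'
    have : w = w' := ((h1.symm).trans k1).eq_of_π (h2.trans k2.symm)
    subst this
    exact ih h3 k3

theorem Lift.exists {x : Y} {l : List D'} {w : C.Vertex}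
    (hl : C.IsEdgePath (C.tail (B.π x)) l w) : ∃ y, B.Lift x l y := by
  induction l generalizing x with
  | nil => exact ⟨x, Star.refl B x⟩
  | cons e l ih =>
    obtain ⟨z, hz, hπ⟩ := Star.exists hl.1.symm
    obtain ⟨y, hy⟩ := ih (x := B.r z) (by rw [B.π_r, hπ]; exact hl.2)
    exact ⟨y, z, hz, hπ, hy⟩

theorem Lift.tail_eq {x y : Y} {l : List D'} {w : C.Vertex}
    (hl : C.IsEdgePath (C.tail (B.π x)) l w) (h : B.Lift x l y) : C.tail (B.π y) = w := by
  induction l generalizing x with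
  | nil => exact (Star.tail_eq h).symm.trans hl
  | cons e l ih =>
    obtain ⟨z, hz, hπ, h3⟩ := h
    refine ih (x := B.r z) ?_ h3
    rw [B.π_r, hπ]; exact hl.2

theorem Lift.reverse {x y : Y} {l : List D'} (h : B.Lift x l y) :
    B.Lift y (l.map C.rev).reverse x := by
  induction l generalizing x with
  | nil => exact Star.symm h
  | cons e l ih =>
    obtain ⟨z, hz, hπ, h3⟩ := h
    rw [List.map_cons, List.reverse_cons]
    refine (ih h3).append ⟨B.r z, Star.refl B _, by rw [B.π_r, hπ], ?_⟩
    rw [B.r_r]; exact hz.symm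

/-- By `r_r` and `n_n_n`, a backtracking or a triangle boundary `c` lifts to a closed path wherever
it lifts at all. It does lift at the relevant place because both words are edge paths. -/
theorem Lift.insert_iff {x y : Y} {v : C.Vertex} {l l' : List D'} (hx : C.tail (B.π x) = v)
    (h : C.ElementaryHomotopy v l l') : B.Lift x l y ↔ B.Lift x l' y := by
  obtain ⟨hl, hl', p, q, e, rfl, h⟩ := h
  have hkey : ∃ c, (∀ z, B.Lift z c z ∨ ¬ ∃ w, B.Lift z c w) ∧ l' = p ++ c ++ q := by
    rcases h with h | h
    · refine ⟨_, fun z => ?_, h⟩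
      by_cases hz : C.tail (B.π z) = C.tail e
      · left
        obtain ⟨w, hw, hπ⟩ := Star.exists hz
        refine ⟨w, hw, hπ, B.r w, Star.refl B _, by rw [B.π_r, hπ], ?_⟩
        rw [B.r_r]; exact hw.symm
      · right
        rintro ⟨w, z', h1, h2, -⟩
        exact hz (by rw [← h2]; exact h1.tail_eq)
    · refine ⟨_, fun z => ?_, h⟩
      by_cases hz : C.tail (B.π z) = C.tail e
      · left
        obtain ⟨w, hw, hπ⟩ := Star.exists hz
        refine ⟨w, hw, hπ, B.n w, (star_r_n w).symm, by rw [B.π_n, hπ], B.n (B.n w),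
          (star_r_n _).symm, by rw [B.π_n, B.π_n, hπ], ?_⟩
        refine Star.trans ?_ hw.symm
        refine (star_r_n _).symm.trans ?_
        rw [B.n_n_n]; exact Star.refl B _
      · right
        rintro ⟨w, z', h1, h2, -⟩
        exact hz (by rw [← h2]; exact h1.tail_eq)
  obtain ⟨c, hc, rfl⟩ := hkey
  constructor
  · intro hxy
    obtain ⟨z, h1, h2⟩ := hxy.split
    rcases hc z with h3 | h3
    · exact (h1.append h3).append h2
    · exfalso
      obtain ⟨w, hw⟩ := Lift.exists (x := x) (l := p ++ c ++ q) (by rw [hx]; exact hl')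
      obtain ⟨w', hw', -⟩ := hw.split
      obtain ⟨w'', h5, h6⟩ := hw'.split
      exact h3 ⟨w', h6.star_left (h1.unique h5)⟩
  · intro hxy
    obtain ⟨w', hw', h7⟩ := hxy.split
    obtain ⟨w, h5, h6⟩ := hw'.split
    rcases hc w with h3 | h3
    · exact h5.append (h7.star_left (h3.unique h6))
    · exact (h3 ⟨_, h6⟩).elim

/-- The endpoint of a lift is invariant under elementary homotopies, and the empty path ends where
it starts: a simply connected base has no monodromy. -/
theorem Lift.closed (hC : C.IsSimplyConnected) {x y : Y} {v : C.Vertex} {l : List D'}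
    (hx : C.tail (B.π x) = v) (hl : C.IsEdgePath v l v) (h : B.Lift x l y) : B.Star x y := by
  have key : ∀ l l' : List D', Relation.EqvGen (C.ElementaryHomotopy v) l l' →
      ∀ y, B.Lift x l y ↔ B.Lift x l' y := fun l l' hll => by
    induction hll with
    | rel _ _ h => exact fun y => Lift.insert_iff hx h
    | refl _ => exact fun y => Iff.rfl
    | symm _ _ _ ih => exact fun y => (ih y).symm
    | trans _ _ _ _ _ ih ih' => exact fun y => (ih y).trans (ih' y)
  exact (key _ _ (hC.2 v l hl) y).1 h

variable (B)

/-- An unbranched covering of a simply connected surface has a section through any point. -/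
theorem exists_section (hC : C.IsSimplyConnected) (y₀ : Y) :
    ∃ s : D' → Y, s (B.π y₀) = y₀ ∧ (∀ e, B.π (s e) = e) ∧ (∀ e, s (C.rev e) = B.r (s e)) ∧
      ∀ e, s (C.next e) = B.n (s e) := by
  have h1 : ∀ e : D', ∃ y, B.π y = e ∧ ∃ l, C.IsEdgePath (C.tail (B.π y₀)) l (C.tail e) ∧
      B.Lift y₀ l y := fun e => by
    obtain ⟨l, hl⟩ := hC.1 (C.tail (B.π y₀)) (C.tail e)
    obtain ⟨y, hy⟩ := Lift.exists hl
    obtain ⟨z, hz, hπ⟩ := Star.exists (Lift.tail_eq hl hy)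
    refine ⟨z, hπ, l, hl, ?_⟩
    have := hy.append (l' := []) hz
    simpa using this
  -- Independence of the path: out along one path and back along the other is a closed path, to
  -- which `Lift.closed` applies.
  have huniq : ∀ (y y' : Y) (l l' : List D') (w : C.Vertex),
      C.IsEdgePath (C.tail (B.π y₀)) l w → C.IsEdgePath (C.tail (B.π y₀)) l' w →
      B.Lift y₀ l y → B.Lift y₀ l' y' → B.Star y y' := fun y y' l l' w hl hl' h h' => by
    obtain ⟨z, hz⟩ := Lift.exists (x := y') (B := B) (l := (l'.map C.rev).reverse)
      (w := C.tail (B.π y₀)) (by rw [Lift.tail_eq hl' h']; exact hl'.reverse)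
    have h2 : B.Star y₀ z := Lift.closed hC rfl (hl'.append hl'.reverse) (h'.append hz)
    have h3 := h.reverse
    have h4 : B.Lift y ((l.map C.rev).reverse ++ l') y' := h3.append h'
    refine Lift.closed hC (Lift.tail_eq hl h) (hl.reverse.append hl') h4
  choose s hsπ l hl hs using h1
  have hstar : ∀ e y, B.π y = e → B.Star (s e) y → s e = y := fun e y hy h =>
    h.eq_of_π ((hsπ e).trans hy.symm)
  refine ⟨s, ?_, hsπ, fun e => ?_, fun e => ?_⟩
  · exact hstar _ _ rfl (huniq _ _ _ [] _ (hl _) rfl (hs _) (Star.refl B y₀))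
  · refine hstar _ _ (by rw [B.π_r, hsπ]) (huniq _ _ _ (l e ++ [e]) _ (hl _)
      ((hl e).append ⟨rfl, rfl⟩) (hs _) ((hs e).append ⟨s e, Star.refl B _, hsπ e, Star.refl B _⟩))
  · refine hstar _ _ (by rw [B.π_n, hsπ]) (huniq _ _ _ (l e ++ [e]) _ (hl _)
      ((hl e).append ⟨rfl, (C.tail_next e).symm⟩) (hs _)
      ((hs e).append ⟨s e, Star.refl B _, hsπ e, (star_r_n _).symm⟩))

end Unbranched

end Section

/-! ### Deck transformations -/

namespace UniversalCovering

open Triangulation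

variable {D D' : Type*} {M : Triangulation D} (U : UniversalCovering M D')

theorem proj_rot (e : D') : U.proj (U.cover.rot e) = M.rot (U.proj e) := by
  rw [rot_apply, U.proj_rev, U.proj_next, U.proj_next, rot_apply]

theorem proj_rot_iterate (e : D') (i : ℕ) :
    U.proj (U.cover.rot^[i] e) = M.rot^[i] (U.proj e) := by
  induction i with
  | zero => rfl
  | succ i ih => rw [Function.iterate_succ_apply', Function.iterate_succ_apply', proj_rot, ih]

/-- Rotation does not change the initial vertex, and the projection is injective on the darts at a
vertex. Consequently valences agree upstairs and downstairs. -/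
theorem rot_iterate_eq_iff (e : D') (i : ℕ) :
    U.cover.rot^[i] e = e ↔ M.rot^[i] (U.proj e) = U.proj e := by
  rw [← proj_rot_iterate]
  exact ⟨fun h => by rw [h], fun h => U.proj_injective _ _ (by rw [tail_rot_iterate]) h⟩

theorem valence_proj (e : D') : M.valence (U.proj e) = U.cover.valence e :=
  (Function.minimalPeriod_eq_minimalPeriod_iff.2 fun i => U.rot_iterate_eq_iff e i).symm

/-- The pairs of oriented edges of the universal covering with the same projection. -/
def fibreProduct : Unbranched U.cover {y : D' × D' // U.proj y.1 = U.proj y.2} where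
  r :=
    { toFun := fun y => ⟨(U.cover.rev y.1.1, U.cover.rev y.1.2), by
        simp only [U.proj_rev, y.2]⟩
      invFun := fun y => ⟨(U.cover.rev y.1.1, U.cover.rev y.1.2), by
        simp only [U.proj_rev, y.2]⟩
      left_inv := fun y => by simp [U.cover.rev_rev]
      right_inv := fun y => by simp [U.cover.rev_rev] }
  n :=
    { toFun := fun y => ⟨(U.cover.next y.1.1, U.cover.next y.1.2), by
        simp only [U.proj_next, y.2]⟩
      invFun := fun y => ⟨(U.cover.next (U.cover.next y.1.1), U.cover.next (U.cover.next y.1.2)), by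
        simp only [U.proj_next, y.2]⟩
      left_inv := fun y => by simp [U.cover.next_next_next]
      right_inv := fun y => by simp [U.cover.next_next_next] }
  π := fun y => y.1.1
  r_r := fun y => by simp [U.cover.rev_rev]
  n_n_n := fun y => by simp [U.cover.next_next_next]
  π_r := fun y => rfl
  π_n := fun y => rfl
  period := by
    rintro ⟨⟨a, b⟩, hab⟩
    have key : ∀ i : ℕ, ∀ y : {y : D' × D' // U.proj y.1 = U.proj y.2},
        ((fun y : {y : D' × D' // U.proj y.1 = U.proj y.2} =>
          (⟨(U.cover.rot y.1.1, U.cover.rot y.1.2), by simp only [U.proj_rot, y.2]⟩ :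
            {y : D' × D' // U.proj y.1 = U.proj y.2}))^[i] y).1 =
          (U.cover.rot^[i] y.1.1, U.cover.rot^[i] y.1.2) := fun i y => by
      induction i with
      | zero => rfl
      | succ i ih => simp only [Function.iterate_succ_apply', ih]
    apply Subtype.ext
    refine (key _ _).trans ?_
    have h2 : U.cover.valence a = U.cover.valence b := by
      rw [← valence_proj, ← valence_proj, hab]
    change (U.cover.rot^[U.cover.valence a] a, U.cover.rot^[U.cover.valence a] b) = (a, b)
    conv_lhs => enter [2]; rw [h2]
    rw [rot_iterate_valence, rot_iterate_valence]

/-- The deck transformations act transitively on the fibres of the universal covering. -/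
theorem exists_deck {a b : D'} (h : U.proj a = U.proj b) :
    ∃ g : U.Deck, (g : Equiv.Perm D') a = b := by
  -- A section of the fibre product through `(a, b)` is the graph of a map commuting with `rev` and
  -- `next` and taking `a` to `b`. The section through `(b, a)` gives its inverse, since both
  -- composites commute with `rev` and `next` and fix one dart.
  obtain ⟨s, s1, s2, s3, s4⟩ := U.fibreProduct.exists_section U.simplyConnected ⟨(a, b), h⟩
  obtain ⟨t, t1, t2, t3, t4⟩ := U.fibreProduct.exists_section U.simplyConnected ⟨(b, a), h.symm⟩
  have hs1 : ∀ e, (s e).1.1 = e := s2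
  have ht1 : ∀ e, (t e).1.1 = e := t2
  have hsr : ∀ e, (s (U.cover.rev e)).1.2 = U.cover.rev (s e).1.2 := fun e => by rw [s3]; rfl
  have hsn : ∀ e, (s (U.cover.next e)).1.2 = U.cover.next (s e).1.2 := fun e => by rw [s4]; rfl
  have htr : ∀ e, (t (U.cover.rev e)).1.2 = U.cover.rev (t e).1.2 := fun e => by rw [t3]; rfl
  have htn : ∀ e, (t (U.cover.next e)).1.2 = U.cover.next (t e).1.2 := fun e => by rw [t4]; rfl
  have hsa : (s a).1.2 = b := by
    have : s a = ⟨(a, b), h⟩ := s1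
    rw [this]
  have htb : (t b).1.2 = a := by
    have : t b = ⟨(b, a), h.symm⟩ := t1
    rw [this]
  have hst : ∀ e, (t (s e).1.2).1.2 = e := by
    refine U.simplyConnected.1.dart_induction (e₀ := a) (by rw [hsa, htb]) (fun e he => ?_)
      fun e he => ?_
    · rw [hsr, htr, he]
    · rw [hsn, htn, he]
  have hts : ∀ e, (s (t e).1.2).1.2 = e := by
    refine U.simplyConnected.1.dart_induction (e₀ := b) (by rw [htb, hsa]) (fun e he => ?_)
      fun e he => ?_
    · rw [htr, hsr, he]
    · rw [htn, hsn, he]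
  refine ⟨⟨⟨fun e => (s e).1.2, fun e => (t e).1.2, hst, hts⟩, hsr, hsn, fun e => ?_⟩, hsa⟩
  change U.proj (s e).1.2 = U.proj e
  rw [← (s e).2, hs1]

end UniversalCovering

end CirclePacking

namespace CirclePacking

/-! ## Counting in closed triangulated surfaces -/

namespace Triangulation

open Classical Finset

variable {D : Type*} (M : Triangulation D)

instance [Finite D] : Fintype M.Vertex :=
  haveI : Finite M.Vertex := inferInstanceAs (Finite (Quotient _))
  Fintype.ofFinite _

instance [Finite D] : Fintype M.Face :=
  haveI : Finite M.Face := inferInstanceAs (Finite (Quotient _))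
  Fintype.ofFinite _

variable [Fintype D]

theorem card_filter_edge (S : Finset M.Edge) :
    #{d : D | M.edge d ∈ S} = 2 * #S := by
  rw [card_eq_sum_card_fiberwise (f := M.edge) (t := S) (fun d hd => by simpa using hd),
    sum_const_nat (m := 2), mul_comm]
  intro ε hε
  obtain ⟨e, rfl⟩ := M.edge_surjective ε
  have : (({d : D | M.edge d ∈ S} : Finset D).filter fun d => M.edge d = M.edge e)
      = {e, M.rev e} := by
    ext d
    simp only [mem_filter, mem_univ, true_and, mem_insert, mem_singleton]
    constructor
    · rintro ⟨-, h⟩; exact M.edge_eq_iff.1 h.symm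
    · intro h
      have := (M.edge_eq_iff.2 h)
      exact ⟨by rw [← this]; exact hε, this.symm⟩
  rw [this, card_pair (M.rev_ne e).symm]

theorem card_filter_face (S : Finset M.Face) :
    #{d : D | M.face d ∈ S} = 3 * #S := by
  rw [card_eq_sum_card_fiberwise (f := M.face) (t := S) (fun d hd => by simpa using hd),
    sum_const_nat (m := 3), mul_comm]
  intro ε hε
  obtain ⟨e, rfl⟩ := M.face_surjective ε
  have : (({d : D | M.face d ∈ S} : Finset D).filter fun d => M.face d = M.face e)
      = {e, M.next e, M.next (M.next e)} := by
    ext d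
    simp only [mem_filter, mem_univ, true_and, mem_insert, mem_singleton]
    constructor
    · rintro ⟨-, h⟩; exact M.face_eq_iff.1 h.symm
    · intro h
      have := (M.face_eq_iff.2 h)
      exact ⟨by rw [← this]; exact hε, this.symm⟩
  rw [this, card_eq_three]
  exact ⟨_, _, _, (M.next_ne e).symm, (M.next_next_ne e).symm,
    (M.next_ne _).symm, rfl⟩

theorem sum_star {A : Type*} [AddCommMonoid A] (h : D → A) (e : D) :
    ∑ d with M.tail d = M.tail e, h d = ∑ i ∈ range (M.valence e), h (M.rot^[i] e) := by
  symm
  refine sum_bij (fun i _ => M.rot^[i] e) (fun i _ => by simp [tail_rot_iterate])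
    (fun i hi j hj hij => M.rot_iterate_injOn e (by simpa using hi) (by simpa using hj) hij)
    (fun d hd => ?_) fun _ _ => rfl
  obtain ⟨i, hi, rfl⟩ := M.exists_rot_of_tail_eq (by simpa using (mem_filter.1 hd).2.symm)
  exact ⟨i, by simpa using hi, rfl⟩

/-- Counting darts by edges and by triangles gives `2E = 3F`, and the Euler characteristic does the
rest. -/
theorem IsClosedOfGenus.card_edge {M : Triangulation D} {g : ℕ} (hM : M.IsClosedOfGenus g) :
    (Nat.card M.Edge : ℤ) = 3 * Nat.card M.Vertex + 6 * g - 6 ∧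
      (Fintype.card D : ℤ) = 6 * Nat.card M.Vertex + 12 * g - 12 := by
  have h1 : Fintype.card D = 2 * Nat.card M.Edge := by
    have := M.card_filter_edge univ
    simpa [Nat.card_eq_fintype_card] using this
  have h2 : Fintype.card D = 3 * Nat.card M.Face := by
    have := M.card_filter_face univ
    simpa [Nat.card_eq_fintype_card] using this
  have h3 := hM.2.2
  omega

end Triangulation

/-! ### Distance levels and recursion along trees -/

theorem exists_level {α : Type*} (r : α → α → Prop) (S : Set α) :
    ∃ l : α → ℕ, ∀ a, (∃ s ∈ S, Relation.ReflTransGen r s a) → a ∉ S → ∃ b, r b a ∧ l b < l a := by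
  classical
  -- `R n` is the set of points reached from `S` in at most `n` steps. The level is the first such
  -- `n`, with the dummy value `0` for unreachable points.
  let R : ℕ → Set α := fun n => Nat.rec (motive := fun _ => Set α) S
    (fun _ T => T ∪ {a | ∃ b ∈ T, r b a}) n
  have hR : ∀ a, (∃ s ∈ S, Relation.ReflTransGen r s a) → ∃ n, a ∈ R n := by
    rintro a ⟨s, hs, h⟩
    induction h with
    | refl => exact ⟨0, hs⟩
    | tail _ h ih =>
      obtain ⟨n, hn⟩ := ih
      exact ⟨n + 1, Or.inr ⟨_, hn, h⟩⟩
  refine ⟨fun a => if h : ∃ n : ℕ, a ∈ R n then Nat.find h else 0, fun a ha haS => ?_⟩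
  have h := hR a ha
  simp only [h, dif_pos]
  obtain ⟨n, hn⟩ : ∃ n, Nat.find h = n + 1 := by
    refine Nat.exists_eq_succ_of_ne_zero fun h0 => haS ?_
    have := Nat.find_spec h
    rw [h0] at this
    exact this
  have h1 := Nat.find_spec h
  rw [hn] at h1
  rcases h1 with h1 | ⟨b, hb, hba⟩
  · exact absurd (Nat.find_min' h h1) (by omega)
  · refine ⟨b, hba, ?_⟩
    have hb' : ∃ n, b ∈ R n := ⟨n, hb⟩
    simp only [hb', dif_pos, hn]
    exact Nat.lt_succ_of_le (Nat.find_min' hb' hb)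

/-- Recursion from parent `p s` to child `s`, well founded because the level drops. Where the level
does not drop, `y₀` is a dummy value. -/
theorem exists_tree_rec {S Y : Type*} (l : S → ℕ) (p : S → S) (step : S → Y → Y) (s₀ : S)
    (y₀ : Y) : ∃ u : S → Y, u s₀ = y₀ ∧ ∀ s, s ≠ s₀ → l (p s) < l s → u s = step s (u (p s)) := by
  classical
  let F : ∀ s : S, (∀ t, l t < l s → Y) → Y := fun s rec =>
    if s = s₀ then y₀ else if h : l (p s) < l s then step s (rec (p s) h) else y₀
  have hwf : WellFounded fun t s : S => l t < l s := (measure l).wf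
  refine ⟨hwf.fix F, ?_, fun s hs h => ?_⟩
  · rw [hwf.fix_eq]; simp [F]
  · rw [hwf.fix_eq]; simp [F, hs, h]

/-! ## Sign patterns -/

/-- Twice the weight of a corner whose sides carry the signs `a` and `b`. -/
def cornerWeight (a b : SignType) : ℕ :=
  if a = 0 ∧ b = 0 then 2 else if a = b then 0 else if a = 0 ∨ b = 0 then 1 else 2

/-- If all signs are non-zero, the product of the three corner products is `-(abc)²`, so an odd
number of corners have opposite signs and at least one counts `2`. A vanishing side contributes at
least `1` at a corner for each of its two ends, and `2` if the corner is shared with another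
vanishing side. -/
theorem two_le_cornerWeight_triangle (a b c : SignType) :
    2 ≤ cornerWeight a (-c) + cornerWeight b (-a) + cornerWeight c (-b) := by
  revert a b c; decide

theorem two_le_cornerWeight_edge (a : SignType) :
    2 ≤ cornerWeight a 0 + cornerWeight 0 (-a) := by
  revert a; decide

/-- A set of vertices of a triangulated surface, together with signs on its oriented edges that are
odd, vanish on the edges leaving the set, and for which the corners at every vertex of the set have
small weight. The set is minimal. -/
structure SignPattern {D : Type*} [Fintype D] (M : Triangulation D) (f : D → SignType)
    (W : Set M.Vertex) : Prop where
  odd : ∀ d, f (M.rev d) = -f d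
  nonempty : W.Nonempty
  leaving : ∀ d, M.tail d ∈ W → M.head d ∉ W → f d = 0
  weight : ∀ d, M.tail d ∈ W →
    ∑ i ∈ Finset.range (M.valence d), cornerWeight (f (M.rot^[i] d)) (f (M.rot (M.rot^[i] d))) ≤ 4
  -- Minimality plays the role of connectedness: the vertices of `W` in one component of its star
  -- satisfy the leaving condition again.
  minimal : ∀ W' ⊆ W, W'.Nonempty → (∀ d, M.tail d ∈ W' → M.head d ∉ W' → f d = 0) → W' = W

namespace SignPattern

open Classical Finset Triangulation

variable {D : Type*} [Fintype D] {M : Triangulation D} {f : D → SignType} {W : Set M.Vertex}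

/-- The triangle on the left of `d` has a vertex in `W`. -/
def Touches (M : Triangulation D) (W : Set M.Vertex) (d : D) : Prop :=
  M.tail d ∈ W ∨ M.head d ∈ W ∨ M.head (M.next d) ∈ W

/-- The edge `d` has a vertex in `W`. -/
def EdgeTouches (M : Triangulation D) (W : Set M.Vertex) (d : D) : Prop :=
  M.tail d ∈ W ∨ M.head d ∈ W

omit [Fintype D] in
theorem EdgeTouches.touches {d : D} (h : EdgeTouches M W d) : Touches M W d := by
  rcases h with h | h
  · exact Or.inl h
  · exact Or.inr (Or.inl h)

omit [Fintype D] in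
theorem touches_next {d : D} : Touches M W (M.next d) ↔ Touches M W d := by
  rw [Touches, Touches, tail_next, head_next_next]; tauto

omit [Fintype D] in
theorem edgeTouches_rev {d : D} : EdgeTouches M W (M.rev d) ↔ EdgeTouches M W d := by
  rw [EdgeTouches, EdgeTouches, head_rev, ← head_eq]; tauto

omit [Fintype D] in
theorem touches_of_face_eq {d d' : D} (h : M.face d = M.face d') :
    Touches M W d ↔ Touches M W d' := by
  rcases M.face_eq_iff.1 h with rfl | rfl | rfl
  · rfl
  · rw [touches_next]
  · rw [touches_next, touches_next]

omit [Fintype D] in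
theorem edgeTouches_of_edge_eq {d d' : D} (h : M.edge d = M.edge d') :
    EdgeTouches M W d ↔ EdgeTouches M W d' := by
  rcases M.edge_eq_iff.1 h with rfl | rfl
  · rfl
  · rw [edgeTouches_rev]

/-- Double counting of corner weights at vertices of `W`: each vertex receives at most `4`, and each
triangle touching `W` supplies at least `2`. So there are at most two triangles per vertex of `W`,
each counted here with its three darts. -/
theorem card_touches_le (h : SignPattern M f W) :
    #{d : D | Touches M W d} ≤ 6 * #{v : M.Vertex | v ∈ W} := by
  set c : D → ℕ := fun d => if M.tail d ∈ W then cornerWeight (f d) (f (M.rot d)) else 0 with hc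
  have h1 : ∑ d with Touches M W d, c d ≤ 4 * #{v : M.Vertex | v ∈ W} := by
    have h2 : ∑ d with Touches M W d, c d = ∑ d with M.tail d ∈ W, c d := by
      symm
      refine sum_subset (fun d hd => ?_) fun d _ hd => ?_
      · simp only [mem_filter, mem_univ, true_and] at hd ⊢
        exact Or.inl hd
      · simp only [mem_filter, mem_univ, true_and] at hd
        simp [hc, hd]
    rw [h2, ← sum_fiberwise_of_maps_to (g := M.tail) (t := ({v : M.Vertex | v ∈ W} : Finset _))
      (fun d hd => by simpa using hd), mul_comm, ← smul_eq_mul]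
    refine sum_le_card_nsmul _ _ _ fun v hv => ?_
    obtain ⟨e, rfl⟩ := M.tail_surjective v
    have hv' : M.tail e ∈ W := by simpa using hv
    refine le_trans (le_of_eq ?_) (h.weight e hv')
    rw [← M.sum_star (fun d => cornerWeight (f d) (f (M.rot d))) e]
    have : (({d : D | M.tail d ∈ W} : Finset D).filter fun d => M.tail d = M.tail e)
        = ({d : D | M.tail d = M.tail e} : Finset D) := by
      ext d
      simp only [mem_filter, mem_univ, true_and, and_iff_right_iff_imp]
      intro hd; rw [hd]; exact hv'
    rw [this]
    refine sum_congr rfl fun d hd => ?_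
    have hd' : M.tail d = M.tail e := by simpa using hd
    simp only [hc, hd', hv', if_true]
  have hinv : ∀ c : D → ℕ, ∑ d with Touches M W d, c (M.next d) = ∑ d with Touches M W d, c d :=
    fun c => by
    refine sum_equiv M.next (fun d => ?_) fun _ _ => rfl
    simp [touches_next]
  have h3 : ∑ d with Touches M W d, (c d + c (M.next d) + c (M.next (M.next d)))
      = 3 * ∑ d with Touches M W d, c d := by
    rw [sum_add_distrib, sum_add_distrib, hinv c, hinv fun d => c (M.next d), hinv c]; ring
  have h4 : 2 * #{d : D | Touches M W d} ≤
      ∑ d with Touches M W d, (c d + c (M.next d) + c (M.next (M.next d))) := by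
    rw [mul_comm, ← smul_eq_mul]
    refine card_nsmul_le_sum _ _ _ fun d hd => ?_
    have hd' : Touches M W d := by simpa using hd
    have r1 : f (M.rot d) = -f (M.next (M.next d)) := by rw [rot_apply, h.odd]
    have r2 : f (M.rot (M.next d)) = -f d := by rw [rot_next, h.odd]
    have r3 : f (M.rot (M.next (M.next d))) = -f (M.next d) := by rw [rot_next, h.odd]
    -- By oddness the signs vanish on the edges with exactly one end in `W`, in either orientation.
    have l1 : ∀ d, ¬ (M.tail d ∈ W ↔ M.head d ∈ W) → f d = 0 := fun d hd => by
      by_cases ht : M.tail d ∈ W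
      · exact h.leaving d ht fun hh => hd ⟨fun _ => hh, fun _ => ht⟩
      · have := h.leaving (M.rev d) (by rw [← head_eq]; tauto) (by rw [head_rev]; exact ht)
        rw [h.odd] at this
        simpa using this
    have hh0 : M.tail (M.next d) = M.head d := M.tail_next d
    have hh1 : M.tail (M.next (M.next d)) = M.head (M.next d) := M.tail_next _
    have hh2 : M.head (M.next (M.next d)) = M.tail d := M.head_next_next d
    have e0 := l1 d
    have e1 := l1 (M.next d)
    have e2 := l1 (M.next (M.next d))
    rw [hh0] at e1
    rw [hh1, hh2] at e2
    simp only [hc, r1, r2, r3, hh0, hh1]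
    have t0 := two_le_cornerWeight_triangle (f d) (f (M.next d)) (f (M.next (M.next d)))
    have t1 := two_le_cornerWeight_edge (f d)
    have t2 := two_le_cornerWeight_edge (f (M.next d))
    have t3 := two_le_cornerWeight_edge (f (M.next (M.next d)))
    have t00 : cornerWeight 0 0 = 2 := rfl
    rw [Touches] at hd'
    -- With three vertices in `W` the triangle inequality `t0` applies. With two, only their common
    -- side may carry a sign and one of `t1`, `t2`, `t3` applies. With one, its corner lies between
    -- two zeros.
    by_cases a : M.tail d ∈ W <;> by_cases b : M.head d ∈ W <;>
      by_cases c : M.head (M.next d) ∈ W <;>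
      simp only [a, b, c, iff_true, iff_false, not_true_eq_false,
        not_false_eq_true, forall_const, or_self, or_true, true_or, if_true, if_false,
        false_implies] at * <;>
      first
      | omega
      | (simp only [e0, e1, e2, neg_zero] at *; omega)
  omega

variable (h : SignPattern M f W)

include h in
/-- Auxiliary data of a sign pattern: a forest of edges joining the vertices of `W` to the
complement of `W`, and a tree of edges joining the triangles that touch `W`. -/
theorem exists_trees (hM : M.IsConnected) (hW : ∃ v, v ∉ W) {d₀ : D} (hd₀ : M.tail d₀ ∈ W) :
    ∃ (l : M.Vertex → ℕ) (π : M.Vertex → D) (k : M.Face → ℕ) (b : M.Face → D),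
      (∀ v ∈ W, M.tail (π v) = v ∧ l (M.head (π v)) < l v) ∧
      b (M.face d₀) = d₀ ∧
      (∀ d, Touches M W d → M.face (b (M.face d)) = M.face d) ∧
      (∀ d, Touches M W d → M.face d ≠ M.face d₀ →
        EdgeTouches M W (b (M.face d)) ∧
        k (M.face (M.rev (b (M.face d)))) < k (M.face d) ∧
        ∀ v ∈ W, M.edge (π v) ≠ M.edge (b (M.face d))) := by
  obtain ⟨v₀, hv₀⟩ := hW
  -- The level `l` is the distance to the complement of `W`, and `π v` is an edge from `v` to a
  -- lower level: these edges form the forest.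
  obtain ⟨l, hl⟩ := exists_level (fun v w : M.Vertex => ∃ d, M.tail d = v ∧ M.head d = w) Wᶜ
  have hpi : ∀ v : M.Vertex, ∃ d, v ∈ W → M.tail d = v ∧ l (M.head d) < l v := fun v => by
    by_cases hv : v ∈ W
    · have hreach : Relation.ReflTransGen
          (fun v w : M.Vertex => ∃ d, M.tail d = v ∧ M.head d = w) v₀ v :=
        hM.vertex_induction (P := fun v => Relation.ReflTransGen
          (fun v w : M.Vertex => ∃ d, M.tail d = v ∧ M.head d = w) v₀ v) .refl
          (fun e he => he.tail ⟨e, rfl, rfl⟩) v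
      obtain ⟨w, ⟨d, hd1, hd2⟩, hw⟩ := hl v ⟨v₀, hv₀, hreach⟩ (by simpa using hv)
      exact ⟨M.rev d, fun _ => ⟨by rw [← head_eq, hd2], by rw [head_rev, hd1]; exact hw⟩⟩
    · exact ⟨d₀, fun hv' => (hv hv').elim⟩
  choose π hπ using hpi
  let P : D → Prop := fun d => ∃ v ∈ W, M.edge (π v) = M.edge d
  -- Adjacency of triangles across an edge of the star that does not belong to the forest.
  let r : M.Face → M.Face → Prop := fun τ τ' => ∃ d, EdgeTouches M W d ∧ ¬ P d ∧
    M.face (M.rev d) = τ ∧ M.face d = τ'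
  have hPrev : ∀ d, P (M.rev d) ↔ P d := fun d => by simp only [P, edge_rev]
  have hrsymm : ∀ τ τ', r τ τ' → r τ' τ := by
    rintro τ τ' ⟨d, h1, h2, h3, h4⟩
    exact ⟨M.rev d, edgeTouches_rev.2 h1, by rwa [hPrev], by rwa [M.rev_rev], h3⟩
  let C : D → D → Prop := fun d d' => Relation.ReflTransGen r (M.face d) (M.face d')
  have hCsymm : ∀ d d', C d d' → C d' d := fun d d' hd =>
    haveI : Std.Symm r := ⟨hrsymm⟩
    Relation.ReflTransGen.stdSymm.symm _ _ hd
  -- All triangles at `v` are joined without crossing the forest, by induction from high levels to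
  -- low ones. Turning around `v`, every edge except `π v` can be passed: directly if it is not in
  -- the forest, and if it is `π w` with `l v < l w`, by going around its other end `w`.
  have hClaim1 : ∀ n, ∀ v ∈ W, univ.sup l - l v = n → ∀ d d', M.tail d = v → M.tail d' = v →
      C d d' := by
    intro n
    induction n using Nat.strong_induction_on with
    | _ n ih =>
      intro v hv hn
      have hstep : ∀ d, M.tail d = v → d ≠ π v → C (M.rev d) d := fun d hd hne => by
        by_cases hP : P d
        · obtain ⟨w, hw, hwd⟩ := hP
          rcases M.edge_eq_iff.1 hwd with h1 | h1
          · exact (hne (by rw [h1, (hπ w hw).1] at hd; rw [h1, hd])).elim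
          · have h2 : M.rev d = π w := by rw [h1, M.rev_rev]
            have h3 : l v < l w := by
              have := (hπ w hw).2
              rwa [← h2, head_rev, hd] at this
            have h4 : M.tail (M.rev d) = w := by rw [h2]; exact (hπ w hw).1
            have h5 : l w ≤ univ.sup l := le_sup (mem_univ w)
            have := ih (univ.sup l - l w) (by omega) w hw rfl (M.rev d) (M.next d) h4
              (by rw [tail_next, head_eq, h4])
            simpa only [C, face_next] using this
        · exact .single ⟨d, Or.inl (hd ▸ hv), hP, rfl, rfl⟩
      have hfrom : ∀ i < M.valence (π v), C (π v) (M.rot^[i] (π v)) := fun i => by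
        induction i with
        | zero => exact fun _ => .refl
        | succ i ih' =>
          intro hi
          refine (ih' (by omega)).trans ?_
          have h1 : C (M.rev (M.rot^[i+1] (π v))) (M.rot^[i+1] (π v)) :=
            hstep _ (by rw [tail_rot_iterate, (hπ v hv).1]) fun he => by
              have := M.rot_iterate_injOn (π v) (i := i + 1) (j := 0) hi (by omega) he
              omega
          have h2 : M.face (M.rev (M.rot^[i+1] (π v))) = M.face (M.rot^[i] (π v)) := by
            rw [Function.iterate_succ_apply', rot_apply, M.rev_rev, face_next, face_next]
          simpa only [C, h2] using h1
      intro d d' hd hd'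
      have hall : ∀ d, M.tail d = v → C (π v) d := fun d hd => by
        obtain ⟨i, hi, rfl⟩ := M.exists_rot_of_tail_eq ((hπ v hv).1.trans hd.symm)
        exact hfrom i hi
      exact (hCsymm _ _ (hall d hd)).trans (hall d' hd')
  have hstar : ∀ d d', M.tail d ∈ W → M.tail d' = M.tail d → C d d' := fun d d' hd hd' =>
    hClaim1 _ _ hd rfl d d' rfl hd'
  have hcross : ∀ d, EdgeTouches M W d → C (M.rev d) d := fun d hd => by
    rcases hd with hd | hd
    · have := hstar d (M.next (M.rev d)) hd (by rw [tail_next, head_rev])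
      exact hCsymm _ _ (by simpa only [C, face_next] using this)
    · have := hstar (M.rev d) (M.next d) hd (by rw [tail_next, head_eq])
      simpa only [C, face_next] using this
  -- The vertices whose triangles lie in the component of `d₀` satisfy the leaving condition: across
  -- an edge with non-zero sign lies a vertex of `W`, whose triangles are in the same component.
  have hW1 : {v ∈ W | ∀ d, M.tail d = v → C d₀ d} = W := by
    refine h.minimal _ (fun v hv => hv.1) ⟨M.tail d₀, hd₀, fun d hd => hstar d₀ d hd₀ hd⟩
      fun d hd hd' => ?_
    refine h.leaving d hd.1 fun hh => hd' ⟨hh, fun e he => ?_⟩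
    have h1 : C d₀ d := hd.2 d rfl
    have h2 : C (M.rev d) d := hcross d (Or.inl hd.1)
    exact (h1.trans (hCsymm _ _ h2)).trans (hstar _ e hh he)
  have hconn : ∀ d, Touches M W d → C d₀ d := fun d hd => by
    have h1 : ∀ d, M.tail d ∈ W → C d₀ d := fun d hd => by
      rw [← hW1] at hd; exact hd.2 d rfl
    rcases hd with hd | hd | hd
    · exact h1 d hd
    · have := h1 (M.next d) (by rwa [tail_next])
      simpa only [C, face_next] using this
    · have := h1 (M.next (M.next d)) (by rwa [tail_next])
      simpa only [C, face_next] using this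
  -- The tree of triangles: `b τ` is the side of `τ`, with `τ` on its left, that leads to a triangle
  -- of lower level. At the root it has the conventional value `d₀`.
  obtain ⟨k, hk⟩ := exists_level r {M.face d₀}
  have hb : ∀ τ : M.Face, ∃ e, (τ = M.face d₀ → e = d₀) ∧
      ∀ d, M.face d = τ → Touches M W d → M.face e = τ ∧ (τ ≠ M.face d₀ →
        EdgeTouches M W e ∧ k (M.face (M.rev e)) < k τ ∧ ¬ P e) := fun τ => by
    by_cases hτ : τ = M.face d₀
    · exact ⟨d₀, fun _ => rfl, fun d _ _ => ⟨hτ.symm, fun h => (h hτ).elim⟩⟩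
    · by_cases ht : ∃ d, M.face d = τ ∧ Touches M W d
      · obtain ⟨d, rfl, hd⟩ := ht
        obtain ⟨σ, ⟨e, e1, e2, e3, e4⟩, hσ⟩ := hk (M.face d) ⟨_, rfl, hconn d hd⟩ hτ
        exact ⟨e, fun h => (hτ h).elim, fun _ _ _ => ⟨e4, fun _ => ⟨e1, by rw [e3]; exact hσ, e2⟩⟩⟩
      · exact ⟨d₀, fun h => (hτ h).elim, fun d h1 h2 => (ht ⟨d, h1, h2⟩).elim⟩
  choose b hb using hb
  refine ⟨l, π, k, b, hπ, (hb _).1 rfl, fun d hd => ((hb _).2 d rfl hd).1, fun d hd hne => ?_⟩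
  obtain ⟨h1, h2, h3⟩ := ((hb _).2 d rfl hd).2 hne
  exact ⟨h1, h2, fun v hv he => h3 ⟨v, hv, he⟩⟩

end SignPattern

end CirclePacking

namespace CirclePacking

/-! ### Lifting the star of the set to the universal covering -/

namespace UniversalCovering

open Triangulation

variable {D D' : Type*} {M : Triangulation D} (U : UniversalCovering M D')

theorem eq_of_face_eq {x y : D'} (h : U.cover.face x = U.cover.face y)
    (hp : U.proj x = U.proj y) : x = y := by
  rcases U.cover.face_eq_iff.1 h with rfl | rfl | rfl
  · rfl
  · rw [U.proj_next] at hp; exact (M.next_ne _ hp.symm).elim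
  · rw [U.proj_next, U.proj_next] at hp; exact (M.next_next_ne _ hp.symm).elim

theorem exists_of_face_eq {x : D'} {d : D} (h : M.face (U.proj x) = M.face d) :
    ∃ y, U.cover.face y = U.cover.face x ∧ U.proj y = d := by
  rcases M.face_eq_iff.1 h with rfl | rfl | rfl
  · exact ⟨x, rfl, rfl⟩
  · exact ⟨U.cover.next x, by rw [face_next], U.proj_next _⟩
  · exact ⟨U.cover.next (U.cover.next x), by rw [face_next, face_next],
      by rw [U.proj_next, U.proj_next]⟩

end UniversalCovering

namespace SignPattern

open Classical Finset Triangulation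

variable {D D' : Type*} [Fintype D] {M : Triangulation D} {f : D → SignType} {W : Set M.Vertex}

/-- The edges without vertices in `W` of the triangles with a vertex in `W`, oriented in such a way
that the triangle is on the left. -/
def Boundary (M : Triangulation D) (W : Set M.Vertex) (d : D) : Prop :=
  M.tail d ∉ W ∧ M.head d ∉ W ∧ M.head (M.next d) ∈ W

theorem card_touches :
    #{d : D | Touches M W d} = 3 * #{τ : M.Face | ∃ d, M.face d = τ ∧ Touches M W d} := by
  rw [← card_filter_face]
  congr 1
  ext d
  simp only [mem_filter, mem_univ, true_and]
  exact ⟨fun h => ⟨d, rfl, h⟩, fun ⟨d', h, h'⟩ => (touches_of_face_eq h).1 h'⟩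

theorem card_edgeTouches :
    #{d : D | EdgeTouches M W d} = 2 * #{ε : M.Edge | ∃ d, M.edge d = ε ∧ EdgeTouches M W d} := by
  rw [← card_filter_edge]
  congr 1
  ext d
  simp only [mem_filter, mem_univ, true_and]
  exact ⟨fun h => ⟨d, rfl, h⟩, fun ⟨d', h, h'⟩ => (edgeTouches_of_edge_eq h).1 h'⟩

theorem card_touches_eq_add :
    #{d : D | Touches M W d} = #{d : D | EdgeTouches M W d} + #{d : D | Boundary M W d} := by
  have h1 : Disjoint ({d : D | EdgeTouches M W d} : Finset D)
      ({d : D | Boundary M W d} : Finset D) := by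
    rw [disjoint_filter]
    intro d _ h1 h2
    rcases h1 with h1 | h1
    · exact h2.1 h1
    · exact h2.2.1 h1
  rw [← card_union_of_disjoint h1]
  congr 1
  ext d
  simp only [mem_filter, mem_univ, true_and, mem_union]
  simp only [Touches, EdgeTouches, Boundary]
  tauto

variable (h : SignPattern M f W)

include h in
/-- The union of the open stars of the vertices in `W` lifts to the universal covering, unless it
has no boundary. -/
theorem exists_lift (hM : M.IsConnected) (hW : ∃ v, v ∉ W) (U : UniversalCovering M D')
    (hB : ∃ d, Boundary M W d) :
    #{d : D | Boundary M W d} ≤ 2 ∧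
    ∃ L : D → D', (∀ d, Touches M W d → U.proj (L d) = d) ∧
      (∀ d, Touches M W d → L (M.next d) = U.cover.next (L d)) ∧
      ∀ d, EdgeTouches M W d → L (M.rev d) = U.cover.rev (L d) := by
  obtain ⟨v₀, hv₀⟩ := h.nonempty
  obtain ⟨d₀, rfl⟩ := M.tail_surjective v₀
  obtain ⟨l, π, k, b, hπ, hb0, hbf, hb⟩ := h.exists_trees hM hW hv₀
  have ht0 : Touches M W d₀ := Or.inl hv₀
  set S : Finset M.Face := {τ | ∃ d, M.face d = τ ∧ Touches M W d} with hS
  set E : Finset M.Edge := {ε | ∃ d, M.edge d = ε ∧ EdgeTouches M W d} with hE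
  set N : Finset M.Vertex := {v | v ∈ W} with hN
  have hSm : ∀ τ ∈ S.erase (M.face d₀), ∃ d, M.face d = τ ∧ Touches M W d ∧
      M.face d ≠ M.face d₀ := fun τ hτ => by
    obtain ⟨h1, h2⟩ := mem_erase.1 hτ
    obtain ⟨d, rfl, hd⟩ := (mem_filter.1 h2).2
    exact ⟨d, rfl, hd, h1⟩
  -- the two trees have disjoint edges
  have hinj1 : Set.InjOn (fun τ => M.edge (b τ)) (S.erase (M.face d₀)) := by
    intro τ hτ τ' hτ' heq
    obtain ⟨d, rfl, hd, hne⟩ := hSm τ hτ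
    obtain ⟨d', rfl, hd', hne'⟩ := hSm τ' hτ'
    rcases M.edge_eq_iff.1 heq with h1 | h1
    · rw [← hbf d hd, ← hbf d' hd', h1]
    · have h2 := (hb d hd hne).2.1
      have h3 := (hb d' hd' hne').2.1
      rw [← h1, hbf d' hd'] at h2
      rw [h1, M.rev_rev, hbf d hd] at h3
      omega
  have hinj2 : Set.InjOn (fun v => M.edge (π v)) N := by
    intro v hv w hw heq
    have hv : v ∈ W := by simpa [hN] using hv
    have hw : w ∈ W := by simpa [hN] using hw
    rcases M.edge_eq_iff.1 heq with h1 | h1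
    · rw [← (hπ v hv).1, ← (hπ w hw).1, h1]
    · have h2 := (hπ v hv).2
      have h3 := (hπ w hw).2
      rw [head_eq, ← h1, (hπ w hw).1] at h2
      rw [h1, head_rev, (hπ v hv).1] at h3
      omega
  have hdisj : Disjoint ((S.erase (M.face d₀)).image fun τ => M.edge (b τ))
      (N.image fun v => M.edge (π v)) := by
    rw [disjoint_left]
    intro ε h1 h2
    obtain ⟨τ, hτ, rfl⟩ := mem_image.1 h1
    obtain ⟨v, hv, hvε⟩ := mem_image.1 h2
    obtain ⟨d, rfl, hd, hne⟩ := hSm τ hτ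
    exact (hb d hd hne).2.2 v (by simpa [hN] using hv) hvε
  have hsub : ((S.erase (M.face d₀)).image fun τ => M.edge (b τ)) ∪
      (N.image fun v => M.edge (π v)) ⊆ E := by
    intro ε hε
    rcases mem_union.1 hε with h1 | h1
    · obtain ⟨τ, hτ, rfl⟩ := mem_image.1 h1
      obtain ⟨d, rfl, hd, hne⟩ := hSm τ hτ
      exact mem_filter.2 ⟨mem_univ _, _, rfl, (hb d hd hne).1⟩
    · obtain ⟨v, hv, rfl⟩ := mem_image.1 h1
      have hv : v ∈ W := by simpa [hN] using hv
      exact mem_filter.2 ⟨mem_univ _, _, rfl, Or.inl (by rw [(hπ v hv).1]; exact hv)⟩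
  have hcard : #(((S.erase (M.face d₀)).image fun τ => M.edge (b τ)) ∪
      (N.image fun v => M.edge (π v))) = #S - 1 + #N := by
    rw [card_union_of_disjoint hdisj, card_image_of_injOn hinj1, card_image_of_injOn hinj2,
      card_erase_of_mem (mem_filter.2 ⟨mem_univ _, _, rfl, ht0⟩)]
  have hSpos : 0 < #S := card_pos.2 ⟨M.face d₀, mem_filter.2 ⟨mem_univ _, _, rfl, ht0⟩⟩
  -- With `B` the number of boundary darts, `3#S = 2#E + B`. Disjointness of the two trees gives `#E
  -- ≥ #S - 1 + #N`, and the corner count gives `#S ≤ 2#N`. Together these force `B ≤ 2`.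
  have c1 := card_touches (M := M) (W := W)
  have c2 := card_edgeTouches (M := M) (W := W)
  have c3 := card_touches_eq_add (M := M) (W := W)
  have c4 := h.card_touches_le
  rw [← hS] at c1
  rw [← hE] at c2
  rw [← hN] at c4
  have c5 := card_le_card hsub
  rw [hcard] at c5
  have hB1 : 0 < #{d : D | Boundary M W d} := by
    obtain ⟨d, hd⟩ := hB
    exact card_pos.2 ⟨d, by simpa using hd⟩
  refine ⟨by omega, ?_⟩
  -- If `B > 0`, the inequalities above leave room only for equality: every edge of the star belongs
  -- to the tree of triangles or to the forest, as for an open disk.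
  have hEeq : ((S.erase (M.face d₀)).image fun τ => M.edge (b τ)) ∪
      (N.image fun v => M.edge (π v)) = E := eq_of_subset_of_card_le hsub (by rw [hcard]; omega)
  have hcases : ∀ d, EdgeTouches M W d →
      (∃ d', Touches M W d' ∧ M.face d' ≠ M.face d₀ ∧ M.edge (b (M.face d')) = M.edge d) ∨
        ∃ v ∈ W, M.edge (π v) = M.edge d := fun d hd => by
    have : M.edge d ∈ E := mem_filter.2 ⟨mem_univ _, _, rfl, hd⟩
    rw [← hEeq] at this
    rcases mem_union.1 this with h1 | h1
    · obtain ⟨τ, hτ, hτd⟩ := mem_image.1 h1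
      obtain ⟨d', rfl, hd', hne⟩ := hSm τ hτ
      exact Or.inl ⟨d', hd', hne, hτd⟩
    · obtain ⟨v, hv, hvd⟩ := mem_image.1 h1
      exact Or.inr ⟨v, by simpa [hN] using hv, hvd⟩
  -- lifting along the tree of triangles
  obtain ⟨e₀, he₀⟩ := U.proj_surjective d₀
  -- `u τ` is the lift of `b τ`, obtained from the lift of the parent triangle by crossing `b τ`. On
  -- triangles of the star the condition `hy` holds; the other branch is a dummy.
  obtain ⟨u, hu0, hu⟩ := exists_tree_rec k (fun τ => M.face (M.rev (b τ)))
    (fun τ (y : D') => if hy : ∃ x, U.cover.face x = U.cover.face y ∧ U.proj x = M.rev (b τ) then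
      U.cover.rev hy.choose else y) (M.face d₀) e₀
  have hu1 : ∀ n, ∀ d, Touches M W d → k (M.face d) = n → U.proj (u (M.face d)) = b (M.face d) ∧
      (M.face d ≠ M.face d₀ → U.cover.face (U.cover.rev (u (M.face d))) =
        U.cover.face (u (M.face (M.rev (b (M.face d)))))) := by
    intro n
    induction n using Nat.strong_induction_on with
    | _ n ih =>
      intro d hd hn
      by_cases hne : M.face d = M.face d₀
      · rw [hne, hu0, hb0]
        exact ⟨he₀, fun h => (h rfl).elim⟩
      · obtain ⟨h1, h2, -⟩ := hb d hd hne
        have h3 := hu _ hne h2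
        have h4 := (ih _ (by omega) (M.rev (b (M.face d))) (edgeTouches_rev.2 h1).touches rfl).1
        have hy : ∃ x, U.cover.face x = U.cover.face (u (M.face (M.rev (b (M.face d))))) ∧
            U.proj x = M.rev (b (M.face d)) := U.exists_of_face_eq (by
          rw [h4]; exact hbf _ (edgeTouches_rev.2 h1).touches)
        rw [dif_pos hy] at h3
        have h5 := hy.choose_spec
        rw [h3]
        refine ⟨by rw [U.proj_rev, h5.2, M.rev_rev], fun _ => ?_⟩
        rw [U.cover.rev_rev, h5.1]
  have hL : ∀ d, ∃ y, Touches M W d → U.cover.face y = U.cover.face (u (M.face d)) ∧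
      U.proj y = d := fun d => by
    by_cases hd : Touches M W d
    · obtain ⟨y, hy⟩ := U.exists_of_face_eq (x := u (M.face d)) (d := d)
        (by rw [(hu1 _ d hd rfl).1]; exact hbf d hd)
      exact ⟨y, fun _ => hy⟩
    · exact ⟨e₀, fun h => (hd h).elim⟩
  choose L hL using hL
  have hLp : ∀ d, Touches M W d → U.proj (L d) = d := fun d hd => (hL d hd).2
  have hLn : ∀ d, Touches M W d → L (M.next d) = U.cover.next (L d) := fun d hd =>
    U.eq_of_face_eq (by
      rw [(hL _ (touches_next.2 hd)).1, face_next, face_next, (hL d hd).1])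
      (by rw [hLp _ (touches_next.2 hd), U.proj_next, hLp d hd])
  refine ⟨L, hLp, hLn, ?_⟩
  have hsymm : ∀ d, L (M.rev d) = U.cover.rev (L d) → L (M.rev (M.rev d)) =
      U.cover.rev (L (M.rev d)) := fun d hd => by rw [hd, M.rev_rev, U.cover.rev_rev]
  have hofedge : ∀ d d', M.edge d = M.edge d' → L (M.rev d) = U.cover.rev (L d) →
      L (M.rev d') = U.cover.rev (L d') := fun d d' he hd => by
    rcases M.edge_eq_iff.1 he with rfl | rfl
    · exact hd
    · exact hsymm _ hd
  have hLb : ∀ d, Touches M W d → M.face d ≠ M.face d₀ →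
      L (M.rev (b (M.face d))) = U.cover.rev (L (b (M.face d))) := fun d hd hne => by
    obtain ⟨h1, h2, -⟩ := hb d hd hne
    have h3 : L (b (M.face d)) = u (M.face d) := U.eq_of_face_eq
      (by rw [(hL _ h1.touches).1, hbf d hd]) (by rw [hLp _ h1.touches, (hu1 _ d hd rfl).1])
    have h4 := (edgeTouches_rev.2 h1).touches
    refine U.eq_of_face_eq ?_ (by rw [hLp _ h4, U.proj_rev, hLp _ h1.touches])
    rw [(hL _ h4).1, h3, (hu1 _ d hd rfl).2 hne]
  -- lifting across the remaining edges, by going around the vertices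
  have hLπ : ∀ n, ∀ v ∈ W, univ.sup l - l v = n → L (M.rev (π v)) = U.cover.rev (L (π v)) := by
    intro n
    induction n using Nat.strong_induction_on with
    | _ n ih =>
      intro v hv hn
      have htl : ∀ i, M.tail (M.rot^[i] (π v)) = v := fun i => by
        rw [tail_rot_iterate, (hπ v hv).1]
      have hto : ∀ i, Touches M W (M.rot^[i] (π v)) := fun i => Or.inl (by rw [htl]; exact hv)
      have hco : ∀ i, 0 < i → i < M.valence (π v) →
          L (M.rev (M.rot^[i] (π v))) = U.cover.rev (L (M.rot^[i] (π v))) := fun i hi0 hi => by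
        rcases hcases (M.rot^[i] (π v)) (Or.inl (by rw [htl]; exact hv)) with
          ⟨d', hd', hne, he⟩ | ⟨w, hw, he⟩
        · exact hofedge _ _ he (hLb d' hd' hne)
        · refine hofedge _ _ he ?_
          rcases M.edge_eq_iff.1 he with h1 | h1
          · have h2 : v = w := by rw [← htl i, h1, (hπ w hw).1]
            subst h2
            have := M.rot_iterate_injOn (π v) (i := i) (j := 0) hi (by omega) h1
            omega
          · have h3 : l v < l w := by
              have h2 := (hπ w hw).2
              rwa [head_eq, ← h1, htl] at h2
            have h5 : l w ≤ univ.sup l := le_sup (mem_univ w)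
            exact ih (univ.sup l - l w) (by omega) w hw rfl
      have hrot2 : ∀ i, U.cover.rot (L (M.rot^[i] (π v))) =
          U.cover.rev (L (M.next (M.next (M.rot^[i] (π v))))) := fun i => by
        rw [rot_apply, hLn _ (touches_next.2 (hto i)), hLn _ (hto i)]
      have hrev : ∀ i, M.next (M.next (M.rot^[i] (π v))) = M.rev (M.rot^[i+1] (π v)) := fun i => by
        rw [Function.iterate_succ_apply', rot_apply, M.rev_rev]
      have hit : ∀ i < M.valence (π v), L (M.rot^[i] (π v)) = U.cover.rot^[i] (L (π v)) :=
        fun i => by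
        induction i with
        | zero => exact fun _ => rfl
        | succ i ih' =>
          intro hi
          rw [Function.iterate_succ_apply' U.cover.rot, ← ih' (by omega), hrot2, hrev,
            hco (i + 1) (by omega) hi, U.cover.rev_rev]
      have hk := M.valence_pos (π v)
      obtain ⟨m, hm⟩ := Nat.exists_eq_add_of_lt hk
      rw [zero_add] at hm
      have h1 := hit m (by omega)
      -- All edges at `v` except `π v` have been glued, and `m` is the valence minus one. The
      -- covering is unbranched, so the fan of lifted triangles closes up after a full turn, which
      -- is the gluing across `π v`.
      have h2 : U.cover.rot (L (M.rot^[m] (π v))) = L (π v) := by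
        have h3 := U.cover.rot_iterate_valence (L (π v))
        rw [← U.valence_proj, hLp (π v) (hto 0), hm, Function.iterate_succ_apply'] at h3
        rw [h1, h3]
      rw [hrot2, hrev, ← hm, M.rot_iterate_valence] at h2
      rw [← h2, U.cover.rev_rev]
  intro d hd
  rcases hcases d hd with ⟨d', hd', hne, he⟩ | ⟨w, hw, he⟩
  · exact hofedge _ _ he (hLb d' hd' hne)
  · exact hofedge _ _ he (hLπ _ w hw rfl)

include h in
-- The star lifts and has at most two boundary darts. Their lifts form a closed path; without loops
-- and parallel edges it must run along one edge and back. Then turning around an end of this edge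
-- inside the star makes a full turn.
theorem touches_of_boundary (hM : M.IsConnected) (hW : ∃ v, v ∉ W) (U : UniversalCovering M D')
    (hU : U.cover.IsSimplicial) {d : D} (hd : Boundary M W d) {e : D} (he : M.tail e = M.head d) :
    Touches M W e := by
  obtain ⟨hcard, L, hLp, hLn, hLr⟩ := h.exists_lift hM hW U ⟨d, hd⟩
  -- The predecessor of `d` along the boundary: rotate around the tail of `d` through the star up to
  -- the first edge that does not lead to `W`, and reverse that edge. If the result is `d` reversed,
  -- the rotation ran through the whole valence.
  have hnu : ∀ d, Boundary M W d → ∃ d', Boundary M W d' ∧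
      U.cover.head (L d') = U.cover.tail (L d) ∧
      (M.rev d' = d → ∀ e, M.tail e = M.tail d → Touches M W e) := fun d hd => by
    have hP : ∃ n, 0 < n ∧ M.head (M.rot^[n] d) ∉ W :=
      ⟨M.valence d, M.valence_pos d, by rw [M.rot_iterate_valence]; exact hd.2.1⟩
    set n := Nat.find hP with hn
    obtain ⟨hn0, hn1⟩ := Nat.find_spec hP
    have hmin : ∀ i, 0 < i → i < n → M.head (M.rot^[i] d) ∈ W := fun i hi0 hi => by
      by_contra hc
      exact Nat.find_min hP hi ⟨hi0, hc⟩
    have h1 : M.head (M.rot d) ∈ W := by rw [head_rot]; exact hd.2.2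
    have hn2 : 1 < n := by
      rcases Nat.lt_or_ge 1 n with h2 | h2
      · exact h2
      · have : n = 1 := by omega
        rw [← hn, this] at hn1
        exact (hn1 h1).elim
    have hto : ∀ i, i < n → Touches M W (M.rot^[i] d) := fun i hi => by
      rcases Nat.eq_zero_or_pos i with rfl | hi0
      · exact Or.inr (Or.inr hd.2.2)
      · exact Or.inr (Or.inl (hmin i hi0 hi))
    have hrot2 : ∀ i < n, U.cover.rot (L (M.rot^[i] d)) =
        U.cover.rev (L (M.next (M.next (M.rot^[i] d)))) := fun i hi => by
      rw [rot_apply, hLn _ (touches_next.2 (hto i hi)), hLn _ (hto i hi)]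
    have hrev : ∀ i, M.next (M.next (M.rot^[i] d)) = M.rev (M.rot^[i+1] d) := fun i => by
      rw [Function.iterate_succ_apply', rot_apply, M.rev_rev]
    have hit : ∀ i < n, L (M.rot^[i] d) = U.cover.rot^[i] (L d) := fun i => by
      induction i with
      | zero => exact fun _ => rfl
      | succ i ih' =>
        intro hi
        rw [Function.iterate_succ_apply' U.cover.rot, ← ih' (by omega), hrot2 i (by omega), hrev,
          hLr (M.rot^[i+1] d) (Or.inr (hmin _ (by omega) hi)), U.cover.rev_rev]
    obtain ⟨m, hm⟩ := Nat.exists_eq_add_of_lt hn0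
    rw [zero_add] at hm
    have hm' : n = m + 1 := hm
    have h2 := hrot2 m (by omega)
    rw [hit m (by omega), ← Function.iterate_succ_apply' (f := U.cover.rot), hrev] at h2
    refine ⟨M.rev (M.rot^[n] d), ⟨hn1, ?_, ?_⟩, ?_, ?_⟩
    · rw [head_rev, tail_rot_iterate]; exact hd.1
    · rw [hm', ← hrev, M.next_next_next]
      exact hmin m (by omega) (by omega)
    · rw [hm', head_eq, ← h2, tail_rot_iterate]
    · intro hrr e he
      rw [M.rev_rev] at hrr
      obtain ⟨i, hi, rfl⟩ := M.exists_rot_of_tail_eq he.symm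
      refine hto i (lt_of_lt_of_le hi ?_)
      exact Function.IsPeriodicPt.minimalPeriod_le hn0 hrr
  choose! ν hν1 hν2 hν3 using hnu
  have hne : ∀ d, Boundary M W d → ν d ≠ d := fun d hd hdd => by
    have := hν2 d hd
    rw [hdd] at this
    exact hU.1 _ this.symm
  -- Otherwise `d`, `ν d`, `ν (ν d)` would be three distinct boundary darts.
  have hνν : ν (ν d) = d := by
    by_contra hc
    have h3 : #({d, ν d, ν (ν d)} : Finset D) = 3 :=
      card_eq_three.2 ⟨_, _, _, (hne d hd).symm, Ne.symm hc, (hne _ (hν1 d hd)).symm, rfl⟩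
    have h4 : ({d, ν d, ν (ν d)} : Finset D) ⊆ ({d : D | Boundary M W d} : Finset D) := by
      intro x hx
      simp only [mem_insert, mem_singleton] at hx
      rw [mem_filter]
      rcases hx with rfl | rfl | rfl
      · exact ⟨mem_univ _, hd⟩
      · exact ⟨mem_univ _, hν1 _ hd⟩
      · exact ⟨mem_univ _, hν1 _ (hν1 _ hd)⟩
    have := card_le_card h4
    omega
  have hd' := hν1 d hd
  have k1 := hν2 d hd
  have k2 := hν2 _ hd'
  rw [hνν] at k2
  have k3 : U.cover.rev (L (ν d)) = L d := hU.2 _ _ (by rw [← head_eq, k1])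
    (by rw [head_rev, k2])
  have k4 : M.rev (ν d) = d := by
    have := congrArg U.proj k3
    rwa [U.proj_rev, hLp _ (Or.inr (Or.inr hd'.2.2)), hLp _ (Or.inr (Or.inr hd.2.2))] at this
  have k5 : M.rev d = ν d := by rw [← M.rev_rev (ν d), k4]
  exact hν3 _ hd' (by rw [hνν, k5]) e (by rw [he, head_eq, k5])

include h in
-- The surface has `6V + 12g - 12` darts, more than the `6V` that `card_touches_le` allows, so some
-- triangle must miss `W`. But touching `W` spreads from vertex to adjacent vertex over the
-- connected surface.
theorem false_of_simplicial {g : ℕ} (hg : 2 ≤ g) (hM : M.IsClosedOfGenus g)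
    (U : UniversalCovering M D') (hU : U.cover.IsSimplicial) : False := by
  have hcard := hM.card_edge.2
  have hle := h.card_touches_le
  suffices hall : ∀ d, Touches M W d by
    have h1 : #{d : D | Touches M W d} = Fintype.card D := by
      rw [filter_true_of_mem fun d _ => hall d]; rfl
    have h2 : #{v : M.Vertex | v ∈ W} ≤ Nat.card M.Vertex := by
      rw [Nat.card_eq_fintype_card]; exact card_le_univ _
    omega
  by_cases hW : ∃ v, v ∉ W
  swap
  · push Not at hW
    exact fun d => Or.inl (hW _)
  have hconn := hM.2.1
  obtain ⟨v₀, hv₀⟩ := h.nonempty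
  -- all triangles at a vertex adjacent to `W` touch `W`
  have key : ∀ e, M.head e ∈ W → ∀ e', M.tail e' = M.tail e → Touches M W e' := by
    intro e he e' he'
    by_cases hz : M.tail e ∈ W
    · exact Or.inl (by rw [he']; exact hz)
    -- Either the rotation around this vertex meets a first edge not leading to `W`, which yields a
    -- boundary dart, or all edges at the vertex lead to `W`.
    by_cases hn : ∃ n, M.head (M.rot^[n] e) ∉ W
    · set n := Nat.find hn with hndef
      have h1 := Nat.find_spec hn
      obtain ⟨m, hm⟩ : ∃ m, n = m + 1 := Nat.exists_eq_succ_of_ne_zero fun h0 => by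
        rw [← hndef, h0] at h1; exact h1 he
      have h2 : M.head (M.rot^[m] e) ∈ W := by
        by_contra hc
        have := Nat.find_min' hn hc
        omega
      rw [← hndef, hm] at h1
      have hrev : M.next (M.next (M.rot^[m] e)) = M.rev (M.rot^[m+1] e) := by
        rw [Function.iterate_succ_apply', rot_apply, M.rev_rev]
      refine h.touches_of_boundary hconn hW U hU (d := M.rev (M.rot^[m+1] e)) ⟨h1, ?_, ?_⟩ ?_
      · rw [head_rev, tail_rot_iterate]; exact hz
      · rw [← hrev, M.next_next_next]; exact h2
      · rw [he', head_rev, tail_rot_iterate]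
    · push Not at hn
      obtain ⟨i, -, rfl⟩ := M.exists_rot_of_tail_eq he'.symm
      exact Or.inr (Or.inl (hn i))
  intro d
  refine hconn.vertex_induction (P := fun v => ∀ e, M.tail e = v → Touches M W e) (v := v₀)
    (fun e he => Or.inl (he ▸ hv₀)) (fun e he e' he' => ?_) (M.tail d) d rfl
  rcases he e rfl with h1 | h1 | h1
  · exact key (M.rev e) (by rwa [head_rev]) e' he'
  · exact Or.inl (by rw [he']; exact h1)
  · exact key (M.next e) h1 e' (by rw [he', tail_next])

end SignPattern

open Classical Finset Triangulation in
/-- An odd assignment of signs to the oriented edges of a closed triangulated surface of genus at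
least two that vanishes at the vertices outside a set `N` and whose corners at the vertices of
`N` have small weight is only possible if `N` is empty. -/
theorem sign_rigidity {D D' : Type*} [Fintype D] {M : Triangulation D} {g : ℕ} (hg : 2 ≤ g)
    (hM : M.IsClosedOfGenus g) (U : UniversalCovering M D') (hU : U.cover.IsSimplicial)
    (f : D → SignType) (N : Set M.Vertex) (odd : ∀ d, f (M.rev d) = -f d)
    (hout : ∀ d, M.tail d ∉ N → f d = 0)
    (weight : ∀ d, M.tail d ∈ N → ∑ i ∈ range (M.valence d),
      cornerWeight (f (M.rot^[i] d)) (f (M.rot (M.rot^[i] d))) ≤ 4) : N = ∅ := by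
  by_contra hN
  -- `N` itself is a candidate, because the reverse of an edge leaving `N` starts outside `N`, where
  -- `f` vanishes. A minimal candidate is a sign pattern.
  have hne : (({W : Set M.Vertex | W ⊆ N ∧ W.Nonempty ∧
      ∀ d, M.tail d ∈ W → M.head d ∉ W → f d = 0} : Set (Set M.Vertex))).Nonempty := by
    refine ⟨N, subset_rfl, Set.nonempty_iff_ne_empty.2 hN, fun d _ hd => ?_⟩
    have := hout (M.rev d) hd
    rw [odd] at this
    simpa using this
  obtain ⟨W, hW⟩ := (Set.toFinite _).exists_minimal hne
  refine SignPattern.false_of_simplicial (M := M) (f := f) (W := W) (D' := D')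
    ⟨odd, hW.prop.2.1, hW.prop.2.2, fun d hd => weight d (hW.prop.1 hd),
      fun W' hW' h1 h2 => ?_⟩ hg hM U hU
  exact subset_antisymm hW' (hW.le_of_le ⟨hW'.trans hW.prop.1, h1, h2⟩ hW')

end CirclePacking

namespace CirclePacking

/-! ## Signs of quadratic forms along a half-turn -/

/-- The distance of two signs. -/
def signDist (a b : SignType) : ℕ := if a = b then 0 else if a = 0 ∨ b = 0 then 1 else 2

/-- The hypotheses exclude a factor that vanishes at both ends: it would make both products zero,
hence weight `2`, at no cost in `signDist`. -/
theorem cornerWeight_mul_le {a b a' b' : SignType} (h : ¬ (a = 0 ∧ a' = 0))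
    (h' : ¬ (b = 0 ∧ b' = 0)) :
    cornerWeight (a * b) (a' * b') ≤ signDist a a' + signDist b b' := by
  revert a b a' b'; decide

theorem signDist_neg (a b : SignType) : signDist (-a) (-b) = signDist a b := by
  revert a b; decide

theorem cast_signDist {a b : SignType} (h : b ≤ a) :
    (signDist a b : ℤ) = (a : ℤ) - (b : ℤ) := by
  revert a b; decide

/-- Vectors of the plane that turn once by half a turn, from `(1, 0)` to `(-1, 0)`. -/
structure HalfTurn (k : ℕ) (X Y : ℕ → ℝ) : Prop where
  two_le : 2 ≤ k
  X_zero : X 0 = 1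
  Y_zero : Y 0 = 0
  X_last : X k = -1
  Y_last : Y k = 0
  neg : ∀ i, 0 < i → i < k → Y i < 0
  det : ∀ i, i < k → X (i + 1) * Y i - X i * Y (i + 1) = 1

namespace HalfTurn

variable {k : ℕ} {X Y : ℕ → ℝ} (h : HalfTurn k X Y)

include h

/-- Consecutive vectors have determinant one and so form a basis of the plane. -/
theorem not_both_zero {α β : ℝ} (hαβ : ¬ (α = 0 ∧ β = 0)) {i : ℕ} (hi : i < k) :
    ¬ (SignType.sign (α * X i + β * Y i) = 0 ∧
      SignType.sign (α * X (i + 1) + β * Y (i + 1)) = 0) := by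
  rintro ⟨h1, h2⟩
  rw [sign_eq_zero_iff] at h1 h2
  have hd := h.det i hi
  refine hαβ ⟨?_, ?_⟩
  · linear_combination Y i * h2 - Y (i + 1) * h1 - α * hd
  · linear_combination X (i + 1) * h1 - X i * h2 - β * hd

/-- The form is positive at `(1, 0)` and negative at `(-1, 0)`, and after a value `≤ 0` the next one
is negative because the vectors turn in one direction. The signs decrease, and the sum telescopes to
`1 - (-1)`. -/
theorem sum_signDist_le_of_pos {α β : ℝ} (hα : 0 < α) :
    ∑ i ∈ Finset.range k, signDist (SignType.sign (α * X i + β * Y i))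
      (SignType.sign (α * X (i + 1) + β * Y (i + 1))) ≤ 2 := by
  have hk := h.two_le
  have hneg : ∀ i, i < k → α * X i + β * Y i ≤ 0 → α * X (i + 1) + β * Y (i + 1) < 0 := by
    intro i hi hle
    rcases Nat.eq_zero_or_pos i with rfl | hi0
    · rw [h.X_zero, h.Y_zero] at hle; linarith
    rcases Nat.lt_or_ge (i + 1) k with hik | hik
    · have hd := h.det i hi
      have h1 := h.neg i hi0 hi
      have h2 := h.neg (i + 1) (by omega) hik
      have h3 : Y i * (α * X (i + 1) + β * Y (i + 1)) = α + Y (i + 1) * (α * X i + β * Y i) := by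
        linear_combination α * hd
      have h4 := mul_nonneg_of_nonpos_of_nonpos h2.le hle
      by_contra hc
      push Not at hc
      have := mul_nonpos_of_nonpos_of_nonneg h1.le hc
      linarith
    · have : i + 1 = k := by omega
      rw [this, h.X_last, h.Y_last]; linarith
  have hmono : ∀ i, i < k → SignType.sign (α * X (i + 1) + β * Y (i + 1)) ≤
      SignType.sign (α * X i + β * Y i) := by
    intro i hi
    rcases le_or_gt (α * X i + β * Y i) 0 with h1 | h1
    · rw [sign_neg (hneg i hi h1)]
      exact SignType.neg_one_le _
    · rw [sign_pos h1]
      exact SignType.le_one _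
  have hsum : (∑ i ∈ Finset.range k, signDist (SignType.sign (α * X i + β * Y i))
      (SignType.sign (α * X (i + 1) + β * Y (i + 1))) : ℤ) = 2 := by
    rw [Finset.sum_congr rfl fun i hi => cast_signDist (hmono i (Finset.mem_range.1 hi)),
      Finset.sum_range_sub' (fun i => ((SignType.sign (α * X i + β * Y i) : SignType) : ℤ)),
      h.X_zero, h.Y_zero, h.X_last, h.Y_last, sign_pos (by linarith), sign_neg (by linarith)]
    rfl
  exact_mod_cast hsum.le

theorem sum_signDist_le {α β : ℝ} (hαβ : ¬ (α = 0 ∧ β = 0)) :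
    ∑ i ∈ Finset.range k, signDist (SignType.sign (α * X i + β * Y i))
      (SignType.sign (α * X (i + 1) + β * Y (i + 1))) ≤ 2 := by
  have hk := h.two_le
  rcases lt_trichotomy α 0 with hα | hα | hα
  · have h1 := h.sum_signDist_le_of_pos (α := -α) (β := -β) (by linarith)
    refine le_trans (le_of_eq (Finset.sum_congr rfl fun i _ => ?_)) h1
    rw [← signDist_neg, ← Left.sign_neg, ← Left.sign_neg]
    congr 2 <;> ring
  -- The form is a multiple of `Y`: zero at both ends and of constant sign in between, so only the
  -- first and the last step count, with `1` each.
  · subst hα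
    have hβ : β ≠ 0 := fun h0 => hαβ ⟨rfl, h0⟩
    have hs : ∀ i, 0 < i → i < k → SignType.sign (0 * X i + β * Y i) = -SignType.sign β := by
      intro i h0 hi
      rw [zero_mul, zero_add, sign_mul, sign_neg (h.neg i h0 hi), mul_neg, mul_one]
    have hz : ∀ i, (i = 0 ∨ i = k) → SignType.sign (0 * X i + β * Y i) = 0 := by
      rintro i (rfl | rfl)
      · rw [h.Y_zero]; simp
      · rw [h.Y_last]; simp
    have hβs : SignType.sign β ≠ 0 := fun h0 => hβ (sign_eq_zero_iff.1 h0)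
    have hd1 : ∀ s : SignType, signDist 0 s ≤ 1 ∧ signDist s 0 ≤ 1 ∧ signDist s s = 0 := by decide
    have hle : ∀ i ∈ Finset.range k, signDist (SignType.sign (0 * X i + β * Y i))
        (SignType.sign (0 * X (i + 1) + β * Y (i + 1))) ≤
        (if i = 0 then 1 else 0) + (if i = k - 1 then 1 else 0) := by
      intro i hi
      rw [Finset.mem_range] at hi
      rcases Nat.eq_zero_or_pos i with rfl | hi0
      · rw [hz 0 (Or.inl rfl), if_pos rfl]
        exact ((hd1 _).1).trans (Nat.le_add_right _ _)
      · rcases Nat.lt_or_ge (i + 1) k with hik | hik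
        · rw [hs i hi0 hi, hs (i + 1) (by omega) hik, (hd1 _).2.2]
          exact Nat.zero_le _
        · rw [hz (i + 1) (Or.inr (by omega)), if_pos (c := i = k - 1) (by omega)]
          exact ((hd1 _).2.1).trans (Nat.le_add_left _ _)
    refine (Finset.sum_le_sum hle).trans ?_
    rw [Finset.sum_add_distrib, Finset.sum_ite_eq', Finset.sum_ite_eq',
      if_pos (by simp; omega), if_pos (by simp; omega)]
  · exact h.sum_signDist_le_of_pos hα

/-- A form with non-negative discriminant is a product of two linear forms, and each contributes at
most `2`. A definite form has constant sign and contributes nothing. -/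
theorem sum_cornerWeight_le {A B C : ℝ} (hABC : ¬ (A = 0 ∧ B = 0 ∧ C = 0)) :
    ∑ i ∈ Finset.range k, cornerWeight
      (SignType.sign (A * X i ^ 2 + B * X i * Y i + C * Y i ^ 2))
      (SignType.sign (A * X (i + 1) ^ 2 + B * X (i + 1) * Y (i + 1) + C * Y (i + 1) ^ 2)) ≤ 4 := by
  have hfac : (∃ α β γ δ : ℝ, ¬ (α = 0 ∧ β = 0) ∧ ¬ (γ = 0 ∧ δ = 0) ∧
      ∀ x y : ℝ, A * x ^ 2 + B * x * y + C * y ^ 2 = (α * x + β * y) * (γ * x + δ * y)) →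
      ∑ i ∈ Finset.range k, cornerWeight
      (SignType.sign (A * X i ^ 2 + B * X i * Y i + C * Y i ^ 2))
      (SignType.sign (A * X (i + 1) ^ 2 + B * X (i + 1) * Y (i + 1) + C * Y (i + 1) ^ 2)) ≤ 4 := by
    rintro ⟨α, β, γ, δ, h1, h2, h3⟩
    have h4 := h.sum_signDist_le h1
    have h5 := h.sum_signDist_le h2
    have h6 : ∀ i ∈ Finset.range k, cornerWeight
      (SignType.sign (A * X i ^ 2 + B * X i * Y i + C * Y i ^ 2))
      (SignType.sign (A * X (i + 1) ^ 2 + B * X (i + 1) * Y (i + 1) + C * Y (i + 1) ^ 2)) ≤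
      signDist (SignType.sign (α * X i + β * Y i))
        (SignType.sign (α * X (i + 1) + β * Y (i + 1))) +
      signDist (SignType.sign (γ * X i + δ * Y i))
        (SignType.sign (γ * X (i + 1) + δ * Y (i + 1))) := fun i hi => by
      rw [h3, h3, sign_mul, sign_mul]
      exact cornerWeight_mul_le (h.not_both_zero h1 (Finset.mem_range.1 hi))
        (h.not_both_zero h2 (Finset.mem_range.1 hi))
    have h7 := Finset.sum_le_sum h6
    rw [Finset.sum_add_distrib] at h7
    omega
  by_cases hA : A = 0
  · subst hA
    exact hfac ⟨0, 1, B, C, by simp, by tauto, fun x y => by ring⟩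
  rcases le_or_gt 0 (B ^ 2 - 4 * A * C) with hd | hd
  · have hr := Real.sq_sqrt hd
    set r := √(B ^ 2 - 4 * A * C)
    refine hfac ⟨A, (B + r) / 2, 1, (B - r) / (2 * A), by tauto, by simp, fun x y => ?_⟩
    field_simp
    linear_combination y ^ 2 * hr
  · have hsign : ∀ x y : ℝ, ¬ (x = 0 ∧ y = 0) →
        SignType.sign (A * x ^ 2 + B * x * y + C * y ^ 2) = SignType.sign A := by
      intro x y hxy
      have h1 : 0 < A * (A * x ^ 2 + B * x * y + C * y ^ 2) := by
        have h2 : 4 * (A * (A * x ^ 2 + B * x * y + C * y ^ 2)) =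
          (2 * A * x + B * y) ^ 2 + (4 * A * C - B ^ 2) * y ^ 2 := by ring
        have h3 : 0 < (2 * A * x + B * y) ^ 2 + (4 * A * C - B ^ 2) * y ^ 2 := by
          by_cases hy : y = 0
          · subst hy
            have hx : x ≠ 0 := fun h0 => hxy ⟨h0, rfl⟩
            have : 0 < (2 * A * x) ^ 2 := by positivity
            simpa using this
          · have : 0 < y ^ 2 := by positivity
            have : 0 < (4 * A * C - B ^ 2) * y ^ 2 := mul_pos (by linarith) this
            positivity
        linarith
      rcases lt_or_gt_of_ne hA with h2 | h2
      · rw [sign_neg h2, sign_neg (by nlinarith)]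
      · rw [sign_pos h2, sign_pos (by nlinarith)]
    have hne : ∀ i, i ≤ k → ¬ (X i = 0 ∧ Y i = 0) := by
      rintro i hi ⟨h1, h2⟩
      rcases Nat.lt_or_ge i k with h3 | h3
      · have := h.det i h3
        rw [h1, h2] at this
        norm_num at this
      · have := h.X_last
        rw [show k = i by omega, h1] at this
        norm_num at this
    rw [Finset.sum_eq_zero]
    · norm_num
    · intro i hi
      rw [Finset.mem_range] at hi
      rw [hsign _ _ (hne i hi.le), hsign _ _ (hne (i + 1) hi)]
      have : SignType.sign A ≠ 0 := fun h0 => hA (sign_eq_zero_iff.1 h0)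
      revert this
      generalize SignType.sign A = s
      revert s
      decide

end HalfTurn

/-! ## Products of frieze matrices around the vertices -/

/-- The Möbius map `z ↦ x - 1 / z`. -/
def frieze (x : ℝ) : Matrix (Fin 2) (Fin 2) ℝ := !![x, -1; 1, 0]

theorem frieze_mul_zero (x : ℝ) (P : Matrix (Fin 2) (Fin 2) ℝ) (b : Fin 2) :
    (frieze x * P) 0 b = x * P 0 b - P 1 b := by
  rw [Matrix.mul_apply, Fin.sum_univ_two]; simp [frieze]; ring

theorem frieze_mul_one (x : ℝ) (P : Matrix (Fin 2) (Fin 2) ℝ) (b : Fin 2) :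
    (frieze x * P) 1 b = P 0 b := by
  rw [Matrix.mul_apply, Fin.sum_univ_two]; simp [frieze]

namespace Triangulation

variable {D : Type*} (M : Triangulation D)

/-- The product of the frieze matrices of the first `i` edges that follow `d` around its initial
vertex. -/
def transport (t : M.Edge → ℝ) (d : D) : ℕ → Matrix (Fin 2) (Fin 2) ℝ
  | 0 => 1
  | i + 1 => frieze (t (M.edge (M.rot^[i + 1] d))) * transport t d i

variable {M}

theorem transport_succ (t : M.Edge → ℝ) (d : D) (i : ℕ) : M.transport t d (i + 1) =
    frieze (t (M.edge (M.rot^[i + 1] d))) * M.transport t d i := rfl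

theorem transport_succ' (t : M.Edge → ℝ) (d : D) (i : ℕ) : M.transport t d (i + 1) =
    M.transport t (M.rot d) i * frieze (t (M.edge (M.rot d))) := by
  induction i with
  | zero => simp [transport]
  | succ i ih =>
    rw [transport_succ, ih, transport_succ, Matrix.mul_assoc, Function.iterate_succ_apply]

theorem det_frieze (x : ℝ) : (frieze x).det = 1 := by
  simp [frieze, Matrix.det_fin_two]

theorem det_transport (t : M.Edge → ℝ) (d : D) (i : ℕ) : (M.transport t d i).det = 1 := by
  induction i with
  | zero => simp [transport]
  | succ i ih => rw [transport_succ, Matrix.det_mul, det_frieze, ih, mul_one]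

theorem transport_succ_10 (t : M.Edge → ℝ) (d : D) (i : ℕ) :
    M.transport t d (i + 1) 1 0 = M.transport t d i 0 0 := by
  rw [transport_succ, frieze_mul_one]

theorem transport_succ_11 (t : M.Edge → ℝ) (d : D) (i : ℕ) :
    M.transport t d (i + 1) 1 1 = M.transport t d i 0 1 := by
  rw [transport_succ, frieze_mul_one]

theorem transport_det_eq (t : M.Edge → ℝ) (d : D) (i : ℕ) :
    M.transport t d i 0 0 * M.transport t d i 1 1 -
      M.transport t d i 0 1 * M.transport t d i 1 0 = 1 := by
  rw [← Matrix.det_fin_two, det_transport]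

variable (M)

/-- The cross ratios `t` close up around each vertex, turning exactly once. -/
def Closing (t : M.Edge → ℝ) : Prop :=
  ∀ d, M.transport t d (M.valence d) = -1 ∧
    -- By `transport_succ_10` these entries are the denominators of the tangency points with index
    -- `i + 1`; index `0` belongs to the point at infinity. Their positivity makes the tangency
    -- points increase.
    ∀ i, i + 1 < M.valence d → 0 < M.transport t d i 0 0

variable {M}

/-- The vectors are the bottom rows of the products, up to a sign. They represent the tangency
points seen from the frame of `d`. A frieze matrix moves the top row to the bottom, so the
determinant of consecutive vectors is that of `transport`. -/
theorem Closing.halfTurn {t : M.Edge → ℝ} (h : M.Closing t) (d : D) :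
    HalfTurn (M.valence d) (fun i => M.transport t d i 1 1) (fun i => -M.transport t d i 1 0) where
  two_le := by have := M.three_le d; omega
  X_zero := by simp [transport]
  Y_zero := by simp [transport]
  X_last := by simp [(h d).1]
  Y_last := by simp [(h d).1]
  neg := fun i hi0 hi => by
    obtain ⟨j, rfl⟩ : ∃ j, i = j + 1 := ⟨i - 1, by omega⟩
    rw [transport_succ_10]
    have := (h d).2 j hi
    linarith
  det := fun i _ => by
    have := transport_det_eq t d i
    rw [transport_succ_10, transport_succ_11]
    linarith

variable (M) in
/-- An oriented edge issuing from a given vertex. -/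
def baseDart (v : M.Vertex) : D := Quotient.out v

theorem tail_baseDart (v : M.Vertex) : M.tail (M.baseDart v) = v := Quotient.out_eq v

/-- The derivative of `transport` in the direction `q`. -/
def dTransport (t q : M.Edge → ℝ) (d : D) : ℕ → Matrix (Fin 2) (Fin 2) ℝ
  | 0 => 0
  | i + 1 => q (M.edge (M.rot^[i + 1] d)) • (!![1, 0; 0, 0] * M.transport t d i) +
      frieze (t (M.edge (M.rot^[i + 1] d))) * dTransport t q d i

theorem hasDerivAt_transport (t q : M.Edge → ℝ) (d : D) (i : ℕ) (a b : Fin 2) :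
    HasDerivAt (fun s : ℝ => M.transport (t + s • q) d i a b) (dTransport t q d i a b) 0 := by
  induction i generalizing a b with
  | zero => simpa [transport, dTransport] using hasDerivAt_const (0 : ℝ) _
  | succ i ih =>
    have h0 : HasDerivAt (fun s : ℝ => (t + s • q) (M.edge (M.rot^[i + 1] d)))
        (q (M.edge (M.rot^[i + 1] d))) 0 := by
      simpa using ((hasDerivAt_id (0 : ℝ)).mul_const (q (M.edge (M.rot^[i + 1] d)))).const_add
        (t (M.edge (M.rot^[i + 1] d)))
    have ha : a = 0 ∨ a = 1 := by fin_cases a <;> simp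
    rcases ha with rfl | rfl
    · have h := (h0.mul (ih 0 b)).sub (ih 1 b)
      simp only [zero_smul, add_zero] at h
      simp only [transport_succ, dTransport, Matrix.add_apply, Matrix.smul_apply, frieze_mul_zero,
        Matrix.mul_apply (M := !![(1 : ℝ), 0; 0, 0]), Fin.sum_univ_two, smul_eq_mul]
      refine h.congr_deriv ?_
      simp; ring
    · simp only [transport_succ, dTransport, Matrix.add_apply, Matrix.smul_apply, frieze_mul_one,
        Matrix.mul_apply (M := !![(1 : ℝ), 0; 0, 0]), Fin.sum_univ_two, smul_eq_mul]
      refine (ih 0 b).congr_deriv ?_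
      simp

/-- The infinitesimal translation along the `i`-th edge. -/
def edgeMotion (t : M.Edge → ℝ) (d : D) (i : ℕ) : Matrix (Fin 2) (Fin 2) ℝ :=
  (M.transport t d i).adjugate * !![0, 1; 0, 0] * M.transport t d i

theorem edgeMotion_eq (t : M.Edge → ℝ) (d : D) (i : ℕ) : edgeMotion t d i =
    !![M.transport t d i 1 1 * M.transport t d i 1 0, M.transport t d i 1 1 ^ 2;
      - M.transport t d i 1 0 ^ 2, - (M.transport t d i 1 1 * M.transport t d i 1 0)] := by
  ext a b
  fin_cases a <;> fin_cases b <;>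
    simp [edgeMotion, Matrix.adjugate_fin_two, Matrix.mul_apply, Fin.sum_univ_two] <;> ring

/-- Variation of constants: the derivative of a frieze matrix is the translation generator times the
matrix, and conjugation by the preceding product turns it into `edgeMotion`. -/
theorem dTransport_eq (t q : M.Edge → ℝ) (d : D) (i : ℕ) :
    dTransport t q d i = M.transport t d i *
      ∑ j ∈ Finset.range i, q (M.edge (M.rot^[j + 1] d)) • edgeMotion t d (j + 1) := by
  induction i with
  | zero => simp [dTransport]
  | succ i ih =>
    have h1 : M.transport t d (i + 1) * edgeMotion t d (i + 1) =
        !![1, 0; 0, 0] * M.transport t d i := by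
      rw [edgeMotion, ← Matrix.mul_assoc, ← Matrix.mul_assoc, Matrix.mul_adjugate, det_transport,
        one_smul, one_mul, transport_succ, ← Matrix.mul_assoc]
      congr 1
      ext a b
      fin_cases a <;> fin_cases b <;> simp [frieze]
    rw [Finset.sum_range_succ, mul_add, Matrix.mul_smul, h1, dTransport, ih, transport_succ,
      Matrix.mul_assoc, add_comm]

theorem contDiff_transport [Finite D] (d : D) (i : ℕ) (a b : Fin 2) :
    ContDiff ℝ ∞ fun t : M.Edge → ℝ => M.transport t d i a b := by
  induction i generalizing a b with
  | zero => exact contDiff_const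
  | succ i ih =>
    have ha : a = 0 ∨ a = 1 := by fin_cases a <;> simp
    rcases ha with rfl | rfl
    · simp only [transport_succ, frieze_mul_zero]
      exact ((contDiff_apply ℝ ℝ _).mul (ih 0 b)).sub (ih 1 b)
    · simp only [transport_succ, frieze_mul_one]
      exact ih 0 b

variable (M) in
/-- The entries of the products of frieze matrices around the vertices. -/
def vertexMap (t : M.Edge → ℝ) (v : M.Vertex) : Fin 3 → ℝ :=
  -- Three entries suffice: the determinant is one, so the fourth is determined wherever the upper
  -- left one is non-zero.
  ![M.transport t (M.baseDart v) (M.valence (M.baseDart v)) 0 0,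
    M.transport t (M.baseDart v) (M.valence (M.baseDart v)) 0 1,
    M.transport t (M.baseDart v) (M.valence (M.baseDart v)) 1 0]

theorem contDiff_vertexMap [Finite D] : ContDiff ℝ ∞ M.vertexMap := by
  refine contDiff_pi.2 fun v => contDiff_pi.2 fun i => ?_
  fin_cases i
  · exact contDiff_transport _ _ _ _
  · exact contDiff_transport _ _ _ _
  · exact contDiff_transport _ _ _ _

theorem fderiv_vertexMap [Finite D] (t q : M.Edge → ℝ) (v : M.Vertex) :
    fderiv ℝ M.vertexMap t q v =
      ![dTransport t q (M.baseDart v) (M.valence (M.baseDart v)) 0 0,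
        dTransport t q (M.baseDart v) (M.valence (M.baseDart v)) 0 1,
        dTransport t q (M.baseDart v) (M.valence (M.baseDart v)) 1 0] := by
  have h1 : HasFDerivAt M.vertexMap (fderiv ℝ M.vertexMap t) (t + (0 : ℝ) • q) := by
    rw [zero_smul, add_zero]
    exact (contDiff_vertexMap.differentiable (by simp) t).hasFDerivAt
  have h2 : HasDerivAt (fun s : ℝ => t + s • q) q 0 := by
    simpa using ((hasDerivAt_id (0 : ℝ)).smul_const q).const_add t
  have h3 := h1.comp_hasDerivAt (0 : ℝ) h2
  rw [hasDerivAt_pi] at h3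
  have h4 := h3 v
  rw [hasDerivAt_pi] at h4
  funext i
  refine (h4 i).unique ?_
  fin_cases i
  · exact hasDerivAt_transport t q _ _ _ _
  · exact hasDerivAt_transport t q _ _ _ _
  · exact hasDerivAt_transport t q _ _ _ _

/-- The sum of the infinitesimal translations along the edges around a vertex, weighted by `q`. -/
def motionSum (t q : M.Edge → ℝ) (d : D) : Matrix (Fin 2) (Fin 2) ℝ :=
  ∑ j ∈ Finset.range (M.valence d), q (M.edge (M.rot^[j] d)) • edgeMotion t d j

theorem Closing.edgeMotion_valence {t : M.Edge → ℝ} (h : M.Closing t) (d : D) :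
    edgeMotion t d (M.valence d) = edgeMotion t d 0 := by
  simp [edgeMotion, (h d).1, transport, Matrix.adjugate_fin_two]

/-- Conjugation by `-1` is trivial, so `edgeMotion` is periodic and the sum over `1, …, k` equals
the sum over `0, …, k - 1`. -/
theorem Closing.dTransport_valence {t : M.Edge → ℝ} (h : M.Closing t) (q : M.Edge → ℝ) (d : D) :
    dTransport t q d (M.valence d) = -motionSum t q d := by
  rw [dTransport_eq, (h d).1, neg_one_mul, motionSum]
  congr 1
  have h1 := Finset.sum_range_succ' (fun j => q (M.edge (M.rot^[j] d)) • edgeMotion t d j)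
    (M.valence d)
  rw [Finset.sum_range_succ, h.edgeMotion_valence, M.rot_iterate_valence] at h1
  exact (add_right_cancel h1).symm

theorem motionSum_trace (t q : M.Edge → ℝ) (d : D) :
    motionSum t q d 1 1 = -motionSum t q d 0 0 := by
  simp only [motionSum, Matrix.sum_apply, Matrix.smul_apply, edgeMotion_eq, ← Finset.sum_neg_distrib]
  refine Finset.sum_congr rfl fun j _ => ?_
  simp

theorem Closing.fderiv_vertexMap_eq_zero_iff [Finite D] {t : M.Edge → ℝ} (h : M.Closing t)
    (q : M.Edge → ℝ) :
    fderiv ℝ M.vertexMap t q = 0 ↔ ∀ v, motionSum t q (M.baseDart v) = 0 := by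
  constructor
  · intro h0 v
    have h1 := congrFun h0 v
    rw [fderiv_vertexMap, h.dTransport_valence] at h1
    have e0 := congrFun h1 0
    have e1 := congrFun h1 1
    have e2 := congrFun h1 2
    simp at e0 e1 e2
    ext a b
    fin_cases a <;> fin_cases b
    · simpa using e0
    · simpa using e1
    · simpa using e2
    · simp [motionSum_trace, e0]
  · intro h0
    funext v
    rw [fderiv_vertexMap, h.dTransport_valence, h0 v]
    ext i
    fin_cases i <;> simp

open Classical in
/-- The closing conditions at the vertices are independent. -/
theorem Closing.fderiv_vertexMap_surjective {D' : Type*} [Finite D] {t : M.Edge → ℝ}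
    (h : M.Closing t) {g : ℕ} (hg : 2 ≤ g) (hM : M.IsClosedOfGenus g)
    (U : UniversalCovering M D') (hU : U.cover.IsSimplicial) :
    Function.Surjective (fderiv ℝ M.vertexMap t) := by
  have := Fintype.ofFinite D
  by_contra hsurj
  have hlt : LinearMap.range (fderiv ℝ M.vertexMap t).toLinearMap < ⊤ := by
    rw [lt_top_iff_ne_top, Ne, LinearMap.range_eq_top]
    exact hsurj
  obtain ⟨φ, hφ, hker⟩ := Submodule.exists_le_ker_of_lt_top _ hlt
  let c : M.Vertex → Fin 3 → ℝ := fun v i => φ (Pi.single v (Pi.single i 1))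
  have hφc : ∀ w, φ w = ∑ v, ∑ i, w v i * c v i := fun w => by
    have h1 : w = ∑ v, ∑ i, w v i • (Pi.single v (Pi.single i 1) : M.Vertex → Fin 3 → ℝ) := by
      funext v i
      simp [Finset.sum_apply, Pi.single_apply, Finset.sum_ite_eq, apply_ite, ite_apply]
    conv_lhs => rw [h1]
    simp [c]
  let N : Set M.Vertex := {v | ¬ (c v 1 = 0 ∧ -c v 0 = 0 ∧ -c v 2 = 0)}
  -- The dual of `sl(2, ℝ)` is the space of binary quadratic forms: pairing `c v` with `edgeMotion`
  -- evaluates the form `Q v` on the vector of the edge, as `hFm` records. `N` is the set of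
  -- vertices where this form is non-zero.
  let Q : M.Vertex → ℝ → ℝ → ℝ := fun v x y =>
    c v 1 * x ^ 2 + (-c v 0) * x * y + (-c v 2) * y ^ 2
  have hidx : ∀ d : D, ∃ i < M.valence (M.baseDart (M.tail d)),
      M.rot^[i] (M.baseDart (M.tail d)) = d := fun d =>
    M.exists_rot_of_tail_eq (tail_baseDart _)
  choose idx hidx1 hidx2 using hidx
  let F : M.Vertex → ℕ → ℝ := fun v i => Q v (M.transport t (M.baseDart v) i 1 1)
    (-M.transport t (M.baseDart v) i 1 0)
  let f : D → ℝ := fun d => F (M.tail d) (idx d)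
  have hF : ∀ v i, i < M.valence (M.baseDart v) → f (M.rot^[i] (M.baseDart v)) = F v i := by
    intro v i hi
    have h1 : M.tail (M.rot^[i] (M.baseDart v)) = v := by rw [tail_rot_iterate, tail_baseDart]
    have h2 := hidx1 (M.rot^[i] (M.baseDart v))
    have h3 := hidx2 (M.rot^[i] (M.baseDart v))
    simp only [f]
    rw [h1] at h2 h3 ⊢
    rw [M.rot_iterate_injOn _ h2 hi h3]
  have hFm : ∀ v i, F v i = c v 0 * edgeMotion t (M.baseDart v) i 0 0 +
      c v 1 * edgeMotion t (M.baseDart v) i 0 1 + c v 2 * edgeMotion t (M.baseDart v) i 1 0 := by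
    intro v i
    simp only [edgeMotion_eq, F, Q]
    simp
    ring
  have hzero : ∀ q : M.Edge → ℝ, ∑ d, q (M.edge d) * f d = 0 := by
    intro q
    have h1 : φ (fderiv ℝ M.vertexMap t q) = 0 := hker ⟨q, rfl⟩
    rw [hφc] at h1
    rw [← Finset.sum_fiberwise (g := M.tail), ← neg_eq_zero, ← Finset.sum_neg_distrib, ← h1]
    refine Finset.sum_congr rfl fun v _ => ?_
    have h2 := M.sum_star (fun d => q (M.edge d) * f d) (M.baseDart v)
    rw [tail_baseDart] at h2
    rw [h2, fderiv_vertexMap, h.dTransport_valence, Fin.sum_univ_three]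
    simp only [motionSum, Matrix.neg_apply, Matrix.sum_apply, Matrix.smul_apply, smul_eq_mul,
      Matrix.cons_val_zero, Matrix.cons_val_one, Matrix.cons_val, neg_mul, Finset.sum_mul,
      ← Finset.sum_neg_distrib, ← Finset.sum_add_distrib]
    refine Finset.sum_congr rfl fun i hi => ?_
    rw [hF v i (Finset.mem_range.1 hi), hFm]
    ring
  have hodd : ∀ d, f (M.rev d) = -f d := by
    intro d
    -- Testing on the indicator of one edge leaves only its two orientations.
    have h1 := hzero fun ε => if ε = M.edge d then 1 else 0
    simp only [ite_mul, one_mul, zero_mul, ← Finset.sum_filter] at h1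
    have h2 : (Finset.univ.filter fun a => M.edge a = M.edge d) = {d, M.rev d} := by
      ext a
      simp only [Finset.mem_filter, Finset.mem_univ, true_and, Finset.mem_insert,
        Finset.mem_singleton]
      rw [eq_comm, edge_eq_iff]
    rw [h2, Finset.sum_pair (M.rev_ne d).symm] at h1
    linarith
  have hN : N = ∅ := by
    refine sign_rigidity hg hM U hU (fun d => SignType.sign (f d)) N (fun d => ?_) (fun d hd => ?_)
      fun d hd => ?_
    · rw [hodd, Left.sign_neg]
    · simp only [N, Set.mem_ofPred_eq, not_not] at hd
      rw [sign_eq_zero_iff]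
      simp only [f, F, Q, hd.1, hd.2.1, hd.2.2]
      ring
    -- The bound holds for the sum that starts at the base dart, and the sum over the star does not
    -- depend on the start. The half-turn ends at the negative of its first vector, where a
    -- quadratic form takes the same value.
    · have h1 := (h.halfTurn (M.baseDart (M.tail d))).sum_cornerWeight_le hd
      have h2 := M.sum_star (fun d => cornerWeight (SignType.sign (f d))
        (SignType.sign (f (M.rot d)))) d
      have h3 := M.sum_star (fun d => cornerWeight (SignType.sign (f d))
        (SignType.sign (f (M.rot d)))) (M.baseDart (M.tail d))
      rw [tail_baseDart] at h3
      refine (h2.symm.trans h3).trans_le (le_trans (le_of_eq ?_) h1)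
      refine Finset.sum_congr rfl fun i hi => ?_
      have hi' := Finset.mem_range.1 hi
      have h4 : f (M.rot (M.rot^[i] (M.baseDart (M.tail d)))) = F (M.tail d) (i + 1) := by
        rw [← Function.iterate_succ_apply' (f := M.rot)]
        rcases Nat.lt_or_ge (i + 1) (M.valence (M.baseDart (M.tail d))) with h5 | h5
        · exact hF _ _ h5
        · have h6 : i + 1 = M.valence (M.baseDart (M.tail d)) := by omega
          have h7 := hF (M.tail d) 0 (M.valence_pos _)
          rw [Nat.succ_eq_add_one, h6, M.rot_iterate_valence]
          refine h7.trans ?_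
          rw [hFm, hFm, h.edgeMotion_valence]
      rw [h4, hF _ _ hi']
  refine hφ (LinearMap.ext fun w => ?_)
  rw [hφc]
  refine Finset.sum_eq_zero fun v _ => Finset.sum_eq_zero fun i _ => ?_
  have hv : v ∉ N := by rw [hN]; exact Set.notMem_empty v
  simp only [N, Set.mem_ofPred_eq, not_not] at hv
  have hc : c v i = 0 := by
    fin_cases i
    · exact neg_eq_zero.1 hv.2.1
    · exact hv.1
    · exact neg_eq_zero.1 hv.2.2
  rw [hc, mul_zero]

end Triangulation

end CirclePacking

namespace CirclePacking

/-! ## The action on disks -/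

/-- The class of a unimodular matrix. -/
def psl : SL(2, ℂ) →* PSL(2, ℂ) := QuotientGroup.mk' _

theorem psl_surjective : Function.Surjective psl := QuotientGroup.mk'_surjective _

theorem act_psl (B : SL(2, ℂ)) (X : Mat) :
    act (psl B) X = ((B⁻¹ : SL(2, ℂ)) : Mat)ᵀ * X * conjMat ((B⁻¹ : SL(2, ℂ)) : Mat) := rfl

theorem Ad_psl (B : SL(2, ℂ)) (X : Mat) :
    Ad (psl B) X = (B : Mat) * X * ((B⁻¹ : SL(2, ℂ)) : Mat) := rfl

theorem smul_psl (B : SL(2, ℂ)) (v : Fin 2 → ℂ) (hv : v ≠ 0) (hv' : (B : Mat) *ᵥ v ≠ 0) :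
    psl B • (Projectivization.mk ℂ v hv : CP1) = Projectivization.mk ℂ ((B : Mat) *ᵥ v) hv' := rfl

theorem psl_neg_one : psl (-1) = 1 := by
  refine (QuotientGroup.eq_one_iff _).2 ?_
  rw [Subgroup.mem_center_iff]
  intro g
  simp

theorem mulVec_ne_zero (B : SL(2, ℂ)) {v : Fin 2 → ℂ} (hv : v ≠ 0) : (B : Mat) *ᵥ v ≠ 0 := fun h =>
  hv (by
    have h1 : ((B⁻¹ : SL(2, ℂ)) : Mat) *ᵥ ((B : Mat) *ᵥ v) = 0 := by rw [h, Matrix.mulVec_zero]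
    rwa [Matrix.mulVec_mulVec, ← Matrix.SpecialLinearGroup.coe_mul, inv_mul_cancel,
      Matrix.SpecialLinearGroup.coe_one, Matrix.one_mulVec] at h1)

theorem act_inv_act (A : PSL(2, ℂ)) (X : Mat) : act A⁻¹ (act A X) = X := by
  rw [← Module.End.mul_apply, ← map_mul, inv_mul_cancel, map_one, Module.End.one_apply]

theorem act_act_inv (A : PSL(2, ℂ)) (X : Mat) : act A (act A⁻¹ X) = X := by
  rw [← Module.End.mul_apply, ← map_mul, mul_inv_cancel, map_one, Module.End.one_apply]

theorem act_mul (A B : PSL(2, ℂ)) (X : Mat) : act (A * B) X = act A (act B X) := by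
  rw [map_mul, Module.End.mul_apply]

theorem act_injective (A : PSL(2, ℂ)) : Function.Injective (act A) :=
  Function.LeftInverse.injective (act_inv_act A)

theorem eq_act_inv_iff {A : PSL(2, ℂ)} {X Y : Mat} : X = act A⁻¹ Y ↔ act A X = Y := by
  constructor
  · rintro rfl; exact act_act_inv A Y
  · rintro rfl; exact (act_inv_act A X).symm

theorem det_conjMat (X : Mat) : (conjMat X).det = star X.det := by
  simp [conjMat, Matrix.det_fin_two]

theorem det_act (A : PSL(2, ℂ)) (X : Mat) : (act A X).det = X.det := by
  obtain ⟨B, rfl⟩ := psl_surjective A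
  rw [act_psl, Matrix.det_mul, Matrix.det_mul, det_conjMat, Matrix.det_transpose,
    Matrix.SpecialLinearGroup.det_coe, star_one, mul_one, one_mul]

theorem mink_act (A : PSL(2, ℂ)) (X Y : Mat) : mink (act A X) (act A Y) = mink X Y := by
  rw [mink, ← map_add, det_act, det_act, det_act, mink]

theorem mink_comm (X Y : Mat) : mink X Y = mink Y X := by
  rw [mink, mink, add_comm X Y, sub_right_comm]

theorem conjTranspose_conjMat (X : Mat) : (conjMat X)ᴴ = Xᵀ := by
  ext i j; simp [conjMat]

theorem isHermitian_act (A : PSL(2, ℂ)) {X : Mat} (h : X.IsHermitian) : (act A X).IsHermitian := by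
  obtain ⟨B, rfl⟩ := psl_surjective A
  rw [act_psl, ← conjTranspose_conjMat]
  exact Matrix.isHermitian_conjTranspose_mul_mul _ h

theorem posSemidef_act (A : PSL(2, ℂ)) {X : Mat} (h : X.PosSemidef) : (act A X).PosSemidef := by
  obtain ⟨B, rfl⟩ := psl_surjective A
  rw [act_psl, ← conjTranspose_conjMat]
  exact h.conjTranspose_mul_mul_same _

theorem act_mem_deSitter (A : PSL(2, ℂ)) {X : Mat} (h : X ∈ deSitter) : act A X ∈ deSitter :=
  ⟨isHermitian_act A h.1, by rw [det_act]; exact h.2⟩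

theorem exists_of_isHermitian {X : Mat} (h : X.IsHermitian) :
    ∃ (a d : ℝ) (b : ℂ), X = !![(a : ℂ), b; star b, (d : ℂ)] := by
  refine ⟨(X 0 0).re, (X 1 1).re, X 0 1, ?_⟩
  have h00 := h.apply 0 0
  have h11 := h.apply 1 1
  have h01 := h.apply 1 0
  ext i j
  fin_cases i <;> fin_cases j
  · exact (Complex.conj_eq_iff_re.1 h00).symm
  · rfl
  · exact h01.symm
  · exact (Complex.conj_eq_iff_re.1 h11).symm

/-- The condition `mink X Y = -1` says that `det (X + Y)` has real part zero, and a Hermitian matrix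
has real determinant. The kernel of `X + Y` is then the tangency point. -/
theorem det_add_eq_zero {X Y : Mat} (hX : X ∈ deSitter) (hY : Y ∈ deSitter)
    (h : mink X Y = -1) : (X + Y).det = 0 := by
  obtain ⟨a, d, b, hab⟩ := exists_of_isHermitian (hX.1.add hY.1)
  have him : (X + Y).det.im = 0 := by
    rw [hab, Matrix.det_fin_two]; simp; ring
  rw [mink, hX.2, hY.2] at h
  simp at h
  exact Complex.ext (by rw [Complex.zero_re]; linarith) him

/-! ### The standard triple of disks -/

/-- The half-plane `Im z < -1`. -/
def lowerHalfPlane : Mat := !![0, -Complex.I; Complex.I, 2]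

/-- The disk of diameter one that is tangent to `upperHalfPlane` at the real point `t`. -/
def tangentDisk (t : ℝ) : Mat :=
  !![2, -2 * (t : ℂ) - Complex.I; -2 * (t : ℂ) + Complex.I, 2 * (t : ℂ) ^ 2]

/-- The unimodular matrix with given entries. -/
def mkSL (a b c d : ℂ) (h : a * d - b * c = 1) : SL(2, ℂ) :=
  ⟨!![a, b; c, d], by rw [Matrix.det_fin_two_of, h]⟩

theorem coe_mkSL (a b c d : ℂ) (h : a * d - b * c = 1) :
    (mkSL a b c d h : Mat) = !![a, b; c, d] := rfl

theorem exists_mkSL (B : SL(2, ℂ)) : ∃ a b c d h, B = mkSL a b c d h := by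
  have h : (B : Mat) 0 0 * (B : Mat) 1 1 - (B : Mat) 0 1 * (B : Mat) 1 0 = 1 := by
    rw [← Matrix.det_fin_two]; exact B.det_coe
  exact ⟨_, _, _, _, h, Subtype.ext (Matrix.eta_fin_two (B : Mat))⟩

theorem mkSL_mul (a b c d h a' b' c' d' h') : mkSL a b c d h * mkSL a' b' c' d' h' =
    mkSL (a * a' + b * c') (a * b' + b * d') (c * a' + d * c') (c * b' + d * d')
      (by linear_combination (a' * d' - b' * c') * h + h') :=
  Subtype.ext (by
    rw [Matrix.SpecialLinearGroup.coe_mul, coe_mkSL, coe_mkSL, coe_mkSL, Matrix.mul_fin_two])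

/-- The element of order three that permutes the disks of the standard triple. -/
def rotateSL : SL(2, ℂ) :=
  mkSL 0 (-Complex.I) (-Complex.I) 1 (by linear_combination -Complex.I_mul_I)

/-- The map `z ↦ -z - i + t`. -/
def flipSL (t : ℝ) : SL(2, ℂ) :=
  mkSL (-Complex.I) (Complex.I * t + 1) 0 Complex.I (by linear_combination -Complex.I_mul_I)

/-- The map `z ↦ t - 1 / z`. -/
def friezeSL (t : ℝ) : SL(2, ℂ) := mkSL t (-1) 1 0 (by ring)

/-- The map `z ↦ r ^ 2 * z`. -/
def scaleSL (r : ℝ) (hr : r ≠ 0) : SL(2, ℂ) := mkSL r 0 0 (r : ℂ)⁻¹ (by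
  have : (r : ℂ) ≠ 0 := by exact_mod_cast hr
  simp [this])

/-- The map `z ↦ z + s`. -/
def translateSL (s : ℝ) : SL(2, ℂ) := mkSL 1 s 0 1 (by ring)

/-- The class of `rotateSL`. -/
def rotate : PSL(2, ℂ) := psl rotateSL

/-- The class of `flipSL t`. -/
def flip (t : ℝ) : PSL(2, ℂ) := psl (flipSL t)

theorem neg_one_eq_mkSL : (-1 : SL(2, ℂ)) = mkSL (-1) 0 0 (-1) (by ring) := by
  apply Subtype.ext
  ext i j
  fin_cases i <;> fin_cases j <;> simp [coe_mkSL]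

theorem mkSL_congr {a b c d a' b' c' d' h h'} (ha : a = a') (hb : b = b') (hc : c = c')
    (hd : d = d') : mkSL a b c d h = mkSL a' b' c' d' h' := by
  subst ha hb hc hd
  rfl

theorem rotate_rotate_rotate : rotate * rotate * rotate = 1 := by
  rw [rotate, ← map_mul, ← map_mul, ← psl_neg_one, rotateSL, mkSL_mul, mkSL_mul, neg_one_eq_mkSL]
  congr 1
  apply mkSL_congr
  · linear_combination Complex.I_mul_I
  · linear_combination -Complex.I * Complex.I_mul_I
  · linear_combination -Complex.I * Complex.I_mul_I
  · linear_combination 2 * Complex.I_mul_I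

theorem flip_flip (t : ℝ) : flip t * flip t = 1 := by
  rw [flip, ← map_mul, ← psl_neg_one, flipSL, mkSL_mul, neg_one_eq_mkSL]
  congr 1
  apply mkSL_congr
  · linear_combination Complex.I_mul_I
  · ring
  · ring
  · linear_combination Complex.I_mul_I

/-- The rotation around a vertex is `rev ∘ next ∘ next`, so this product is the change of frame
between consecutive edges at a vertex. It is a real matrix. -/
theorem flip_rotate_rotate (t : ℝ) : flip t * (rotate * rotate) = psl (friezeSL t) := by
  rw [rotate, flip, ← map_mul, ← map_mul, rotateSL, flipSL, friezeSL, mkSL_mul, mkSL_mul]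
  congr 1
  apply mkSL_congr
  · linear_combination (-Complex.I - (t : ℂ)) * Complex.I_mul_I
  · linear_combination (2 + Complex.I * (t : ℂ)) * Complex.I_mul_I
  · linear_combination -Complex.I_mul_I
  · linear_combination Complex.I * Complex.I_mul_I

theorem act_mk (a b c d x y z w : ℂ) (h : a * d - b * c = 1) :
    act (psl (mkSL a b c d h)) !![x, y; z, w] =
      !![(d * x - c * z) * star d - (d * y - c * w) * star c,
        -(d * x - c * z) * star b + (d * y - c * w) * star a;
        (-b * x + a * z) * star d - (-b * y + a * w) * star c,
        -(-b * x + a * z) * star b + (-b * y + a * w) * star a] := by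
  rw [act_psl, Matrix.SpecialLinearGroup.coe_inv, coe_mkSL]
  ext i j
  fin_cases i <;> fin_cases j <;>
    simp [Matrix.adjugate_fin_two, conjMat, Matrix.mul_apply, Fin.sum_univ_two] <;> ring

theorem mat_congr {a b c d a' b' c' d' : ℂ} (ha : a = a') (hb : b = b') (hc : c = c')
    (hd : d = d') : (!![a, b; c, d] : Mat) = !![a', b'; c', d'] := by
  subst ha hb hc hd
  rfl

theorem act_rotate_upper : act rotate upperHalfPlane = tangentDisk 0 := by
  rw [rotate, rotateSL, upperHalfPlane, act_mk, tangentDisk]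
  apply mat_congr <;> simp <;> grind [Complex.I_mul_I]

theorem act_rotate_lower : act rotate lowerHalfPlane = upperHalfPlane := by
  rw [rotate, rotateSL, lowerHalfPlane, act_mk, upperHalfPlane]
  apply mat_congr <;> simp <;> grind [Complex.I_mul_I]

theorem act_rotate_tangentDisk : act rotate (tangentDisk 0) = lowerHalfPlane := by
  rw [rotate, rotateSL, lowerHalfPlane, tangentDisk, act_mk]
  apply mat_congr <;> simp <;> grind [Complex.I_mul_I]

theorem act_flip_upper (t : ℝ) : act (flip t) upperHalfPlane = lowerHalfPlane := by
  rw [flip, flipSL, upperHalfPlane, act_mk, lowerHalfPlane]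
  apply mat_congr <;> simp <;> grind [Complex.I_mul_I]

theorem act_flip_lower (t : ℝ) : act (flip t) lowerHalfPlane = upperHalfPlane := by
  rw [flip, flipSL, upperHalfPlane, lowerHalfPlane, act_mk]
  apply mat_congr <;> simp <;> grind [Complex.I_mul_I]

theorem act_flip_tangentDisk (t s : ℝ) : act (flip t) (tangentDisk s) = tangentDisk (t - s) := by
  rw [flip, flipSL, tangentDisk, tangentDisk, act_mk]
  apply mat_congr <;> simp <;> grind [Complex.I_mul_I]

theorem act_translate_upper (s : ℝ) :
    act (psl (translateSL s)) upperHalfPlane = upperHalfPlane := by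
  rw [translateSL, upperHalfPlane, act_mk]
  apply mat_congr <;> simp <;> ring

theorem act_translate_lower (s : ℝ) :
    act (psl (translateSL s)) lowerHalfPlane = lowerHalfPlane := by
  rw [translateSL, lowerHalfPlane, act_mk]
  apply mat_congr <;> simp <;> ring

theorem act_translate_tangentDisk (s t : ℝ) :
    act (psl (translateSL s)) (tangentDisk t) = tangentDisk (t + s) := by
  rw [translateSL, tangentDisk, tangentDisk, act_mk]
  apply mat_congr <;> simp <;> ring

theorem mink_eq_of_mk (a d a' d' : ℝ) (b b' : ℂ) :
    mink !![(a : ℂ), b; star b, (d : ℂ)] !![(a' : ℂ), b'; star b', (d' : ℂ)] =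
      -(a * d' + a' * d) / 2 + b.re * b'.re + b.im * b'.im := by
  simp [mink, Matrix.det_fin_two]
  ring

theorem upperHalfPlane_eq :
    upperHalfPlane = !![((0 : ℝ) : ℂ), Complex.I; star Complex.I, ((0 : ℝ) : ℂ)] := by
  simp [upperHalfPlane]

theorem lowerHalfPlane_eq :
    lowerHalfPlane = !![((0 : ℝ) : ℂ), -Complex.I; star (-Complex.I), ((2 : ℝ) : ℂ)] := by
  simp [lowerHalfPlane]

theorem tangentDisk_eq (t : ℝ) : tangentDisk t =
    !![((2 : ℝ) : ℂ), -2 * (t : ℂ) - Complex.I; star (-2 * (t : ℂ) - Complex.I),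
      ((2 * t ^ 2 : ℝ) : ℂ)] := by
  simp [tangentDisk]

theorem mink_upper_lower : mink upperHalfPlane lowerHalfPlane = -1 := by
  rw [upperHalfPlane_eq, lowerHalfPlane_eq, mink_eq_of_mk]; simp

theorem mink_tangentDisk (s t : ℝ) :
    mink (tangentDisk s) (tangentDisk t) = 1 - 2 * (s - t) ^ 2 := by
  rw [tangentDisk_eq, tangentDisk_eq, mink_eq_of_mk]; simp; ring

theorem upper_mem : upperHalfPlane ∈ deSitter := by
  refine ⟨?_, by simp [upperHalfPlane, Matrix.det_fin_two]⟩
  ext i j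
  fin_cases i <;> fin_cases j <;> simp [upperHalfPlane]

/-- A disk that is tangent to the two disks of the standard triple is a `tangentDisk`. -/
theorem exists_tangentDisk {X : Mat} (h : X ∈ deSitter) (h1 : mink upperHalfPlane X = -1)
    (h2 : mink lowerHalfPlane X = -1) : ∃ t, X = tangentDisk t := by
  obtain ⟨a, d, b, rfl⟩ := exists_of_isHermitian h.1
  rw [upperHalfPlane_eq, mink_eq_of_mk] at h1
  rw [lowerHalfPlane_eq, mink_eq_of_mk] at h2
  have hdet := h.2
  rw [Matrix.det_fin_two] at hdet
  simp at h1 h2 hdet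
  have hdet' := congrArg Complex.re hdet
  simp [h1] at hdet'
  have ha : a = 2 := by linarith
  subst ha
  refine ⟨-b.re / 2, ?_⟩
  have hd : d = 2 * (-b.re / 2) ^ 2 := by nlinarith
  rw [tangentDisk_eq, ← hd]
  have hb : b = -2 * ((-b.re / 2 : ℝ) : ℂ) - Complex.I := by
    apply Complex.ext
    · simp; ring
    · simp [h1]
  rw [← hb]

/-- An element that fixes the three disks of the standard triple is trivial. -/
theorem eq_one_of_act {A : PSL(2, ℂ)} (h1 : act A upperHalfPlane = upperHalfPlane)
    (h2 : act A lowerHalfPlane = lowerHalfPlane) (h3 : act A (tangentDisk 0) = tangentDisk 0) :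
    A = 1 := by
  obtain ⟨B, rfl⟩ := psl_surjective A
  obtain ⟨a, b, c, d, hdet, rfl⟩ := exists_mkSL B
  rw [upperHalfPlane, act_mk] at h1
  rw [lowerHalfPlane, act_mk] at h2
  rw [tangentDisk, act_mk] at h3
  have e1 := congrFun (congrFun h1 0) 0
  have e2 := congrFun (congrFun h2 0) 0
  have e3 := congrFun (congrFun h1 0) 1
  have e4 := congrFun (congrFun h3 0) 0
  have e5 := congrFun (congrFun h3 0) 1
  simp at e1 e2 e3 e4 e5
  -- The two half-planes add up to `diag(0, 2)`, whose invariance forces `|c|² = 0`, that is, the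
  -- point at infinity is fixed.
  have hc : c = 0 := by
    have : c * (starRingEnd ℂ) c = 0 := by linear_combination (e1 + e2) / 2
    rw [Complex.mul_conj] at this
    exact Complex.normSq_eq_zero.1 (by exact_mod_cast this)
  subst hc
  have hdet' := hdet
  simp at hdet' e1 e2 e3 e4 e5
  have hdd : d * (starRingEnd ℂ) d = 1 := by linear_combination e4 / 2
  have hda : d = (starRingEnd ℂ) d := by
    have h0 : d ≠ 0 := by rintro rfl; simp at hdet'
    have h5 : a = (starRingEnd ℂ) d := mul_right_cancel₀ h0 (by rw [hdet', mul_comm, hdd])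
    have h6 := e3
    rw [h5] at h6
    simp at h6
    have : d * d = d * (starRingEnd ℂ) d := by
      rw [hdd]
      have hI : Complex.I * (d * d - 1) = 0 := by linear_combination h6
      rcases mul_eq_zero.1 hI with h | h
      · exact (Complex.I_ne_zero h).elim
      · linear_combination h
    exact mul_left_cancel₀ h0 this
  have hd2 : d * d = 1 := by rw [← hdd, ← hda]
  have hb : b = 0 := by
    have h0 : d ≠ 0 := by rintro rfl; simp at hdet'
    have had : a = d := mul_right_cancel₀ h0 (by rw [hdet', hd2])
    rw [had] at e5
    have : (starRingEnd ℂ) b * d = 0 := by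
      rw [← hda] at e5
      linear_combination (-1/2) * e5 - Complex.I / 2 * hd2
    rcases mul_eq_zero.1 this with h | h
    · simpa using h
    · exact (h0 h).elim
  subst hb
  have hd : d = 1 ∨ d = -1 := mul_self_eq_one_iff.1 hd2
  rcases hd with rfl | rfl
  · have ha : a = 1 := by simpa using hdet'
    subst ha
    rw [← map_one psl]
    congr 1
    apply Subtype.ext
    rw [coe_mkSL]
    exact Matrix.one_fin_two.symm
  · have ha : a = -1 := by linear_combination -hdet'
    subst ha
    rw [← psl_neg_one, neg_one_eq_mkSL]

theorem eq_of_act {A B : PSL(2, ℂ)} {X Y Z : Mat} (hA1 : act A X = upperHalfPlane)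
    (hA2 : act A Y = lowerHalfPlane) (hA3 : act A Z = tangentDisk 0)
    (hB1 : act B X = upperHalfPlane) (hB2 : act B Y = lowerHalfPlane)
    (hB3 : act B Z = tangentDisk 0) : A = B := by
  have : A * B⁻¹ = 1 := by
    refine eq_one_of_act ?_ ?_ ?_
    · rw [act_mul, ← hB1, act_inv_act, hA1, hB1]
    · rw [act_mul, ← hB2, act_inv_act, hA2, hB2]
    · rw [act_mul, ← hB3, act_inv_act, hA3, hB3]
  exact mul_inv_eq_one.1 this

/-! ### Tangency points and cross ratios -/

/-- The determinant of two vectors of the plane. -/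
def det₂ (v w : Fin 2 → ℂ) : ℂ := v 0 * w 1 - v 1 * w 0

theorem det₂_mulVec (B : SL(2, ℂ)) (v w : Fin 2 → ℂ) :
    det₂ ((B : Mat) *ᵥ v) ((B : Mat) *ᵥ w) = det₂ v w := by
  have h : (B : Mat) 0 0 * (B : Mat) 1 1 - (B : Mat) 0 1 * (B : Mat) 1 0 = 1 := by
    rw [← Matrix.det_fin_two]; exact B.det_coe
  simp [det₂, Matrix.mulVec, dotProduct, Fin.sum_univ_two]
  linear_combination (v 0 * w 1 - v 1 * w 0) * h

theorem mk_eq_mk_iff_det₂ {v w : Fin 2 → ℂ} (hv : v ≠ 0) (hw : w ≠ 0) :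
    (Projectivization.mk ℂ v hv : CP1) = Projectivization.mk ℂ w hw ↔ det₂ v w = 0 := by
  rw [Projectivization.mk_eq_mk_iff']
  constructor
  · rintro ⟨a, rfl⟩
    simp [det₂]; ring
  · intro h
    rw [det₂] at h
    have hw' : w 0 ≠ 0 ∨ w 1 ≠ 0 := by
      by_contra hc
      push Not at hc
      exact hw (funext fun i => by fin_cases i; exacts [hc.1, hc.2])
    rcases hw' with h0 | h0
    · refine ⟨v 0 / w 0, funext fun i => ?_⟩
      fin_cases i
      · simp; field_simp
      · simp; field_simp; linear_combination h
    · refine ⟨v 1 / w 1, funext fun i => ?_⟩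
      fin_cases i
      · simp; field_simp; linear_combination -h
      · simp; field_simp

/-- A non-zero `2 × 2` matrix has a kernel of dimension at most one, so the choice made by
`Classical.epsilon` is forced. -/
theorem tangencyPoint_eq {X Y : Mat} (h : X + Y ≠ 0) {v : Fin 2 → ℂ} (hv : v ≠ 0)
    (hk : v ᵥ* (X + Y) = 0) : tangencyPoint X Y = Projectivization.mk ℂ v hv := by
  have hrep : ∀ p : CP1, p.rep ᵥ* (X + Y) = 0 ↔ p = Projectivization.mk ℂ v hv := by
    intro p
    conv_rhs => rw [← p.mk_rep]
    rw [mk_eq_mk_iff_det₂]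
    constructor
    · intro hp
      by_contra hdet
      apply h
      have h0 := congrFun hp 0
      have h1 := congrFun hp 1
      have k0 := congrFun hk 0
      have k1 := congrFun hk 1
      simp only [Matrix.vecMul, dotProduct, Fin.sum_univ_two, Pi.zero_apply] at h0 h1 k0 k1
      rw [det₂] at hdet
      ext i j
      refine mul_left_cancel₀ hdet ?_
      rw [Matrix.zero_apply, mul_zero]
      fin_cases i <;> fin_cases j <;> simp only [Fin.zero_eta, Fin.mk_one, Fin.isValue]
      · linear_combination v 1 * h0 - p.rep 1 * k0
      · linear_combination v 1 * h1 - p.rep 1 * k1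
      · linear_combination p.rep 0 * k0 - v 0 * h0
      · linear_combination p.rep 0 * k1 - v 0 * h1
    · intro hdet
      have h2 := (mk_eq_mk_iff_det₂ p.rep_nonzero hv).2 hdet
      obtain ⟨a, ha⟩ := (Projectivization.mk_eq_mk_iff' ℂ _ _ p.rep_nonzero hv).1 h2
      rw [← ha, Matrix.smul_vecMul, hk, smul_zero]
  have hex : ∃ p : CP1, p.rep ᵥ* (X + Y) = 0 := ⟨_, (hrep _).2 rfl⟩
  exact (hrep _).1 (Classical.epsilon_spec hex)

theorem vecMul_act (B : SL(2, ℂ)) (v : Fin 2 → ℂ) (X : Mat) :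
    ((B : Mat) *ᵥ v) ᵥ* act (psl B) X = (v ᵥ* X) ᵥ* conjMat ((B⁻¹ : SL(2, ℂ)) : Mat) := by
  rw [act_psl, ← Matrix.vecMul_transpose, Matrix.vecMul_vecMul, ← Matrix.mul_assoc,
    ← Matrix.mul_assoc, ← Matrix.transpose_mul, ← Matrix.SpecialLinearGroup.coe_mul,
    inv_mul_cancel, Matrix.SpecialLinearGroup.coe_one, Matrix.transpose_one, one_mul,
    Matrix.vecMul_vecMul]

theorem tangencyPoint_act (A : PSL(2, ℂ)) {X Y : Mat} (h : X + Y ≠ 0) (hd : (X + Y).det = 0) :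
    tangencyPoint (act A X) (act A Y) = A • tangencyPoint X Y := by
  obtain ⟨B, rfl⟩ := psl_surjective A
  obtain ⟨v, hv, hk⟩ := Matrix.exists_vecMul_eq_zero_iff.2 hd
  rw [tangencyPoint_eq h hv hk, smul_psl B v hv (mulVec_ne_zero B hv)]
  refine tangencyPoint_eq ?_ _ ?_
  · rw [← map_add]
    intro h0
    exact h (act_injective _ (by rw [h0, map_zero]))
  · rw [← map_add, vecMul_act, hk, Matrix.zero_vecMul]

/-- Each point occurs once in the numerator and once in the denominator, so the scalars relating the
representatives cancel. -/
theorem crossRatio_mk {a b c d : Fin 2 → ℂ} (ha : a ≠ 0) (hb : b ≠ 0) (hc : c ≠ 0) (hd : d ≠ 0) :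
    crossRatio (Projectivization.mk ℂ a ha) (Projectivization.mk ℂ b hb)
      (Projectivization.mk ℂ c hc) (Projectivization.mk ℂ d hd) =
      det₂ d b * det₂ c a / (det₂ d a * det₂ c b) := by
  obtain ⟨x, hx⟩ := Projectivization.exists_smul_eq_mk_rep ℂ a ha
  obtain ⟨y, hy⟩ := Projectivization.exists_smul_eq_mk_rep ℂ b hb
  obtain ⟨z, hz⟩ := Projectivization.exists_smul_eq_mk_rep ℂ c hc
  obtain ⟨w, hw⟩ := Projectivization.exists_smul_eq_mk_rep ℂ d hd
  simp only [crossRatio, ← hx, ← hy, ← hz, ← hw, det₂, Units.smul_def, Pi.smul_apply, smul_eq_mul]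
  have hx0 := x.ne_zero
  have hy0 := y.ne_zero
  have hz0 := z.ne_zero
  have hw0 := w.ne_zero
  rw [show ((w : ℂ) * d 0 * (y * b 1) - w * d 1 * (y * b 0)) * (z * c 0 * (x * a 1) - z * c 1 *
      (x * a 0)) = (x * y * z * w) * ((d 0 * b 1 - d 1 * b 0) * (c 0 * a 1 - c 1 * a 0)) by ring,
    show ((w : ℂ) * d 0 * (x * a 1) - w * d 1 * (x * a 0)) * (z * c 0 * (y * b 1) - z * c 1 *
      (y * b 0)) = (x * y * z * w) * ((d 0 * a 1 - d 1 * a 0) * (c 0 * b 1 - c 1 * b 0)) by ring,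
    mul_div_mul_left _ _ (by simp)]

theorem crossRatio_smul (A : PSL(2, ℂ)) (a b c d : CP1) :
    crossRatio (A • a) (A • b) (A • c) (A • d) = crossRatio a b c d := by
  obtain ⟨B, rfl⟩ := psl_surjective A
  induction a using Projectivization.ind with | _ a ha
  induction b using Projectivization.ind with | _ b hb
  induction c using Projectivization.ind with | _ c hc
  induction d using Projectivization.ind with | _ d hd
  rw [smul_psl B a ha (mulVec_ne_zero B ha), smul_psl B b hb (mulVec_ne_zero B hb),
    smul_psl B c hc (mulVec_ne_zero B hc), smul_psl B d hd (mulVec_ne_zero B hd),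
    crossRatio_mk, crossRatio_mk, det₂_mulVec, det₂_mulVec, det₂_mulVec, det₂_mulVec]

end CirclePacking

namespace CirclePacking

/-! ## Frames adapted to a circle packing -/

theorem smul_point_mkSL (a b c d z w : ℂ) (h : a * d - b * c = 1) (hz : ![z, w] ≠ 0)
    (hz' : ![a * z + b * w, c * z + d * w] ≠ 0) :
    psl (mkSL a b c d h) • point z w hz = point (a * z + b * w) (c * z + d * w) hz' := by
  rw [point, smul_psl _ _ hz (mulVec_ne_zero _ hz), point]
  congr 1
  rw [coe_mkSL]
  ext i
  fin_cases i <;> simp [Matrix.mulVec, dotProduct, Fin.sum_univ_two]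

theorem point_eq_point_iff {z w z' w' : ℂ} (h : ![z, w] ≠ 0) (h' : ![z', w'] ≠ 0) :
    point z w h = point z' w' h' ↔ z * w' - w * z' = 0 := by
  rw [point, point, mk_eq_mk_iff_det₂]
  simp [det₂]

theorem cons_one_ne_zero (z : ℂ) : ![z, 1] ≠ 0 := fun h => by simpa using congrFun h 1

theorem smul_scale_realPoint (r : ℝ) (hr : r ≠ 0) (x : ℝ) :
    psl (scaleSL r hr) • realPoint x = realPoint (r ^ 2 * x) := by
  have hr' : (r : ℂ) ≠ 0 := by exact_mod_cast hr
  rw [scaleSL, realPoint, smul_point_mkSL _ _ _ _ _ _ _ _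
    (fun h => by simpa [hr'] using congrFun h 1), realPoint, point_eq_point_iff]
  push_cast
  field_simp
  ring

theorem smul_translate_realPoint (s x : ℝ) :
    psl (translateSL s) • realPoint x = realPoint (x + s) := by
  rw [translateSL, realPoint, smul_point_mkSL _ _ _ _ _ _ _ _
    (fun h => by simpa using congrFun h 1), realPoint, point_eq_point_iff]
  push_cast
  ring

theorem tangencyPoint_upper_lower : tangencyPoint upperHalfPlane lowerHalfPlane = infinityPoint := by
  refine tangencyPoint_eq (fun h => ?_) _ ?_
  · simpa [upperHalfPlane, lowerHalfPlane] using congrFun (congrFun h 1) 1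
  · ext i
    fin_cases i <;> simp [upperHalfPlane, lowerHalfPlane]

theorem tangentDisk_injective : Function.Injective tangentDisk := fun s t h => by
  have h1 := congrFun (congrFun h 0) 1
  have h2 : (s : ℂ) = t := by
    simp [tangentDisk] at h1
    exact_mod_cast h1
  exact_mod_cast h2

/-- A disk tangent to the upper half-plane at infinity. -/
theorem exists_scale {Y : Mat} (hY : Y ∈ deSitter) (hm : mink upperHalfPlane Y = -1)
    (hn : ¬ (-(upperHalfPlane + Y)).PosSemidef)
    (ht : tangencyPoint upperHalfPlane Y = infinityPoint) :
    ∃ r hr, act (psl (scaleSL r hr)) upperHalfPlane = upperHalfPlane ∧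
      act (psl (scaleSL r hr)) Y = lowerHalfPlane := by
  have hne : upperHalfPlane + Y ≠ 0 := fun h => hn (by
    rw [h, neg_zero]; exact Matrix.PosSemidef.zero)
  have hd := det_add_eq_zero upper_mem hY hm
  obtain ⟨v, hv, hk⟩ := Matrix.exists_vecMul_eq_zero_iff.2 hd
  rw [tangencyPoint_eq hne hv hk, infinityPoint, point, mk_eq_mk_iff_det₂] at ht
  have hv1 : v 1 = 0 := by simpa [det₂] using ht
  have hv0 : v 0 ≠ 0 := fun h0 => hv (funext fun i => by fin_cases i; exacts [h0, hv1])
  obtain ⟨a, c, b, rfl⟩ := exists_of_isHermitian hY.1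
  have h0 := congrFun hk 0
  have h1 := congrFun hk 1
  simp [upperHalfPlane, Matrix.vecMul, dotProduct, Fin.sum_univ_two, hv1, hv0] at h0 h1
  subst h0
  have hb : b = -Complex.I := by linear_combination h1
  subst hb
  -- The disk is `Im z < -c / 2`. For `c ≤ 0` it would overlap the upper half-plane or be its
  -- complement, and the sum would be negative semidefinite. Scaling by `r ^ 2 = 2 / c` then moves
  -- its boundary to `Im z = -1`.
  have hc : 0 < c := by
    by_contra hc
    push Not at hc
    apply hn
    have : -(upperHalfPlane + !![((0 : ℝ) : ℂ), -Complex.I; star (-Complex.I), (c : ℂ)]) =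
        Matrix.diagonal ![0, ((-c : ℝ) : ℂ)] := by
      ext i j
      fin_cases i <;> fin_cases j <;> simp [upperHalfPlane]
    rw [this]
    refine Matrix.PosSemidef.diagonal fun i => ?_
    fin_cases i
    · simp
    · simpa using Complex.real_le_real.2 hc
  have hr : Real.sqrt (2 / c) ≠ 0 := (Real.sqrt_pos.2 (by positivity)).ne'
  have hr' : (Real.sqrt (2 / c) : ℂ) ≠ 0 := by exact_mod_cast hr
  have hsq : (Real.sqrt (2 / c) : ℂ) * Real.sqrt (2 / c) * c = 2 := by
    have h2 : Real.sqrt (2 / c) * Real.sqrt (2 / c) * c = 2 := by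
      rw [Real.mul_self_sqrt (by positivity)]
      field_simp
    exact_mod_cast h2
  refine ⟨Real.sqrt (2 / c), hr, ?_, ?_⟩
  · rw [scaleSL, upperHalfPlane, act_mk]
    apply mat_congr <;> simp <;> field_simp
  · rw [scaleSL, lowerHalfPlane, act_mk]
    rw [star_neg, ← Complex.ofReal_inv]
    set r := Real.sqrt (2 / c)
    apply mat_congr <;> simp
    · field_simp
    · field_simp
    · linear_combination hsq

variable {D D' : Type*} {M : Triangulation D} {U : UniversalCovering M D'}

open UniversalCovering Triangulation

namespace UniversalCovering.DevelopedPacking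

variable (p : U.DevelopedPacking)

theorem add_ne_zero (e : D') : p.disk (U.cover.tail e) + p.disk (U.cover.head e) ≠ 0 := fun h =>
  p.not_neg e (by rw [h, neg_zero]; exact Matrix.PosSemidef.zero)

theorem smul_tangency (A : PSL(2, ℂ)) (e : D') : A • U.tangency p.disk e =
    tangencyPoint (act A (p.disk (U.cover.tail e))) (act A (p.disk (U.cover.head e))) :=
  (tangencyPoint_act A (p.add_ne_zero e) (det_add_eq_zero (p.disk_mem _) (p.disk_mem _)
    (p.mink_eq e))).symm

theorem mink_eq_next (e : D') :
    mink (p.disk (U.cover.tail e)) (p.disk (U.cover.head (U.cover.next e))) = -1 := by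
  rw [← head_rot, ← tail_rot, p.mink_eq]

theorem mink_head_next (e : D') :
    mink (p.disk (U.cover.head e)) (p.disk (U.cover.head (U.cover.next e))) = -1 := by
  rw [← tail_next, p.mink_eq]

/-- The chart provided by `turnsOnce` is determined up to maps `z ↦ r² z + s`. The scale normalizes
the second disk and the translation the third, and such maps preserve the order of the tangency
points. -/
theorem exists_frame (e : D') : ∃ (A : PSL(2, ℂ)) (x : ℕ → ℝ),
    act A (p.disk (U.cover.tail e)) = upperHalfPlane ∧
    act A (p.disk (U.cover.head e)) = lowerHalfPlane ∧
    act A (p.disk (U.cover.head (U.cover.next e))) = tangentDisk 0 ∧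
    (∀ i, 1 ≤ i → i < U.cover.valence e →
      A • U.tangency p.disk (U.cover.rot^[i] e) = realPoint (x i)) ∧
    ∀ i j, 1 ≤ i → i < j → j < U.cover.valence e → x i < x j := by
  obtain ⟨A, x, h1, h2, h3, h4⟩ := p.turnsOnce e
  have hm : mink upperHalfPlane (act A (p.disk (U.cover.head e))) = -1 := by
    rw [← h1, mink_act, p.mink_eq]
  obtain ⟨r, hr, h5, h6⟩ := exists_scale (act_mem_deSitter A (p.disk_mem (U.cover.head e))) hm
    (fun h => p.not_neg e (by
      have := posSemidef_act A⁻¹ h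
      rwa [map_neg, map_add, act_inv_act, ← h1, act_inv_act] at this))
    (by rw [← h2, p.smul_tangency, h1])
  have h7 : act (psl (scaleSL r hr) * A) (p.disk (U.cover.tail e)) = upperHalfPlane := by
    rw [act_mul, h1, h5]
  have h8 : act (psl (scaleSL r hr) * A) (p.disk (U.cover.head e)) = lowerHalfPlane := by
    rw [act_mul, h6]
  obtain ⟨t, ht⟩ := exists_tangentDisk
    (act_mem_deSitter (psl (scaleSL r hr) * A) (p.disk_mem (U.cover.head (U.cover.next e))))
    (by rw [← h7, mink_act, p.mink_eq_next]) (by rw [← h8, mink_act, p.mink_head_next])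
  refine ⟨psl (translateSL (-t)) * (psl (scaleSL r hr) * A), fun i => r ^ 2 * x i + -t,
    ?_, ?_, ?_, ?_, ?_⟩
  · rw [act_mul, h7, act_translate_upper]
  · rw [act_mul, h8, act_translate_lower]
  · rw [act_mul, ht, act_translate_tangentDisk, add_neg_cancel]
  · intro i hi hi'
    rw [mul_smul, mul_smul, h3 i hi hi', smul_scale_realPoint, smul_translate_realPoint]
  · intro i j hi hij hj
    have := h4 i j hi hij hj
    have hr2 : 0 < r ^ 2 := by positivity
    have := mul_lt_mul_of_pos_left this hr2
    linarith

/-- The Moebius transformation that takes the disks at the vertices of the triangle on the left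
of `e` to the standard triple. -/
def frame (e : D') : PSL(2, ℂ) := Classical.choose (p.exists_frame e)

theorem act_frame_tail (e : D') : act (p.frame e) (p.disk (U.cover.tail e)) = upperHalfPlane :=
  (Classical.choose_spec (p.exists_frame e)).choose_spec.1

theorem act_frame_head (e : D') : act (p.frame e) (p.disk (U.cover.head e)) = lowerHalfPlane :=
  (Classical.choose_spec (p.exists_frame e)).choose_spec.2.1

theorem act_frame_third (e : D') :
    act (p.frame e) (p.disk (U.cover.head (U.cover.next e))) = tangentDisk 0 :=
  (Classical.choose_spec (p.exists_frame e)).choose_spec.2.2.1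

theorem exists_frame_smul_tangency (e : D') : ∃ x : ℕ → ℝ,
    (∀ i, 1 ≤ i → i < U.cover.valence e →
      p.frame e • U.tangency p.disk (U.cover.rot^[i] e) = realPoint (x i)) ∧
    ∀ i j, 1 ≤ i → i < j → j < U.cover.valence e → x i < x j :=
  ⟨_, (Classical.choose_spec (p.exists_frame e)).choose_spec.2.2.2⟩

variable {p}

theorem frame_unique {e : D'} {A : PSL(2, ℂ)}
    (h1 : act A (p.disk (U.cover.tail e)) = upperHalfPlane)
    (h2 : act A (p.disk (U.cover.head e)) = lowerHalfPlane)
    (h3 : act A (p.disk (U.cover.head (U.cover.next e))) = tangentDisk 0) : p.frame e = A :=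
  eq_of_act (p.act_frame_tail e) (p.act_frame_head e) (p.act_frame_third e) h1 h2 h3

variable (p)

theorem frame_next (e : D') : p.frame (U.cover.next e) = rotate * p.frame e := by
  apply frame_unique
  · rw [tail_next, act_mul, act_frame_head, act_rotate_lower]
  · rw [act_mul, act_frame_third, act_rotate_tangentDisk]
  · rw [head_next_next, act_mul, act_frame_tail, act_rotate_upper]

theorem exists_shape (e : D') : ∃ t : ℝ,
    act (p.frame e) (p.disk (U.cover.head (U.cover.next (U.cover.rev e)))) = tangentDisk t := by
  refine exists_tangentDisk (act_mem_deSitter _ (p.disk_mem _)) ?_ ?_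
  · rw [← p.act_frame_tail e, mink_act, ← head_rev, p.mink_head_next]
  · rw [← p.act_frame_head e, mink_act, head_eq, p.mink_eq_next]

/-- The relative position of the two triangles adjacent to `e`. -/
def shape (e : D') : ℝ := Classical.choose (p.exists_shape e)

theorem act_frame_rev_third (e : D') :
    act (p.frame e) (p.disk (U.cover.head (U.cover.next (U.cover.rev e)))) =
      tangentDisk (p.shape e) := Classical.choose_spec (p.exists_shape e)

theorem frame_rev (e : D') : p.frame (U.cover.rev e) = flip (p.shape e) * p.frame e := by
  apply frame_unique
  · rw [← head_eq, act_mul, act_frame_head, act_flip_lower]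
  · rw [head_rev, act_mul, act_frame_tail, act_flip_upper]
  · rw [act_mul, act_frame_rev_third, act_flip_tangentDisk, sub_self]

theorem shape_rev (e : D') : p.shape (U.cover.rev e) = p.shape e := by
  have h := p.act_frame_rev_third (U.cover.rev e)
  rw [U.cover.rev_rev, p.frame_rev, act_mul, act_frame_third, act_flip_tangentDisk, sub_zero] at h
  exact (tangentDisk_injective h).symm

/-- The right-hand side is a polynomial in the entries of two disks. This is how smoothness and
derivatives of the cross ratios are reached. -/
theorem shape_sq (e : D') : 1 - 2 * p.shape e ^ 2 = mink (p.disk (U.cover.head (U.cover.next e)))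
    (p.disk (U.cover.head (U.cover.next (U.cover.rev e)))) := by
  rw [← mink_act (p.frame e), act_frame_third, act_frame_rev_third, mink_tangentDisk, zero_sub,
    neg_sq]

theorem disk_tail_deck (h : U.Deck) (e : D') :
    p.disk (U.cover.tail ((h : Equiv.Perm D') e)) = act (p.hol h) (p.disk (U.cover.tail e)) :=
  p.equivariant h e

theorem disk_head_deck (h : U.Deck) (e : D') :
    p.disk (U.cover.head ((h : Equiv.Perm D') e)) = act (p.hol h) (p.disk (U.cover.head e)) := by
  rw [head_eq, ← h.2.1, p.equivariant, head_eq]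

theorem frame_deck (h : U.Deck) (e : D') :
    p.frame ((h : Equiv.Perm D') e) = p.frame e * (p.hol h)⁻¹ := by
  apply frame_unique
  · rw [disk_tail_deck, act_mul, act_inv_act, act_frame_tail]
  · rw [disk_head_deck, act_mul, act_inv_act, act_frame_head]
  · rw [← h.2.2.1, disk_head_deck, act_mul, act_inv_act, act_frame_third]

theorem shape_deck (h : U.Deck) (e : D') : p.shape ((h : Equiv.Perm D') e) = p.shape e := by
  apply tangentDisk_injective
  rw [← act_frame_rev_third, ← act_frame_rev_third, ← h.2.1, ← h.2.2.1, disk_head_deck, frame_deck,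
    act_mul, act_inv_act]

theorem shape_eq_of_edge_eq {e e' : D'} (h : M.edge (U.proj e) = M.edge (U.proj e')) :
    p.shape e = p.shape e' := by
  rcases M.edge_eq_iff.1 h with h | h
  · obtain ⟨k, rfl⟩ := U.exists_deck h.symm
    rw [shape_deck]
  · rw [← U.proj_rev] at h
    obtain ⟨k, rfl⟩ := U.exists_deck h.symm
    rw [shape_deck, shape_rev]

theorem frame_eq_of_act {p q : U.DevelopedPacking} {A : PSL(2, ℂ)}
    (h : ∀ v, q.disk v = act A (p.disk v)) (e : D') : q.frame e = p.frame e * A⁻¹ := by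
  apply frame_unique
  · rw [h, act_mul, act_inv_act, act_frame_tail]
  · rw [h, act_mul, act_inv_act, act_frame_head]
  · rw [h, act_mul, act_inv_act, act_frame_third]

theorem shape_eq_of_act {p q : U.DevelopedPacking} {A : PSL(2, ℂ)}
    (h : ∀ v, q.disk v = act A (p.disk v)) (e : D') : q.shape e = p.shape e := by
  apply tangentDisk_injective
  rw [← act_frame_rev_third, ← act_frame_rev_third, h, frame_eq_of_act h, act_mul, act_inv_act]

/-- In the frame of `e` the four tangency points are `∞`, `-i`, `0` and `t - i` with `t = p.shape
e`; their cross ratio is `-i t`. -/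
theorem edgeCrossRatio_eq (e : D') : p.edgeCrossRatio e = p.shape e := by
  rw [edgeCrossRatio, ← crossRatio_smul (p.frame e), smul_tangency, smul_tangency, smul_tangency,
    smul_tangency, act_frame_tail, act_frame_head, tail_next, act_frame_head, act_frame_third,
    head_next_next, tail_next, act_frame_third, act_frame_tail, head_next_next, tail_next,
    act_frame_rev_third, ← head_eq, act_frame_head,
    tangencyPoint_upper_lower,
    tangencyPoint_eq (v := ![-Complex.I, 1]) (X := lowerHalfPlane) (Y := tangentDisk 0)
      (fun h => by simpa [lowerHalfPlane, tangentDisk] using congrFun (congrFun h 0) 0)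
      (cons_one_ne_zero _) ?_,
    tangencyPoint_eq (v := ![0, 1]) (X := tangentDisk 0) (Y := upperHalfPlane)
      (fun h => by simpa [upperHalfPlane, tangentDisk] using congrFun (congrFun h 0) 0)
      (cons_one_ne_zero _) ?_,
    tangencyPoint_eq (v := ![p.shape e - Complex.I, 1]) (X := tangentDisk (p.shape e))
      (Y := lowerHalfPlane)
      (fun h => by simpa [lowerHalfPlane, tangentDisk] using congrFun (congrFun h 0) 0)
      (cons_one_ne_zero _) ?_, infinityPoint, point, crossRatio_mk]
  · simp [det₂]
    field_simp
    linear_combination -(p.shape e : ℂ) * Complex.I_sq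
  all_goals
    ext i
    fin_cases i <;> simp [lowerHalfPlane, tangentDisk, upperHalfPlane, Matrix.vecMul, dotProduct,
      Fin.sum_univ_two] <;> grind [Complex.I_mul_I]

end UniversalCovering.DevelopedPacking

/-! ### Systems of frames and the closing equations -/

theorem crossRatioMap_edge (p : U.DevelopedPacking) (e : D') :
    U.crossRatioMap p.toSpace (M.edge (U.proj e)) = p.shape e := by
  rw [crossRatioMap, DevelopedPacking.edgeCrossRatio_eq, Complex.ofReal_re]
  obtain ⟨A, -, hA⟩ : (DevelopedPacking.setoid U).r p (Quotient.out p.toSpace) :=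
    Quotient.exact (Quotient.out_eq p.toSpace).symm
  rw [DevelopedPacking.shape_eq_of_act hA]
  apply DevelopedPacking.shape_eq_of_edge_eq
  exact (congrArg M.edge (Function.surjInv_eq U.proj_surjective _)).trans (Quotient.out_eq _)

theorem ofReal_crossRatioMap (p : U.DevelopedPacking) (e : D') :
    ((U.crossRatioMap p.toSpace (M.edge (U.proj e)) : ℝ) : ℂ) = p.edgeCrossRatio e := by
  rw [crossRatioMap_edge, p.edgeCrossRatio_eq]

/-- A system of frames with given relative positions of adjacent triangles. -/
structure IsFrame (U : UniversalCovering M D') (t : M.Edge → ℝ) (A : D' → PSL(2, ℂ)) : Prop where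
  next : ∀ e, A (U.cover.next e) = rotate * A e
  rev : ∀ e, A (U.cover.rev e) = flip (t (M.edge (U.proj e))) * A e

theorem UniversalCovering.DevelopedPacking.isFrame (p : U.DevelopedPacking) :
    IsFrame U (U.crossRatioMap p.toSpace) p.frame where
  next := p.frame_next
  rev e := by rw [p.frame_rev, crossRatioMap_edge]

/-- The unimodular matrix of `transport`. -/
def transportSL (t : M.Edge → ℝ) (d : D) : ℕ → SL(2, ℂ)
  | 0 => 1
  | i + 1 => friezeSL (t (M.edge (M.rot^[i + 1] d))) * transportSL t d i

theorem coe_transportSL (t : M.Edge → ℝ) (d : D) (i : ℕ) :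
    (transportSL t d i : Mat) = (M.transport t d i).map Complex.ofReal := by
  induction i with
  | zero =>
    ext i j
    fin_cases i <;> fin_cases j <;> simp [transportSL, transport]
  | succ i ih =>
    rw [transportSL, Matrix.SpecialLinearGroup.coe_mul, ih, transport_succ, friezeSL, coe_mkSL]
    ext a b
    rw [Matrix.map_apply, Matrix.mul_apply, Fin.sum_univ_two]
    fin_cases a
    · simp [frieze_mul_zero]
      ring
    · simp [frieze_mul_one]

theorem transportSL_eq (t : M.Edge → ℝ) (d : D) (i : ℕ) : transportSL t d i =
    mkSL (M.transport t d i 0 0) (M.transport t d i 0 1) (M.transport t d i 1 0)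
      (M.transport t d i 1 1) (by
        have := det_transport t d i
        rw [Matrix.det_fin_two] at this
        exact_mod_cast this) := by
  apply Subtype.ext
  rw [coe_mkSL, coe_transportSL]
  ext i j
  fin_cases i <;> fin_cases j <;> rfl

theorem infinityPoint_eq_smul_realPoint {t : M.Edge → ℝ} {d : D} {i : ℕ} {x : ℝ} :
    psl (transportSL t d i) • realPoint x = infinityPoint ↔
      M.transport t d i 1 0 * x + M.transport t d i 1 1 = 0 := by
  have hne := mulVec_ne_zero (transportSL t d i) (cons_one_ne_zero x)
  rw [transportSL_eq, coe_mkSL] at hne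
  rw [transportSL_eq, realPoint, smul_point_mkSL _ _ _ _ _ _ _ _ (fun h => hne (by
    rw [← h]
    ext i
    fin_cases i <;> simp [Matrix.mulVec, dotProduct, Fin.sum_univ_two])), infinityPoint,
    point_eq_point_iff]
  rw [← Complex.ofReal_inj]
  push_cast
  constructor <;> intro h <;> linear_combination -h

namespace IsFrame

variable {t : M.Edge → ℝ} {A : D' → PSL(2, ℂ)} (h : IsFrame U t A)

include h

theorem rot (e : D') :
    A (U.cover.rot e) = psl (friezeSL (t (M.edge (M.rot (U.proj e))))) * A e := by
  rw [rot_apply, h.rev, h.next, h.next, ← flip_rotate_rotate, U.proj_next, U.proj_next, rot_apply,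
    edge_rev]
  simp only [mul_assoc]

theorem rot_iterate (e : D') (i : ℕ) :
    A (U.cover.rot^[i] e) = psl (transportSL t (U.proj e) i) * A e := by
  induction i with
  | zero => simp [transportSL]
  | succ i ih =>
    rw [Function.iterate_succ_apply', h.rot, ih, transportSL, map_mul, mul_assoc, U.proj_rot_iterate,
      ← Function.iterate_succ_apply' M.rot]

theorem psl_transportSL_valence (e : D') :
    psl (transportSL t (U.proj e) (M.valence (U.proj e))) = 1 := by
  have h1 := h.rot_iterate e (M.valence (U.proj e))
  rw [U.valence_proj, rot_iterate_valence] at h1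
  rw [U.valence_proj]
  exact right_eq_mul.1 h1

end IsFrame

theorem eq_or_eq_neg_of_psl_eq_one {B : SL(2, ℂ)} (h : psl B = 1) : B = 1 ∨ B = -1 :=
  center_cases ((QuotientGroup.eq_one_iff B).1 h)

/-- The cross ratios of a circle packing close up around each vertex. -/
theorem UniversalCovering.DevelopedPacking.closing (p : U.DevelopedPacking) :
    M.Closing (U.crossRatioMap p.toSpace) := by
  intro d
  obtain ⟨e, rfl⟩ := U.proj_surjective d
  set t := U.crossRatioMap p.toSpace
  set k := M.valence (U.proj e) with hk
  set P := M.transport t (U.proj e) with hP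
  have hk3 : 3 ≤ k := M.three_le _
  obtain ⟨x, hx, hlt⟩ := p.exists_frame_smul_tangency e
  rw [← U.valence_proj, ← hk] at hx hlt
  have hF := p.isFrame
  -- In its own frame each tangency point is `∞`, so in the frame of `e` it is the pole of the
  -- `i`-th product.
  have hx' : ∀ i, 1 ≤ i → i < k → P i 1 0 * x i + P i 1 1 = 0 := by
    intro i hi hik
    have h1 := hx i hi hik
    have h2 : p.frame (U.cover.rot^[i] e) • U.tangency p.disk (U.cover.rot^[i] e) =
        infinityPoint := by
      rw [p.smul_tangency, p.act_frame_tail, p.act_frame_head, tangencyPoint_upper_lower]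
    rw [hF.rot_iterate, mul_smul, h1, infinityPoint_eq_smul_realPoint] at h2
    exact h2
  have hdet : ∀ i, P i 0 0 * P i 1 1 - P i 0 1 * P i 1 0 = 1 := fun i => by
    rw [← Matrix.det_fin_two]; exact det_transport _ _ _
  have hpos : ∀ i, i + 1 < k → 0 < P i 0 0 := by
    intro i
    induction i with
    | zero => intro _; simp [hP, transport]
    | succ i ih =>
      intro hi
      have h1 := ih (by omega)
      have h2 := hx' (i + 1) (by omega) (by omega)
      have h3 := hx' (i + 2) (by omega) (by omega)
      have h4 := hlt (i + 1) (i + 2) (by omega) (by omega) (by omega)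
      have h5 : P (i + 1) 1 0 = P i 0 0 := transport_succ_10 _ _ _
      have h6 : P (i + 2) 1 0 = P (i + 1) 0 0 := transport_succ_10 _ _ _
      have h7 : P (i + 2) 1 1 = P (i + 1) 0 1 := transport_succ_11 _ _ _
      rw [h6, h7] at h3
      rw [h5] at h2
      have h8 := hdet (i + 1)
      rw [h5] at h8
      -- The determinant relation makes consecutive tangency points differ by the inverse of a
      -- product of two entries, so that monotonicity propagates positivity.
      have h9 : P i 0 0 * P (i + 1) 0 0 * (x (i + 2) - x (i + 1)) = 1 := by
        linear_combination h8 + P i 0 0 * h3 - P (i + 1) 0 0 * h2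
      have h10 : 0 < P i 0 0 * (x (i + 2) - x (i + 1)) := mul_pos h1 (by linarith)
      by_contra hc
      push Not at hc
      have := mul_nonpos_of_nonpos_of_nonneg hc h10.le
      linarith
  refine ⟨?_, hpos⟩
  have h1 : transportSL t (U.proj e) k = 1 ∨ transportSL t (U.proj e) k = -1 :=
    eq_or_eq_neg_of_psl_eq_one (hF.psl_transportSL_valence e)
  have hentry : ∀ a b, ((P k a b : ℝ) : ℂ) = (transportSL t (U.proj e) k : Mat) a b := fun a b => by
    rw [coe_transportSL]; rfl
  obtain ⟨j, hj⟩ : ∃ j, k = j + 2 := ⟨k - 2, by omega⟩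
  have h5 : P (j + 1) 1 0 = P j 0 0 := transport_succ_10 _ _ _
  have h6 : P (j + 2) 1 0 = P (j + 1) 0 0 := transport_succ_10 _ _ _
  have h7 : P (j + 2) 1 1 = P (j + 1) 0 1 := transport_succ_11 _ _ _
  have h8 := hdet (j + 1)
  have h9 := hpos j (by omega)
  rcases h1 with h1 | h1
  -- If the product were `+1`, its bottom row `(0, 1)` would be the top row of the preceding
  -- product, whose determinant would give `P j 0 0 = -1`.
  · exfalso
    have e1 := hentry 1 0
    have e2 := hentry 1 1
    rw [h1] at e1 e2
    simp at e1 e2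
    rw [hj] at e1 e2
    norm_cast at e2
    rw [h6] at e1
    rw [h7] at e2
    rw [e1, e2, h5] at h8
    linarith
  · ext a b
    have := hentry a b
    rw [h1] at this
    fin_cases a <;> fin_cases b <;> simp at this ⊢ <;> first | exact this | exact_mod_cast this

theorem Triangulation.Closing.pos {t : M.Edge → ℝ} (h : M.Closing t) (ε : M.Edge) : 0 < t ε := by
  obtain ⟨d, rfl⟩ := M.edge_surjective ε
  have h1 := (h (M.rot.symm d)).2 1 (by have := M.three_le (M.rot.symm d); omega)
  simpa [transport, frieze] using h1

end CirclePacking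

namespace CirclePacking

/-! ## Developing a solution of the closing equations -/

variable {D D' : Type*} {M : Triangulation D} {U : UniversalCovering M D'}

open UniversalCovering Triangulation

theorem psl_eq_one_of_coe_eq_neg_one {B : SL(2, ℂ)} (h : (B : Mat) = -1) : psl B = 1 := by
  rw [show B = -1 from Subtype.ext (by rw [h]; simp), psl_neg_one]

theorem Triangulation.Closing.psl_transportSL {t : M.Edge → ℝ} (h : M.Closing t) (d : D) :
    psl (transportSL t d (M.valence d)) = 1 := by
  apply psl_eq_one_of_coe_eq_neg_one
  rw [coe_transportSL, (h d).1]
  ext i j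
  fin_cases i <;> fin_cases j <;> simp

/-- The space of frames on a triangulated surface that satisfies the closing equations, as an
unbranched covering. -/
def developing (U : UniversalCovering M D') {t : M.Edge → ℝ} (h : M.Closing t) :
    Unbranched U.cover (D' × PSL(2, ℂ)) where
  r :=
    { toFun := fun y => (U.cover.rev y.1, flip (t (M.edge (U.proj y.1))) * y.2)
      invFun := fun y => (U.cover.rev y.1, flip (t (M.edge (U.proj y.1))) * y.2)
      left_inv := fun y => by
        simp only [U.cover.rev_rev, U.proj_rev, M.edge_rev, ← mul_assoc, flip_flip, one_mul]
      right_inv := fun y => by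
        simp only [U.cover.rev_rev, U.proj_rev, M.edge_rev, ← mul_assoc, flip_flip, one_mul] }
  n :=
    { toFun := fun y => (U.cover.next y.1, rotate * y.2)
      invFun := fun y => (U.cover.next (U.cover.next y.1), rotate * rotate * y.2)
      left_inv := fun y => by
        simp only [U.cover.next_next_next, ← mul_assoc, rotate_rotate_rotate, one_mul]
      right_inv := fun y => by
        simp only [U.cover.next_next_next, ← mul_assoc, rotate_rotate_rotate, one_mul] }
  π := Prod.fst
  r_r y := by
    simp only [Equiv.coe_fn_mk, U.cover.rev_rev, U.proj_rev, M.edge_rev, ← mul_assoc, flip_flip,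
      one_mul]
  n_n_n y := by
    simp only [Equiv.coe_fn_mk, U.cover.next_next_next, ← mul_assoc, rotate_rotate_rotate, one_mul]
  π_r y := rfl
  π_n y := rfl
  -- This is where the closing equations enter: the product around a vertex is `-1`, which is
  -- trivial in `PSL(2, ℂ)`.
  period y := by
    have key : ∀ i : ℕ, (fun y : D' × PSL(2, ℂ) =>
        (U.cover.rev (U.cover.next (U.cover.next y.1)),
          flip (t (M.edge (U.proj (U.cover.next (U.cover.next y.1))))) *
            (rotate * (rotate * y.2))))^[i] y =
        (U.cover.rot^[i] y.1, psl (transportSL t (U.proj y.1) i) * y.2) := fun i => by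
      induction i with
      | zero => simp [transportSL]
      | succ i ih =>
        rw [Function.iterate_succ_apply', ih]
        simp only [Function.iterate_succ_apply', transportSL,
          map_mul, ← flip_rotate_rotate, U.proj_next, U.proj_rot_iterate, rot_apply, edge_rev,
          mul_assoc]
    refine (key _).trans ?_
    rw [rot_iterate_valence, ← U.valence_proj, h.psl_transportSL, one_mul]

theorem exists_isFrame {t : M.Edge → ℝ} (h : M.Closing t) (e₀ : D') (g : PSL(2, ℂ)) :
    ∃ A, IsFrame U t A ∧ A e₀ = g := by
  obtain ⟨s, h1, h2, h3, h4⟩ := (developing U h).exists_section U.simplyConnected (e₀, g)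
  refine ⟨fun e => (s e).2, ⟨fun e => ?_, fun e => ?_⟩, congrArg Prod.snd h1⟩
  · exact congrArg Prod.snd (h4 e)
  · refine (congrArg Prod.snd (h3 e)).trans ?_
    change flip (t (M.edge (U.proj ((developing U h).π (s e))))) * _ = _
    rw [h2]

/-- Both systems satisfy the same recursion by left multiplication, so they differ by a constant
right factor. -/
theorem IsFrame.eq_mul {t : M.Edge → ℝ} {A B : D' → PSL(2, ℂ)} (hA : IsFrame U t A)
    (hB : IsFrame U t B) (e₀ e : D') : A e = B e * ((B e₀)⁻¹ * A e₀) := by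
  refine U.simplyConnected.1.dart_induction (P := fun e => A e = B e * ((B e₀)⁻¹ * A e₀))
    (e₀ := e₀) (by group) (fun e he => ?_) (fun e he => ?_) e
  · rw [hA.rev, hB.rev, he, mul_assoc]
  · rw [hA.next, hB.next, he, mul_assoc]

theorem IsFrame.comp_deck {t : M.Edge → ℝ} {A : D' → PSL(2, ℂ)} (hA : IsFrame U t A) (h : U.Deck) :
    IsFrame U t fun e => A ((h : Equiv.Perm D') e) where
  next e := by rw [h.2.2.1, hA.next]
  rev e := by rw [h.2.1, hA.rev, h.2.2.2]

/-- Matrices whose entries are smooth functions of the cross ratios. -/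
def SmoothSL [Finite D] (W : (M.Edge → ℝ) → SL(2, ℂ)) : Prop :=
  ∀ i j, ContDiff ℝ ∞ fun t => (W t : Mat) i j

theorem SmoothSL.mul [Finite D] {V W : (M.Edge → ℝ) → SL(2, ℂ)} (hV : SmoothSL V)
    (hW : SmoothSL W) : SmoothSL fun t => V t * W t := by
  intro i j
  simp only [Matrix.SpecialLinearGroup.coe_mul, Matrix.mul_apply]
  exact ContDiff.sum fun k _ => (hV i k).mul (hW k j)

theorem smoothSL_const [Finite D] (B : SL(2, ℂ)) : SmoothSL fun _ : M.Edge → ℝ => B :=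
  fun _ _ => contDiff_const

theorem smoothSL_flip [Finite D] (ε : M.Edge) : SmoothSL fun t : M.Edge → ℝ => flipSL (t ε) := by
  have h : ContDiff ℝ ∞ fun t : M.Edge → ℝ => ((t ε : ℝ) : ℂ) :=
    Complex.ofRealCLM.contDiff.comp (contDiff_apply ℝ ℝ ε)
  intro i j
  simp only [flipSL, coe_mkSL]
  fin_cases i <;> fin_cases j
  · exact contDiff_const
  · exact (contDiff_const.mul h).add contDiff_const
  · exact contDiff_const
  · exact contDiff_const

/-- Along a path from `e₀` to `e` the frame is multiplied by flips and rotations, which lift to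
matrices smooth in `t`. `W` is defined for every `t`, also where the equations do not close up and
the product depends on the path. -/
theorem exists_frameSL [Finite D] (e₀ e : D') : ∃ W : (M.Edge → ℝ) → SL(2, ℂ), SmoothSL W ∧
    ∀ t A, IsFrame U t A → A e = psl (W t) * A e₀ := by
  refine U.simplyConnected.1.dart_induction (P := fun e => ∃ W : (M.Edge → ℝ) → SL(2, ℂ),
    SmoothSL W ∧ ∀ t A, IsFrame U t A → A e = psl (W t) * A e₀) (e₀ := e₀)
    ⟨fun _ => 1, smoothSL_const 1, fun t A _ => by simp⟩ ?_ ?_ e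
  · rintro e ⟨W, hW, h⟩
    refine ⟨fun t => flipSL (t (M.edge (U.proj e))) * W t, (smoothSL_flip _).mul hW, fun t A hA => ?_⟩
    rw [hA.rev, h t A hA, map_mul, mul_assoc]
    rfl
  · rintro e ⟨W, hW, h⟩
    refine ⟨fun t => rotateSL * W t, (smoothSL_const _).mul hW, fun t A hA => ?_⟩
    rw [hA.next, h t A hA, map_mul, mul_assoc]
    rfl

variable (U) in
/-- A product of standard matrices along an edge path from `e₀` to `e`, as a function of the cross
ratios. -/
def frameSL [Finite D] (e₀ e : D') : (M.Edge → ℝ) → SL(2, ℂ) :=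
  Classical.choose (exists_frameSL (U := U) e₀ e)

theorem smooth_frameSL [Finite D] (e₀ e : D') : SmoothSL (frameSL U e₀ e) :=
  (Classical.choose_spec (exists_frameSL (U := U) e₀ e)).1

theorem IsFrame.eq_frameSL [Finite D] {t : M.Edge → ℝ} {A : D' → PSL(2, ℂ)} (hA : IsFrame U t A)
    (e₀ e : D') : A e = psl (frameSL U e₀ e t) * A e₀ :=
  (Classical.choose_spec (exists_frameSL (U := U) e₀ e)).2 t A hA

theorem isFrame_frameSL [Finite D] {t : M.Edge → ℝ} (h : M.Closing t) (e₀ : D') :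
    IsFrame U t fun e => psl (frameSL U e₀ e t) := by
  obtain ⟨A, hA, h1⟩ := exists_isFrame (U := U) h e₀ 1
  have : (fun e => psl (frameSL U e₀ e t)) = A := funext fun e => by
    rw [hA.eq_frameSL e₀ e, h1, mul_one]
  rwa [this]

theorem psl_frameSL_self [Finite D] {t : M.Edge → ℝ} (h : M.Closing t) (e₀ : D') :
    psl (frameSL U e₀ e₀ t) = 1 := by
  have := (isFrame_frameSL (U := U) h e₀).eq_frameSL e₀ e₀
  exact right_eq_mul.1 this

/-- The holonomy of a solution of the closing equations. -/
def holonomy [Finite D] {t : M.Edge → ℝ} (h : M.Closing t) (e₀ : D') : U.Deck →* PSL(2, ℂ) where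
  toFun k := (psl (frameSL U e₀ ((k : Equiv.Perm D') e₀) t))⁻¹
  map_one' := by
    rw [OneMemClass.coe_one, Equiv.Perm.one_apply, psl_frameSL_self h, inv_one]
  map_mul' k l := by
    have hF := isFrame_frameSL (U := U) h e₀
    have h1 := (hF.comp_deck k).eq_mul hF e₀ ((l : Equiv.Perm D') e₀)
    simp only [psl_frameSL_self h, inv_one, one_mul] at h1
    rw [Subgroup.coe_mul, Equiv.Perm.mul_apply, h1, mul_inv_rev]

theorem holonomy_apply [Finite D] {t : M.Edge → ℝ} (h : M.Closing t) (e₀ : D') (k : U.Deck) :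
    holonomy h e₀ k = (psl (frameSL U e₀ ((k : Equiv.Perm D') e₀) t))⁻¹ := rfl

theorem frameSL_deck [Finite D] {t : M.Edge → ℝ} (h : M.Closing t) (e₀ e : D') (k : U.Deck) :
    psl (frameSL U e₀ ((k : Equiv.Perm D') e) t) =
      psl (frameSL U e₀ e t) * (holonomy h e₀ k)⁻¹ := by
  have hF := isFrame_frameSL (U := U) h e₀
  have h1 := (hF.comp_deck k).eq_mul hF e₀ e
  simp only [psl_frameSL_self h, inv_one, one_mul] at h1
  rw [h1, holonomy_apply, inv_inv]

theorem act_transportSL_upper (t : M.Edge → ℝ) (d : D) (i : ℕ) :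
    act (psl (transportSL t d i)) upperHalfPlane = upperHalfPlane := by
  have hdet := det_transport t d i
  rw [Matrix.det_fin_two] at hdet
  have hdet' : ((M.transport t d i 0 0 : ℝ) : ℂ) * (M.transport t d i 1 1 : ℝ) -
    (M.transport t d i 0 1 : ℝ) * (M.transport t d i 1 0 : ℝ) = 1 := by exact_mod_cast hdet
  rw [transportSL_eq, upperHalfPlane, act_mk]
  apply mat_congr <;> simp
  · ring
  · linear_combination Complex.I * hdet'
  · linear_combination -Complex.I * hdet'
  · ring

variable (U) in
/-- The disks of a solution of the closing equations. -/
def devDisk [Finite D] (t : M.Edge → ℝ) (e₀ : D') (v : U.cover.Vertex) : Mat :=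
  act (psl (frameSL U e₀ (U.cover.baseDart v) t))⁻¹ upperHalfPlane

/-- Frames at the same vertex differ by a real matrix, which preserves the upper half-plane, so the
choice of the base dart is immaterial. -/
theorem devDisk_tail [Finite D] {t : M.Edge → ℝ} (h : M.Closing t) (e₀ e : D') :
    devDisk U t e₀ (U.cover.tail e) = act (psl (frameSL U e₀ e t))⁻¹ upperHalfPlane := by
  obtain ⟨i, -, hi⟩ := U.cover.exists_rot_of_tail_eq (U.cover.tail_baseDart (U.cover.tail e)).symm
  have h1 := (isFrame_frameSL (U := U) h e₀).rot_iterate e i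
  rw [devDisk, ← hi, h1, mul_inv_rev, act_mul]
  congr 1
  rw [eq_comm, eq_act_inv_iff, act_transportSL_upper]

theorem devDisk_mem [Finite D] (t : M.Edge → ℝ) (e₀ : D') (v : U.cover.Vertex) : devDisk U t e₀ v ∈ deSitter :=
  act_mem_deSitter _ upper_mem

section Dev

variable [Finite D] {t : M.Edge → ℝ} (h : M.Closing t) (e₀ : D')

include h

theorem act_frameSL_tail (e : D') :
    act (psl (frameSL U e₀ e t)) (devDisk U t e₀ (U.cover.tail e)) = upperHalfPlane := by
  rw [devDisk_tail h, act_act_inv]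

theorem act_frameSL_head (e : D') :
    act (psl (frameSL U e₀ e t)) (devDisk U t e₀ (U.cover.head e)) = lowerHalfPlane := by
  have h1 := (isFrame_frameSL (U := U) h e₀).rev e
  have h2 := act_frameSL_tail (U := U) h e₀ (U.cover.rev e)
  rw [h1, act_mul, ← head_eq, ← act_flip_lower (t (M.edge (U.proj e)))] at h2
  exact act_injective _ h2

theorem act_frameSL_third (e : D') :
    act (psl (frameSL U e₀ e t)) (devDisk U t e₀ (U.cover.head (U.cover.next e))) =
      tangentDisk 0 := by
  have h1 := (isFrame_frameSL (U := U) h e₀).next e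
  have h2 := act_frameSL_head (U := U) h e₀ (U.cover.next e)
  rw [h1, act_mul, ← act_rotate_tangentDisk] at h2
  exact act_injective _ h2

theorem act_frameSL_rev_third (e : D') :
    act (psl (frameSL U e₀ e t)) (devDisk U t e₀ (U.cover.head (U.cover.next (U.cover.rev e)))) =
      tangentDisk (t (M.edge (U.proj e))) := by
  have h1 := (isFrame_frameSL (U := U) h e₀).rev e
  have h2 := act_frameSL_third (U := U) h e₀ (U.cover.rev e)
  rw [h1, act_mul] at h2
  apply act_injective (flip (t (M.edge (U.proj e))))
  rw [h2, act_flip_tangentDisk, sub_self]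

theorem devDisk_mink (e : D') :
    mink (devDisk U t e₀ (U.cover.tail e)) (devDisk U t e₀ (U.cover.head e)) = -1 := by
  rw [← mink_act (psl (frameSL U e₀ e t)), act_frameSL_tail h, act_frameSL_head h, mink_upper_lower]

theorem devDisk_not_neg (e : D') :
    ¬ (-(devDisk U t e₀ (U.cover.tail e) + devDisk U t e₀ (U.cover.head e))).PosSemidef := by
  intro h0
  have h1 := posSemidef_act (psl (frameSL U e₀ e t)) h0
  rw [map_neg, map_add, act_frameSL_tail h, act_frameSL_head h] at h1
  have h2 := h1.diag_nonneg (i := 1)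
  rw [Complex.le_def] at h2
  norm_num [upperHalfPlane, lowerHalfPlane] at h2

theorem devDisk_smul_tangency (A : PSL(2, ℂ)) (e : D') : A • U.tangency (devDisk U t e₀) e =
    tangencyPoint (act A (devDisk U t e₀ (U.cover.tail e)))
      (act A (devDisk U t e₀ (U.cover.head e))) :=
  (tangencyPoint_act A (fun h0 => devDisk_not_neg h e₀ e (by
      rw [h0, neg_zero]; exact Matrix.PosSemidef.zero))
    (det_add_eq_zero (devDisk_mem t e₀ _) (devDisk_mem t e₀ _) (devDisk_mink h e₀ e))).symm

/-- In the frame of `e` the tangency points are `-P i 1 1 / P i 1 0`. They increase because the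
denominators are positive and the products have determinant one. -/
theorem devDisk_turnsOnce (e : D') : U.TurnsOnce (devDisk U t e₀) e := by
  have hF := isFrame_frameSL (U := U) h e₀
  set P := M.transport t (U.proj e) with hP
  have hpos : ∀ i, 1 ≤ i → i < U.cover.valence e → 0 < P i 1 0 := by
    intro i hi hi'
    obtain ⟨j, rfl⟩ : ∃ j, i = j + 1 := ⟨i - 1, by omega⟩
    rw [hP, transport_succ_10]
    exact (h (U.proj e)).2 j (by rw [U.valence_proj]; exact hi')
  have htan : ∀ e, psl (frameSL U e₀ e t) • U.tangency (devDisk U t e₀) e = infinityPoint :=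
    fun e => by
      rw [devDisk_smul_tangency h, act_frameSL_tail h, act_frameSL_head h,
        tangencyPoint_upper_lower]
  refine ⟨psl (frameSL U e₀ e t), fun i => -(P i 1 1) / P i 1 0, act_frameSL_tail h e₀ e, htan e,
    fun i hi hi' => ?_, ?_⟩
  · have h1 := htan (U.cover.rot^[i] e)
    have h2 := hF.rot_iterate e i
    rw [h2, mul_smul] at h1
    refine MulAction.injective (psl (transportSL t (U.proj e) i)) ?_
    dsimp only
    rw [h1, eq_comm, infinityPoint_eq_smul_realPoint]
    have := (hpos i hi hi').ne'
    field_simp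
    ring
  · intro i j hi hij
    induction j, hij using Nat.le_induction with
    | base =>
      intro hj
      have h1 := hpos i hi (by omega)
      have h2 := hpos (i + 1) (by omega) hj
      have hdet : P i 0 0 * P i 1 1 - P i 0 1 * P i 1 0 = 1 := by
        rw [← Matrix.det_fin_two]; exact det_transport _ _ _
      have h3 : P (i + 1) 1 0 = P i 0 0 := transport_succ_10 _ _ _
      have h4 : P (i + 1) 1 1 = P i 0 1 := transport_succ_11 _ _ _
      rw [h3] at h2
      simp only [h3, h4]
      rw [div_lt_div_iff₀ h1 h2]
      linarith
    | succ j hij' ih =>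
      intro hj
      refine (ih (by omega)).trans ?_
      have h1 := hpos j (by omega) (by omega)
      have h2 := hpos (j + 1) (by omega) hj
      have hdet : P j 0 0 * P j 1 1 - P j 0 1 * P j 1 0 = 1 := by
        rw [← Matrix.det_fin_two]; exact det_transport _ _ _
      have h3 : P (j + 1) 1 0 = P j 0 0 := transport_succ_10 _ _ _
      have h4 : P (j + 1) 1 1 = P j 0 1 := transport_succ_11 _ _ _
      rw [h3] at h2
      simp only [h3, h4]
      rw [div_lt_div_iff₀ h1 h2]
      linarith

end Dev

/-- The circle packing developed from a solution of the closing equations. -/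
def develop [Finite D] {t : M.Edge → ℝ} (h : M.Closing t) (e₀ : D')
    (hne : NonElementary (holonomy (U := U) h e₀)) : U.DevelopedPacking where
  hol := holonomy h e₀
  disk := devDisk U t e₀
  nonElementary := hne
  disk_mem := devDisk_mem t e₀
  equivariant k e := by
    rw [devDisk_tail h, devDisk_tail h, frameSL_deck h, mul_inv_rev, inv_inv, act_mul]
  mink_eq := devDisk_mink h e₀
  not_neg := devDisk_not_neg h e₀
  turnsOnce := devDisk_turnsOnce h e₀

theorem frame_develop [Finite D] {t : M.Edge → ℝ} (h : M.Closing t) (e₀ : D')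
    (hne : NonElementary (holonomy (U := U) h e₀)) (e : D') :
    (develop h e₀ hne).frame e = psl (frameSL U e₀ e t) :=
  DevelopedPacking.frame_unique (act_frameSL_tail h e₀ e) (act_frameSL_head h e₀ e)
    (act_frameSL_third h e₀ e)

theorem crossRatioMap_develop [Finite D] {t : M.Edge → ℝ} (h : M.Closing t) (e₀ : D')
    (hne : NonElementary (holonomy (U := U) h e₀)) :
    U.crossRatioMap (develop h e₀ hne).toSpace = t := by
  funext ε
  obtain ⟨d, rfl⟩ := M.edge_surjective ε
  obtain ⟨e, rfl⟩ := U.proj_surjective d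
  rw [crossRatioMap_edge]
  apply tangentDisk_injective
  rw [← DevelopedPacking.act_frame_rev_third, frame_develop]
  exact act_frameSL_rev_third h e₀ e

theorem nonElementary_conj {G : Type*} [Group G] {ρ σ : G →* PSL(2, ℂ)} (h : NonElementary ρ)
    (A : PSL(2, ℂ)) (hσ : ∀ g, σ g = A * ρ g * A⁻¹) : NonElementary σ := by
  intro X hX h0 hfin
  refine h (act A⁻¹ X) (posSemidef_act _ hX) (fun h1 => h0 (act_injective A⁻¹
    (by rw [h1, map_zero]))) ?_
  refine (hfin.image fun s => (act A⁻¹) '' s).subset ?_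
  rintro _ ⟨g, rfl⟩
  refine ⟨_, ⟨g, rfl⟩, ?_⟩
  have hkey : act (ρ g) (act A⁻¹ X) = act A⁻¹ (act (σ g) X) := by
    rw [hσ, act_mul, act_mul, act_inv_act]
  ext Y
  simp only [Set.mem_image, Set.mem_ofPred_eq, hkey]
  constructor
  · rintro ⟨_, ⟨c, hc, rfl⟩, rfl⟩
    exact ⟨c, hc, by rw [LinearMap.map_smul_of_tower]⟩
  · rintro ⟨c, hc, rfl⟩
    exact ⟨_, ⟨c, hc, rfl⟩, by rw [LinearMap.map_smul_of_tower]⟩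

/-! ### Recovering a packing from its cross ratios -/

section

variable [Finite D] (p : U.DevelopedPacking) (e₀ : D')

theorem frame_eq_frameSL (e : D') :
    p.frame e = psl (frameSL U e₀ e (U.crossRatioMap p.toSpace)) * p.frame e₀ :=
  p.isFrame.eq_frameSL e₀ e

theorem holonomy_eq (k : U.Deck) :
    holonomy p.closing e₀ k = p.frame e₀ * p.hol k * (p.frame e₀)⁻¹ := by
  have h1 := frame_eq_frameSL p e₀ ((k : Equiv.Perm D') e₀)
  rw [p.frame_deck] at h1
  rw [holonomy_apply, inv_eq_iff_eq_inv, ← mul_left_inj (p.frame e₀),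
    ← h1]
  group

theorem nonElementary_holonomy : NonElementary (holonomy (U := U) p.closing e₀) :=
  nonElementary_conj p.nonElementary _ (holonomy_eq p e₀)

/-- The developed packing is `p` moved by its own frame at `e₀`. -/
theorem develop_crossRatioMap :
    (develop p.closing e₀ (nonElementary_holonomy p e₀)).toSpace = p.toSpace := by
  refine (Quotient.sound ⟨p.frame e₀, holonomy_eq p e₀, fun v => ?_⟩ : p.toSpace = _).symm
  obtain ⟨e, rfl⟩ := U.cover.tail_surjective v
  refine (devDisk_tail p.closing e₀ e).trans ?_
  rw [eq_comm, eq_act_inv_iff, ← act_mul, ← frame_eq_frameSL, p.act_frame_tail]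

end

theorem develop_congr [Finite D] {t t' : M.Edge → ℝ} (ht : t = t') {h : M.Closing t}
    {h' : M.Closing t'} {e₀ : D'} {hne : NonElementary (holonomy (U := U) h e₀)}
    {hne' : NonElementary (holonomy (U := U) h' e₀)} : develop h e₀ hne = develop h' e₀ hne' := by
  subst ht
  rfl

theorem crossRatioMap_injective [Finite D] [Nonempty D'] :
    Function.Injective U.crossRatioMap := by
  intro x y h
  obtain ⟨p, rfl⟩ : ∃ p : U.DevelopedPacking, p.toSpace = x := Quotient.exists_rep x
  obtain ⟨q, rfl⟩ : ∃ p : U.DevelopedPacking, p.toSpace = y := Quotient.exists_rep y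
  obtain ⟨e₀⟩ := ‹Nonempty D'›
  rw [← develop_crossRatioMap p e₀, ← develop_crossRatioMap q e₀, develop_congr h]

/-- The coordinates of the developed packing, as functions of the cross ratios. -/
def devCoord (U : UniversalCovering M D') [Finite D] (e₀ : D') (t : M.Edge → ℝ) : U.CoordIndex → ℂ :=
  Sum.elim (fun x => devDisk U t e₀ x.1 x.2.1 x.2.2) fun x =>
    act (psl (frameSL U e₀ ((x.1 : Equiv.Perm D') e₀) t))⁻¹
      (Matrix.single x.2.1.1 x.2.1.2 1) x.2.2.1 x.2.2.2

theorem coord_develop [Finite D] {t : M.Edge → ℝ} (h : M.Closing t) (e₀ : D')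
    (hne : NonElementary (holonomy (U := U) h e₀)) :
    (develop h e₀ hne).coord = devCoord U e₀ t := by
  funext i
  rcases i with ⟨v, i, j⟩ | ⟨k, ⟨a, b⟩, i, j⟩ <;> rfl

theorem act_psl_inv (B : SL(2, ℂ)) (X : Mat) : act (psl B)⁻¹ X = (B : Mat)ᵀ * X * conjMat (B : Mat) := by
  rw [← map_inv, act_psl, inv_inv]

theorem SmoothSL.act_inv [Finite D] {W : (M.Edge → ℝ) → SL(2, ℂ)} (hW : SmoothSL W) (X : Mat)
    (i j : Fin 2) : ContDiff ℝ ∞ fun t => act (psl (W t))⁻¹ X i j := by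
  simp only [act_psl_inv, Matrix.mul_apply, conjMat, Matrix.map_apply, Matrix.transpose_apply]
  refine ContDiff.sum fun k _ => ContDiff.mul (ContDiff.sum fun l _ => ?_) ?_
  · exact (hW l i).mul contDiff_const
  · exact Complex.conjCLE.contDiff.comp (hW k j)

theorem contDiff_devCoord [Finite D] (e₀ : D') (i : U.CoordIndex) :
    ContDiff ℝ ∞ fun t => devCoord U e₀ t i := by
  rcases i with ⟨v, i, j⟩ | ⟨k, ⟨a, b⟩, i, j⟩
  · exact (smooth_frameSL _ _).act_inv _ i j
  · exact (smooth_frameSL _ _).act_inv _ i j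

end CirclePacking

namespace CirclePacking

/-! ## Elementary representations -/

/-- Positive semidefinite Hermitian matrices of trace one. -/
def densityMatrices : Set Mat := {X | X.PosSemidef ∧ X.trace = 1}

theorem isClosed_posSemidef : IsClosed {X : Mat | X.PosSemidef} := by
  have : {X : Mat | X.PosSemidef} =
      {X : Mat | Xᴴ = X} ∩ ⋂ x : Fin 2 → ℂ, {X : Mat | 0 ≤ star x ⬝ᵥ (X *ᵥ x)} := by
    ext X
    simp only [Set.mem_inter_iff, Set.mem_iInter, Set.mem_ofPred_eq]
    exact Matrix.posSemidef_iff_dotProduct_mulVec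
  rw [this]
  refine (isClosed_eq (by fun_prop) continuous_id).inter (isClosed_iInter fun x => ?_)
  exact isClosed_le continuous_const (by fun_prop)

theorem isCompact_densityMatrices : IsCompact densityMatrices := by
  have h1 : IsCompact (Set.pi Set.univ fun _ : Fin 2 => Set.pi Set.univ fun _ : Fin 2 =>
      Metric.closedBall (0 : ℂ) 1) :=
    isCompact_univ_pi fun _ => isCompact_univ_pi fun _ => isCompact_closedBall _ _
  refine IsCompact.of_isClosed_subset h1 (isClosed_posSemidef.inter
    (isClosed_eq (by fun_prop) continuous_const)) ?_
  rintro X ⟨hX, ht⟩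
  obtain ⟨a, d, b, rfl⟩ := exists_of_isHermitian hX.1
  have ha : 0 ≤ a := by simpa using hX.diag_nonneg (i := 0)
  have hd : 0 ≤ d := by simpa using hX.diag_nonneg (i := 1)
  have had : a + d = 1 := by
    rw [Matrix.trace_fin_two_of] at ht
    exact_mod_cast ht
  have hdet := hX.det_nonneg
  rw [Matrix.det_fin_two_of, ← starRingEnd_apply, Complex.mul_conj] at hdet
  have hb : Complex.normSq b ≤ 1 := by
    have h2 : Complex.normSq b ≤ a * d := by
      have : ((0 : ℝ) : ℂ) ≤ ((a * d - Complex.normSq b : ℝ) : ℂ) := by push_cast; exact hdet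
      have := Complex.real_le_real.1 this
      linarith
    nlinarith
  have hb' : ‖b‖ ≤ 1 := by
    rw [Complex.normSq_eq_norm_sq] at hb
    exact (sq_le_one_iff₀ (norm_nonneg b)).1 hb
  intro i _ j _
  rw [mem_closedBall_zero_iff]
  fin_cases i <;> fin_cases j
  · simp [abs_of_nonneg ha]; linarith
  · simpa using hb'
  · simpa using hb'
  · simp [abs_of_nonneg hd]; linarith

theorem trace_re_pos {X : Mat} (h : X.PosSemidef) (h0 : X ≠ 0) : 0 < X.trace.re := by
  have h1 := h.trace_nonneg
  rcases h1.lt_or_eq with h2 | h2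
  · exact (Complex.lt_def.1 h2).1
  · exact (h0 (h.trace_eq_zero_iff.1 h2.symm)).elim

theorem ofReal_trace_re {X : Mat} (h : X.PosSemidef) : ((X.trace.re : ℝ) : ℂ) = X.trace :=
  Complex.ext rfl (by simpa using (Complex.le_def.1 h.trace_nonneg).2)

theorem act_real_smul (A : PSL(2, ℂ)) (c : ℝ) (X : Mat) : act A (c • X) = c • act A X :=
  LinearMap.map_smul_of_tower _ c X

theorem act_ne_zero (A : PSL(2, ℂ)) {X : Mat} (h : X ≠ 0) : act A X ≠ 0 := fun h1 =>
  h (act_injective A (by rw [h1, map_zero]))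

theorem posSemidef_real_smul {X : Mat} (h : X.PosSemidef) {c : ℝ} (hc : 0 ≤ c) :
    (c • X).PosSemidef := by
  have := h.smul (a := (c : ℂ)) (by exact_mod_cast hc)
  rwa [Complex.coe_smul] at this

/-- The normalization of a positive semidefinite matrix. -/
def traceNormalize (X : Mat) : Mat := (X.trace.re)⁻¹ • X

theorem traceNormalize_mem {X : Mat} (h : X.PosSemidef) (h0 : X ≠ 0) :
    traceNormalize X ∈ densityMatrices := by
  have h1 := trace_re_pos h h0
  refine ⟨posSemidef_real_smul h (inv_nonneg.2 h1.le), ?_⟩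
  have h2 := ofReal_trace_re h
  rw [traceNormalize, Matrix.trace_smul, Complex.real_smul]
  generalize X.trace.re = r at h1 h2
  rw [← h2, ← Complex.ofReal_mul, inv_mul_cancel₀ h1.ne', Complex.ofReal_one]

theorem smul_traceNormalize {X : Mat} (h : X.PosSemidef) (h0 : X ≠ 0) :
    X.trace.re • traceNormalize X = X := by
  rw [traceNormalize, smul_smul, mul_inv_cancel₀ (trace_re_pos h h0).ne', one_smul]

theorem traceNormalize_smul {X : Mat} {c : ℝ} (hc : 0 < c) : traceNormalize (c • X) = traceNormalize X := by
  rw [traceNormalize, Matrix.trace_smul, Complex.smul_re, smul_smul, traceNormalize, smul_eq_mul, mul_inv,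
    mul_right_comm, inv_mul_cancel₀ hc.ne', one_mul]

theorem ne_zero_of_mem {X : Mat} (h : X ∈ densityMatrices) : X ≠ 0 := by
  rintro rfl
  simpa using h.2

theorem mink_real_smul (a b : ℝ) (X Y : Mat) : mink (a • X) (b • Y) = a * b * mink X Y := by
  have h : (a • X + b • Y).det - (a • X).det - (b • Y).det =
      ((a * b : ℝ) : ℂ) * ((X + Y).det - X.det - Y.det) := by
    simp [Matrix.det_fin_two]
    ring
  rw [mink, mink, h, Complex.re_ofReal_mul]
  ring

/-- Two distinct points at infinity are not orthogonal. -/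
theorem mink_ne_zero {X Y : Mat} (hX : X ∈ densityMatrices) (hY : Y ∈ densityMatrices)
    (hX0 : X.det = 0) (hY0 : Y.det = 0) (hXY : X ≠ Y) : mink X Y ≠ 0 := by
  intro h
  obtain ⟨a, d, b, rfl⟩ := exists_of_isHermitian hX.1.1
  obtain ⟨a', d', b', rfl⟩ := exists_of_isHermitian hY.1.1
  rw [mink_eq_of_mk] at h
  have h1 := hX.2
  have h2 := hY.2
  rw [Matrix.trace_fin_two_of] at h1 h2
  rw [Matrix.det_fin_two_of, ← starRingEnd_apply, Complex.mul_conj, Complex.normSq_apply] at hX0 hY0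
  norm_cast at h1 h2 hX0 hY0
  obtain rfl : d = 1 - a := by linarith
  obtain rfl : d' = 1 - a' := by linarith
  -- For singular matrices of trace one, `-2 * mink X Y` is the squared distance of the points with
  -- coordinates `(a, b)`.
  have h3 : (a - a') * (a - a') + ((b.re - b'.re) * (b.re - b'.re) +
      (b.im - b'.im) * (b.im - b'.im)) = 0 := by
    linear_combination -hX0 - hY0 - 2 * h
  have h4 := mul_self_nonneg (a - a')
  have h5 := mul_self_nonneg (b.re - b'.re)
  have h6 := mul_self_nonneg (b.im - b'.im)
  have e1 : a = a' := sub_eq_zero.1 (mul_self_eq_zero.1 (by linarith))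
  have e2 : b = b' := Complex.ext (sub_eq_zero.1 (mul_self_eq_zero.1 (by linarith)))
    (sub_eq_zero.1 (mul_self_eq_zero.1 (by linarith)))
  exact hXY (by rw [e1, e2])

section

variable {G : Type*} [Group G] (ρ : G →* PSL(2, ℂ))

/-- The group permutes the finite orbit, so its sum is invariant, and the sum is non-zero because
traces are positive. -/
theorem exists_fixed_of_finite {X : Mat} (hX : X.PosSemidef) (h0 : X ≠ 0)
    (hfin : (Set.range fun g => act (ρ g) X).Finite) :
    ∃ Y ∈ densityMatrices, ∀ g, act (ρ g) Y = Y := by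
  set s := hfin.toFinset with hs
  have hmem : ∀ Y ∈ s, Y.PosSemidef := by
    intro Y hY
    rw [hs, Set.Finite.mem_toFinset] at hY
    obtain ⟨g, rfl⟩ := hY
    exact posSemidef_act _ hX
  have hXs : X ∈ s := by
    rw [hs, Set.Finite.mem_toFinset]
    exact ⟨1, by simp⟩
  have hS : (∑ Y ∈ s, Y).PosSemidef := Matrix.posSemidef_sum s hmem
  have hS0 : ∑ Y ∈ s, Y ≠ 0 := by
    intro h1
    have h2 : ∑ Y ∈ s, Y.trace.re = 0 := by
      rw [← Complex.re_sum, ← Matrix.trace_sum, h1]; simp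
    rw [Finset.sum_eq_zero_iff_of_nonneg fun Y hY =>
      (Complex.le_def.1 (hmem Y hY).trace_nonneg).1] at h2
    exact (trace_re_pos hX h0).ne' (h2 X hXs)
  refine ⟨_, traceNormalize_mem hS hS0, fun g => ?_⟩
  rw [traceNormalize, act_real_smul, map_sum]
  congr 1
  refine Finset.sum_bij (fun Y _ => act (ρ g) Y) ?_ ?_ ?_ ?_
  · intro Y hY
    rw [hs, Set.Finite.mem_toFinset] at hY ⊢
    obtain ⟨k, rfl⟩ := hY
    exact ⟨g * k, by simp only [map_mul, Module.End.mul_apply]⟩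
  · intro Y _ Z _ h
    exact act_injective _ h
  · intro Y hY
    rw [hs, Set.Finite.mem_toFinset] at hY
    obtain ⟨k, rfl⟩ := hY
    refine ⟨act (ρ (g⁻¹ * k)) X, ?_, ?_⟩
    · rw [hs, Set.Finite.mem_toFinset]
      exact ⟨_, rfl⟩
    · rw [← act_mul, ← map_mul, mul_inv_cancel_left]
  · intro Y _
    rfl

/-- The point is that two elements of a compact set suffice. A finite orbit of boundary points of
size at most two is of this form. In all other cases the scale of the vectors on the finitely many
rays takes finitely many values, so a vector orbit is finite and its barycentre is fixed. -/
theorem not_nonElementary_iff : ¬ NonElementary ρ ↔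
    ∃ Y ∈ densityMatrices, ∃ Z ∈ densityMatrices, ∀ g,
      act (ρ g) Y = (act (ρ g) Y).trace.re • Y ∨ act (ρ g) Y = (act (ρ g) Y).trace.re • Z := by
  constructor
  · intro h
    rw [NonElementary] at h
    push Not at h
    obtain ⟨X, hX, h0, hfin⟩ := h
    have hXg : ∀ g, (act (ρ g) X).PosSemidef := fun g => posSemidef_act _ hX
    have hXg0 : ∀ g, act (ρ g) X ≠ 0 := fun g => act_ne_zero _ h0
    set O : Set Mat := Set.range fun g => traceNormalize (act (ρ g) X) with hO
    have hOK : O ⊆ densityMatrices := by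
      rintro _ ⟨g, rfl⟩
      exact traceNormalize_mem (hXg g) (hXg0 g)
    have hOfin : O.Finite := by
      refine (hfin.image fun s => traceNormalize (Classical.epsilon (· ∈ s))).subset ?_
      rintro _ ⟨g, rfl⟩
      refine ⟨_, ⟨g, rfl⟩, ?_⟩
      have hex : ∃ Y, Y ∈ {Y : Mat | ∃ c : ℝ, 0 < c ∧ Y = c • act (ρ g) X} :=
        ⟨_, 1, one_pos, (one_smul ℝ _).symm⟩
      obtain ⟨c, hc, hY⟩ := Classical.epsilon_spec hex
      dsimp only
      rw [hY, traceNormalize_smul hc]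
    have hact : ∀ W ∈ O, ∀ g, ∃ μ : ℝ, 0 < μ ∧ ∃ W' ∈ O, act (ρ g) W = μ • W' := by
      rintro _ ⟨k, rfl⟩ g
      refine ⟨(act (ρ k) X).trace.re⁻¹ * (act (ρ (g * k)) X).trace.re,
        mul_pos (inv_pos.2 (trace_re_pos (hXg k) (hXg0 k))) (trace_re_pos (hXg _) (hXg0 _)), _,
        ⟨g * k, rfl⟩, ?_⟩
      dsimp only
      rw [mul_smul, smul_traceNormalize (hXg _) (hXg0 _), traceNormalize, act_real_smul, map_mul,
        act_mul]
    have hfix : (∃ W, W.PosSemidef ∧ W ≠ 0 ∧ (Set.range fun g => act (ρ g) W).Finite) →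
        ∃ Y ∈ densityMatrices, ∃ Z ∈ densityMatrices, ∀ g,
          act (ρ g) Y = (act (ρ g) Y).trace.re • Y ∨
            act (ρ g) Y = (act (ρ g) Y).trace.re • Z := by
      rintro ⟨W, h1, h2, h3⟩
      obtain ⟨Y, hY, h4⟩ := exists_fixed_of_finite ρ h1 h2 h3
      refine ⟨Y, hY, Y, hY, fun g => Or.inl ?_⟩
      rw [h4, hY.2, Complex.one_re, one_smul]
    have hW : traceNormalize (act (ρ 1) X) ∈ O := ⟨1, rfl⟩
    generalize traceNormalize (act (ρ 1) X) = W at hW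
    by_cases hdet : X.det = 0
    · have hdetO : ∀ W ∈ O, W.det = 0 := by
        rintro _ ⟨g, rfl⟩
        dsimp only
        rw [traceNormalize, ← Complex.coe_smul, Matrix.det_smul, det_act, hdet, mul_zero]
      by_cases h2 : ∃ V ∈ O, ∀ V' ∈ O, V' = W ∨ V' = V
      · obtain ⟨V, hV, h2⟩ := h2
        refine ⟨W, hOK hW, V, hOK hV, fun g => ?_⟩
        obtain ⟨μ, hμ, W', hW', h3⟩ := hact W hW g
        have h4 : (act (ρ g) W).trace.re = μ := by
          rw [h3, Matrix.trace_smul, (hOK hW').2]; simp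
        rw [h4, h3]
        rcases h2 W' hW' with rfl | rfl
        · exact Or.inl rfl
        · exact Or.inr rfl
      · push Not at h2
        obtain ⟨V, hV, hVW, -⟩ := h2 W hW
        obtain ⟨V', hV', hVW', hVV'⟩ := h2 V hV
        have hne : ∀ {P Q : Mat}, P ∈ O → Q ∈ O → P ≠ Q → mink P Q ≠ 0 := fun hP hQ hPQ =>
          mink_ne_zero (hOK hP) (hOK hQ) (hdetO _ hP) (hdetO _ hQ) hPQ
        refine hfix ⟨W, (hOK hW).1, ne_zero_of_mem (hOK hW), ?_⟩
        -- The products `ab`, `ac`, `bc` of the scaling factors are quotients of Minkowski products,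
        -- so `a² = (ab)(ac) / (bc)` depends only on the triple `(A, B, C)` of points of the finite
        -- orbit.
        refine ((hOfin.prod (hOfin.prod hOfin)).image fun x : Mat × Mat × Mat =>
          Real.sqrt (mink W V * mink W V' * mink x.2.1 x.2.2 /
            (mink V V' * mink x.1 x.2.1 * mink x.1 x.2.2)) • x.1).subset ?_
        rintro _ ⟨g, rfl⟩
        obtain ⟨a, ha, A, hA, ha'⟩ := hact W hW g
        obtain ⟨b, hb, B, hB, hb'⟩ := hact V hV g
        obtain ⟨c, hc, C, hC, hc'⟩ := hact V' hV' g
        refine ⟨(A, B, C), ⟨hA, hB, hC⟩, ?_⟩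
        have e1 : mink W V = a * b * mink A B := by
          rw [← mink_act (ρ g), ha', hb', mink_real_smul]
        have e2 : mink W V' = a * c * mink A C := by
          rw [← mink_act (ρ g), ha', hc', mink_real_smul]
        have e3 : mink V V' = b * c * mink B C := by
          rw [← mink_act (ρ g), hb', hc', mink_real_smul]
        have n1 := hne hW hV hVW.symm
        have n2 := hne hW hV' hVW'.symm
        have n3 := hne hV hV' hVV'.symm
        dsimp only
        rw [ha']
        congr 1
        rw [e1] at n1
        rw [e2] at n2
        rw [e3] at n3
        have m1 := right_ne_zero_of_mul n1
        have m2 := right_ne_zero_of_mul n2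
        have m3 := right_ne_zero_of_mul n3
        rw [e1, e2, e3, show a * b * mink A B * (a * c * mink A C) * mink B C /
          (b * c * mink B C * mink A B * mink A C) = a ^ 2 by field_simp, Real.sqrt_sq ha.le]
    -- For `det X ≠ 0` the invariance of the determinant fixes the scale on each ray.
    · refine hfix ⟨X, hX, h0, ?_⟩
      refine (hOfin.image fun W => Real.sqrt (X.det.re / W.det.re) • W).subset ?_
      rintro _ ⟨g, rfl⟩
      refine ⟨_, ⟨g, rfl⟩, ?_⟩
      have h1 := trace_re_pos (hXg g) (hXg0 g)
      have h2 : X.det.re ≠ 0 := fun h2 => hdet (Complex.ext h2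
        (Complex.le_def.1 hX.det_nonneg).2.symm)
      have h3 : (traceNormalize (act (ρ g) X)).det.re = ((act (ρ g) X).trace.re)⁻¹ ^ 2 * X.det.re := by
        rw [traceNormalize, ← Complex.coe_smul, Matrix.det_smul, det_act, Fintype.card_fin,
          ← Complex.ofReal_pow, Complex.re_ofReal_mul]
      dsimp only
      rw [h3, show X.det.re / ((act (ρ g) X).trace.re⁻¹ ^ 2 * X.det.re) =
        (act (ρ g) X).trace.re ^ 2 by field_simp, Real.sqrt_sq h1.le,
        smul_traceNormalize (hXg g) (hXg0 g)]
  · rintro ⟨Y, hY, Z, hZ, h⟩ hne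
    refine hne Y hY.1 (ne_zero_of_mem hY) ?_
    refine (Set.toFinite {{W : Mat | ∃ c : ℝ, 0 < c ∧ W = c • Y},
      {W : Mat | ∃ c : ℝ, 0 < c ∧ W = c • Z}}).subset ?_
    rintro _ ⟨g, rfl⟩
    have hpos := trace_re_pos (posSemidef_act (ρ g) hY.1) (act_ne_zero _ (ne_zero_of_mem hY))
    have key : ∀ V : Mat, act (ρ g) Y = (act (ρ g) Y).trace.re • V →
        {W : Mat | ∃ c : ℝ, 0 < c ∧ W = c • act (ρ g) Y} =
          {W : Mat | ∃ c : ℝ, 0 < c ∧ W = c • V} := by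
      intro V hV
      generalize (act (ρ g) Y).trace.re = r at hV hpos
      rw [hV]
      ext W
      simp only [Set.mem_ofPred_eq]
      constructor
      · rintro ⟨c, hc, rfl⟩
        exact ⟨c * r, mul_pos hc hpos, by rw [mul_smul]⟩
      · rintro ⟨c, hc, rfl⟩
        exact ⟨c * r⁻¹, mul_pos hc (inv_pos.2 hpos), by
          rw [smul_smul, mul_assoc, inv_mul_cancel₀ hpos.ne', mul_one]⟩
    rcases h g with h1 | h1
    · exact Or.inl (key _ h1)
    · exact Or.inr (key _ h1)

end

variable {D D' : Type*} {M : Triangulation D} {U : UniversalCovering M D'}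

open UniversalCovering Triangulation

variable (U) in
/-- Non-elementarity of the holonomy is an open condition. -/
theorem exists_isClosed_nonElementary_iff [Finite D] (e₀ : D') : ∃ C : Set (M.Edge → ℝ),
    IsClosed C ∧ ∀ t (h : M.Closing t), NonElementary (holonomy (U := U) h e₀) ↔ t ∉ C := by
  have hcpt : CompactSpace densityMatrices := isCompact_iff_compactSpace.1 isCompact_densityMatrices
  set a : U.Deck → (M.Edge → ℝ) → Mat → Mat := fun k t Y =>
    (frameSL U e₀ ((k : Equiv.Perm D') e₀) t : Mat)ᵀ * Y *
      conjMat (frameSL U e₀ ((k : Equiv.Perm D') e₀) t : Mat) with ha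
  have hcont : ∀ k, Continuous fun x : (M.Edge → ℝ) × densityMatrices × densityMatrices =>
      a k x.1 x.2.1 := by
    intro k
    have hW : Continuous fun t : M.Edge → ℝ => (frameSL U e₀ ((k : Equiv.Perm D') e₀) t : Mat) :=
      continuous_matrix fun i j => (smooth_frameSL e₀ _ i j).continuous
    have hW' := hW.comp (continuous_fst (X := M.Edge → ℝ)
      (Y := densityMatrices × densityMatrices))
    have hc : Continuous conjMat := continuous_matrix fun i j =>
      (continuous_star.comp (continuous_id.matrix_elem i j))
    exact (hW'.matrix_transpose.mul (by fun_prop)).mul (hc.comp hW')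
  refine ⟨Prod.fst '' {x : (M.Edge → ℝ) × densityMatrices × densityMatrices | ∀ k,
    a k x.1 x.2.1 = (a k x.1 x.2.1).trace.re • (x.2.1 : Mat) ∨
    a k x.1 x.2.1 = (a k x.1 x.2.1).trace.re • (x.2.2 : Mat)}, ?_, ?_⟩
  -- The elementary parameters are the projection, along a compact space, of a set given by closed
  -- conditions.
  · apply isClosedMap_fst_of_compactSpace
    rw [Set.ofPred_forall]
    refine isClosed_iInter fun k => ?_
    have htr := Complex.continuous_re.comp (hcont k).matrix_trace
    rw [Set.ofPred_or]
    refine (isClosed_eq (hcont k) (htr.smul (by fun_prop))).union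
      (isClosed_eq (hcont k) (htr.smul (by fun_prop)))
  · intro t h
    rw [← not_iff_not, not_not, not_nonElementary_iff]
    have hact : ∀ k Y, act (holonomy (U := U) h e₀ k) Y = a k t Y := fun k Y => by
      rw [holonomy_apply, act_psl_inv]
    simp only [hact]
    constructor
    · rintro ⟨Y, hY, Z, hZ, h1⟩
      exact ⟨(t, ⟨Y, hY⟩, ⟨Z, hZ⟩), h1, rfl⟩
    · rintro ⟨⟨t', Y, Z⟩, h1, rfl⟩
      exact ⟨Y, Y.2, Z, Z.2, h1⟩

end CirclePacking

namespace CirclePacking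

/-! ## Manifold structures given by slices -/

section Slices

open Set Function

/-- The germ of a smooth function extends to a global smooth function. -/
theorem exists_contDiff_eventuallyEq {E : Type*} [NormedAddCommGroup E] [NormedSpace ℝ E]
    [FiniteDimensional ℝ E] {O : Set E} (hO : IsOpen O) {x : E} (hx : x ∈ O) {G : E → ℝ}
    (hG : ContDiffOn ℝ ∞ G O) : ∃ G' : E → ℝ, ContDiff ℝ ∞ G' ∧ G' =ᶠ[𝓝 x] G := by
  obtain ⟨r, hr, hball⟩ := Metric.isOpen_iff.1 hO x hx
  let b : ContDiffBump x := ⟨r / 4, r / 2, by positivity, by linarith⟩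
  refine ⟨fun y => b y * G y, contDiff_iff_contDiffAt.2 fun y => ?_, ?_⟩
  · by_cases hy : y ∈ O
    · exact b.contDiff.contDiffAt.mul (hG.contDiffAt (hO.mem_nhds hy))
    · have hy' : y ∉ tsupport b := fun h => hy (hball (by
        rw [b.tsupport_eq] at h
        exact lt_of_le_of_lt h (half_lt_self hr)))
      have h0 : (fun y => b y * G y) =ᶠ[𝓝 y] fun _ => 0 := by
        filter_upwards [(isClosed_tsupport b).isOpen_compl.mem_nhds hy'] with z hz
        rw [image_eq_zero_of_notMem_tsupport hz, zero_mul]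
      exact contDiffAt_const.congr_of_eventuallyEq h0
  · filter_upwards [b.eventuallyEq_one] with y hy
    rw [hy, Pi.one_apply, one_mul]

variable {X ι E F V : Type*} [NormedAddCommGroup E] [NormedSpace ℝ E]
  [NormedAddCommGroup F] [NormedSpace ℝ F] [NormedAddCommGroup V] [NormedSpace ℝ V]

/-- A local diffeomorphism that straightens the range of `f`. -/
structure IsSlice (f : X → E) (H : OpenPartialHomeomorph E (F × V)) : Prop where
  contDiffOn : ContDiffOn ℝ ∞ H H.source
  contDiffOn_symm : ContDiffOn ℝ ∞ H.symm H.target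
  mem_range_iff : ∀ t ∈ H.source, t ∈ range f ↔ (H t).2 = 0

/-- Near `x`, the function `u` is the restriction of a smooth function on the ambient space. -/
def SmoothExt (f : X → E) (u : X → ℝ) (x : X) : Prop :=
  ∃ O : Set E, IsOpen O ∧ f x ∈ O ∧ ∃ G : E → ℝ, ContDiffOn ℝ ∞ G O ∧
    ∀ x', f x' ∈ O → u x' = G (f x')

variable {f : X → E} {H : OpenPartialHomeomorph E (F × V)}

namespace IsSlice

theorem apply_mem (h : IsSlice f H) {x : X} (hx : f x ∈ H.source) : ((H (f x)).1, (0 : V)) = H (f x) :=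
  Prod.ext rfl ((h.mem_range_iff _ hx).1 ⟨x, rfl⟩).symm

theorem symm_mem_range (h : IsSlice f H) {y : F} (hy : (y, (0 : V)) ∈ H.target) :
    H.symm (y, 0) ∈ range f :=
  (h.mem_range_iff _ (H.map_target hy)).2 (by rw [H.right_inv hy])

theorem apply_invFun [Nonempty X] (h : IsSlice f H) {y : F} (hy : (y, (0 : V)) ∈ H.target) :
    f (invFun f (H.symm (y, 0))) = H.symm (y, 0) := invFun_eq (h.symm_mem_range hy)

end IsSlice

variable [TopologicalSpace X]

/-- The chart of the source of an embedding given by a slice. -/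
def sliceChart [Nonempty X] (hf : Topology.IsEmbedding f) (h : IsSlice f H) : OpenPartialHomeomorph X F where
  toFun x := (H (f x)).1
  invFun y := invFun f (H.symm (y, 0))
  source := f ⁻¹' H.source
  target := {y | (y, (0 : V)) ∈ H.target}
  map_source' x hx := by
    change ((H (f x)).1, (0 : V)) ∈ H.target
    rw [h.apply_mem hx]
    exact H.map_source hx
  map_target' y hy := by
    change f (invFun f (H.symm (y, 0))) ∈ H.source
    rw [h.apply_invFun hy]
    exact H.map_target hy
  left_inv' x hx := by
    rw [h.apply_mem hx, H.left_inv hx]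
    exact leftInverse_invFun hf.injective x
  right_inv' y hy := by
    rw [h.apply_invFun hy, H.right_inv hy]
  open_source := H.open_source.preimage hf.continuous
  open_target := H.open_target.preimage (by fun_prop)
  continuousOn_toFun := continuous_fst.comp_continuousOn
    (H.continuousOn.comp hf.continuous.continuousOn fun _ hx => hx)
  continuousOn_invFun := by
    rw [hf.continuousOn_iff]
    refine ContinuousOn.congr (f := fun y : F => H.symm (y, (0 : V)))
      (H.symm.continuousOn.comp (by fun_prop) fun _ hy => hy) fun y hy => ?_
    exact h.apply_invFun hy

section

variable [Nonempty X] (hf : Topology.IsEmbedding f) (h : IsSlice f H)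

theorem apply_sliceChart_symm {y : F} (hy : y ∈ (sliceChart hf h).target) :
    f ((sliceChart hf h).symm y) = H.symm (y, 0) := h.apply_invFun hy

theorem contDiffOn_sliceChart_symm :
    ContDiffOn ℝ ∞ (fun y => f ((sliceChart hf h).symm y)) (sliceChart hf h).target := by
  refine ContDiffOn.congr (f := fun y : F => H.symm (y, (0 : V)))
    (h.contDiffOn_symm.comp (by fun_prop) fun y hy => hy)
    fun y hy => apply_sliceChart_symm hf h hy

end

variable (V) in
/-- The charted space structure on the source of an embedding that is given by slices. -/
@[reducible] def sliceChartedSpace (hf : Topology.IsEmbedding f)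
    (h : ∀ x, ∃ H : OpenPartialHomeomorph E (F × V), IsSlice f H ∧ f x ∈ H.source) :
    ChartedSpace F X where
  atlas := {φ | ∃ (_ : Nonempty X) (H : OpenPartialHomeomorph E (F × V)) (hH : IsSlice f H),
    φ = sliceChart hf hH}
  chartAt x := haveI : Nonempty X := ⟨x⟩; sliceChart hf (Classical.choose_spec (h x)).1
  mem_chart_source x := (Classical.choose_spec (h x)).2
  chart_mem_atlas x := ⟨⟨x⟩, _, (Classical.choose_spec (h x)).1, rfl⟩

/-- A transition map is the first component of `H'` applied to the inverse of `H` on the slice, and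
both are smooth on the ambient space. -/
theorem isManifold_sliceChartedSpace (hf : Topology.IsEmbedding f)
    (h : ∀ x, ∃ H : OpenPartialHomeomorph E (F × V), IsSlice f H ∧ f x ∈ H.source) :
    @IsManifold ℝ _ F _ _ F _ 𝓘(ℝ, F) ∞ X _ (sliceChartedSpace V hf h) := by
  let := sliceChartedSpace V hf h
  refine isManifold_of_contDiffOn _ _ _ ?_
  rintro _ _ ⟨hX, H, hH, rfl⟩ ⟨-, H', hH', rfl⟩
  simp only [modelWithCornersSelf_coe, modelWithCornersSelf_coe_symm, range_id, inter_univ,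
    preimage_id, CompTriple.comp_eq]
  refine (contDiff_fst.comp_contDiffOn (hH'.contDiffOn.comp
    ((contDiffOn_sliceChart_symm hf hH).mono ?_) ?_))
  · intro y hy
    exact hy.1
  · intro y hy
    exact hy.2

theorem SmoothExt.contMDiffAt {X' : Type*} [TopologicalSpace X'] [ChartedSpace F X'] {f : X' → E}
    (hf : ContMDiff 𝓘(ℝ, F) 𝓘(ℝ, E) ∞ f) {u : X' → ℝ} {x : X'} (hu : SmoothExt f u x) :
    ContMDiffAt 𝓘(ℝ, F) 𝓘(ℝ, ℝ) ∞ u x := by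
  obtain ⟨O, hO, hx, G, hG, hGu⟩ := hu
  have h1 : ContMDiffAt 𝓘(ℝ, F) 𝓘(ℝ, ℝ) ∞ (G ∘ f) x :=
    ContMDiffAt.comp x (hG.contDiffAt (hO.mem_nhds hx)).contMDiffAt (hf x)
  refine h1.congr_of_eventuallyEq ?_
  filter_upwards [(hO.preimage hf.continuous).mem_nhds hx] with x' hx'
  exact hGu x' hx'

/-- A function that is smooth in the chart extends to the ambient space through the first component
of `H`. Conversely `f` is smooth, hence so are restrictions of ambient smooth functions. -/
theorem contMDiffOn_sliceChartedSpace_iff (hf : Topology.IsEmbedding f)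
    (h : ∀ x, ∃ H : OpenPartialHomeomorph E (F × V), IsSlice f H ∧ f x ∈ H.source)
    (W : Set X) (u : X → ℝ) (hW : IsOpen W) :
    letI := sliceChartedSpace V hf h
    ContMDiffOn 𝓘(ℝ, F) 𝓘(ℝ, ℝ) ∞ u W ↔ ∀ x ∈ W, SmoothExt f u x := by
  let := sliceChartedSpace V hf h
  have := isManifold_sliceChartedSpace hf h
  constructor
  · intro hu x hx
    have : Nonempty X := ⟨x⟩
    set H := Classical.choose (h x)
    have hH : IsSlice f H := (Classical.choose_spec (h x)).1
    have hxH : f x ∈ H.source := (Classical.choose_spec (h x)).2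
    set φ := sliceChart hf hH with hφ
    have hφm : φ ∈ IsManifold.maximalAtlas 𝓘(ℝ, F) ∞ X :=
      StructureGroupoid.subset_maximalAtlas _ ⟨⟨x⟩, H, hH, rfl⟩
    have h1 : ContDiffOn ℝ ∞ (u ∘ φ.symm) (φ.target ∩ φ.symm ⁻¹' W) := by
      rw [← contMDiffOn_iff_contDiffOn]
      exact hu.comp ((contMDiffOn_symm_of_mem_maximalAtlas hφm).mono inter_subset_left)
        fun y hy => hy.2
    have hO1 : IsOpen (φ.target ∩ φ.symm ⁻¹' W) := φ.symm.isOpen_inter_preimage hW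
    refine ⟨H.source ∩ (fun t => (H t).1) ⁻¹' (φ.target ∩ φ.symm ⁻¹' W),
      (continuous_fst.comp_continuousOn H.continuousOn).isOpen_inter_preimage H.open_source hO1,
      ⟨hxH, φ.map_source hxH, ?_⟩, fun t => u (φ.symm (H t).1), ?_, ?_⟩
    · change φ.symm (φ x) ∈ W
      rwa [φ.left_inv hxH]
    · exact h1.comp (contDiff_fst.comp_contDiffOn (hH.contDiffOn.mono inter_subset_left))
        fun t ht => ht.2
    · intro x' hx'
      change u x' = u (φ.symm (φ x'))
      rw [φ.left_inv hx'.1]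
  · intro hu
    have hsm : ContMDiff 𝓘(ℝ, F) 𝓘(ℝ, E) ∞ f := by
      intro x
      have : Nonempty X := ⟨x⟩
      set H := Classical.choose (h x)
      have hH : IsSlice f H := (Classical.choose_spec (h x)).1
      have hxH : f x ∈ H.source := (Classical.choose_spec (h x)).2
      set φ := sliceChart hf hH with hφ
      have hφm : φ ∈ IsManifold.maximalAtlas 𝓘(ℝ, F) ∞ X :=
        StructureGroupoid.subset_maximalAtlas _ ⟨⟨x⟩, H, hH, rfl⟩
      have h1 : ContMDiffOn 𝓘(ℝ, F) 𝓘(ℝ, E) ∞ ((fun y => f (φ.symm y)) ∘ φ) φ.source :=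
        (contMDiffOn_iff_contDiffOn.2 (contDiffOn_sliceChart_symm hf hH)).comp
          (contMDiffOn_of_mem_maximalAtlas hφm) fun x hx => φ.map_source hx
      refine (h1.contMDiffAt (φ.open_source.mem_nhds hxH)).congr_of_eventuallyEq ?_
      filter_upwards [φ.open_source.mem_nhds hxH] with x' hx'
      rw [Function.comp_apply, φ.left_inv hx']
    exact fun x hx => (hu x hx).contMDiffAt hsm |>.contMDiffWithinAt

/-! ### Arbitrary manifold structures with the prescribed smooth functions -/

section Natural

variable {n : ℕ} [Fintype ι] [ChartedSpace (EuclideanSpace ℝ (Fin n)) X]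
  {f : X → ι → ℝ} {H : OpenPartialHomeomorph (ι → ℝ) (EuclideanSpace ℝ (Fin n) × V)}

theorem contMDiff_of_forall_smoothExt
    (hcs : ∀ (W : Set X) (u : X → ℝ), IsOpen W →
      (ContMDiffOn (𝓡 n) 𝓘(ℝ, ℝ) ∞ u W ↔ ∀ x ∈ W, SmoothExt f u x)) :
    ContMDiff (𝓡 n) 𝓘(ℝ, ι → ℝ) ∞ f := by
  rw [contMDiff_pi_space]
  intro i
  rw [← contMDiffOn_univ, hcs _ _ isOpen_univ]
  intro x _
  exact ⟨univ, isOpen_univ, mem_univ _, fun t => t i, (contDiff_apply ℝ ℝ i).contDiffOn,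
    fun _ _ => rfl⟩

/-- The components of a chart of the given structure are smooth functions, hence extend to ambient
smooth functions. Composed with the inverse slice chart they are smooth, so that this inverse is
smooth for the given structure. -/
theorem sliceChart_mem_maximalAtlas [Nonempty X] [IsManifold (𝓡 n) ∞ X] (hf : Topology.IsEmbedding f)
    (hcs : ∀ (W : Set X) (u : X → ℝ), IsOpen W →
      (ContMDiffOn (𝓡 n) 𝓘(ℝ, ℝ) ∞ u W ↔ ∀ x ∈ W, SmoothExt f u x)) (hH : IsSlice f H) :
    sliceChart hf hH ∈ IsManifold.maximalAtlas (𝓡 n) ∞ X := by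
  have hsm := contMDiff_of_forall_smoothExt hcs
  set φ := sliceChart hf hH with hφ
  refine φ.mem_maximalAtlas_of_contMDiffOn ?_ ?_
  · exact (contMDiffOn_iff_contDiffOn.2 (contDiff_fst.comp_contDiffOn hH.contDiffOn)).comp
      hsm.contMDiffOn fun x hx => hx
  · intro y hy
    refine ContMDiffAt.contMDiffWithinAt ?_
    set ψ := chartAt (EuclideanSpace ℝ (Fin n)) (φ.symm y) with hψ
    have hyψ : φ.symm y ∈ ψ.source := mem_chart_source _ _
    have hcont : ContinuousAt φ.symm y := φ.symm.continuousAt hy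
    rw [contMDiffAt_iff_target]
    refine ⟨hcont, ?_⟩
    rw [contMDiffAt_iff_contDiffAt]
    refine contDiffAt_euclidean.2 fun i => ?_
    have hu : ContMDiffOn (𝓡 n) 𝓘(ℝ, ℝ) ∞ (fun x => ψ x i) ψ.source :=
      (contMDiffOn_iff_contDiffOn.2 (contDiff_piLp_apply (p := 2) (i := i)).contDiffOn).comp
        (t := univ) (contMDiffOn_of_mem_maximalAtlas
          (StructureGroupoid.chart_mem_maximalAtlas _ _)) fun x _ => mem_univ _
    obtain ⟨O, hO, hyO, G, hG, hGu⟩ := (hcs _ _ ψ.open_source).1 hu _ hyψ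
    have h1 : ContDiffAt ℝ ∞ (G ∘ fun y => f (φ.symm y)) y :=
      ContDiffAt.comp y (hG.contDiffAt (hO.mem_nhds hyO))
        ((contDiffOn_sliceChart_symm hf hH).contDiffAt (φ.open_target.mem_nhds hy))
    refine h1.congr_of_eventuallyEq ?_
    filter_upwards [hcont.preimage_mem_nhds ((hO.preimage hf.continuous).mem_nhds hyO)] with z hz
    exact hGu _ hz

/-- In the slice charts `f` reads `y ↦ (y, 0)`. -/
theorem isImmersion_of_slices [IsManifold (𝓡 n) ∞ X] (hf : Topology.IsEmbedding f)
    (hcs : ∀ (W : Set X) (u : X → ℝ), IsOpen W →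
      (ContMDiffOn (𝓡 n) 𝓘(ℝ, ℝ) ∞ u W ↔ ∀ x ∈ W, SmoothExt f u x))
    (e : (EuclideanSpace ℝ (Fin n) × V) ≃L[ℝ] (ι → ℝ))
    (h : ∀ x, ∃ H : OpenPartialHomeomorph (ι → ℝ) (EuclideanSpace ℝ (Fin n) × V),
      IsSlice f H ∧ f x ∈ H.source) :
    Manifold.IsImmersion (𝓡 n) 𝓘(ℝ, ι → ℝ) ∞ f := by
  refine Manifold.IsImmersionOfComplement.isImmersion (F := V) fun x => ?_
  have : Nonempty X := ⟨x⟩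
  obtain ⟨H, hH, hx⟩ := h x
  refine Manifold.IsImmersionAtOfComplement.mk_of_charts e (sliceChart hf hH)
    (H.trans e.toHomeomorph.toOpenPartialHomeomorph) hx (by simpa using hx)
    (sliceChart_mem_maximalAtlas hf hcs hH) ?_ ?_ ?_
  · refine OpenPartialHomeomorph.mem_maximalAtlas_of_contMDiffOn _ ?_ ?_
    · refine contMDiffOn_iff_contDiffOn.2 (e.contDiff.comp_contDiffOn (hH.contDiffOn.mono ?_))
      simp
    · refine contMDiffOn_iff_contDiffOn.2 (hH.contDiffOn_symm.comp e.symm.contDiff.contDiffOn ?_)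
      intro y hy
      simpa using hy
  · intro x' hx'
    change f x' ∈ H.source at hx'
    simpa using hx'
  · intro y hy
    have hy' : y ∈ (sliceChart hf hH).target := by simpa using hy
    have h1 := apply_sliceChart_symm hf hH hy'
    simp only [Function.comp_apply, OpenPartialHomeomorph.extend_coe_symm,
      OpenPartialHomeomorph.extend_coe, modelWithCornersSelf_coe, modelWithCornersSelf_coe_symm,
      id_eq, h1, OpenPartialHomeomorph.coe_trans]
    rw [H.right_inv hy']
    rfl

/-- The first component of `H` followed by the inverse slice chart is a differentiable left inverse
of `f` near `x`. -/
theorem mfderiv_injective_of_slice [IsManifold (𝓡 n) ∞ X] (hf : Topology.IsEmbedding f)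
    (hcs : ∀ (W : Set X) (u : X → ℝ), IsOpen W →
      (ContMDiffOn (𝓡 n) 𝓘(ℝ, ℝ) ∞ u W ↔ ∀ x ∈ W, SmoothExt f u x)) (hH : IsSlice f H) {x : X}
    (hx : f x ∈ H.source) : Function.Injective (mfderiv (𝓡 n) 𝓘(ℝ, ι → ℝ) f x) := by
  have : Nonempty X := ⟨x⟩
  have hsm := contMDiff_of_forall_smoothExt hcs
  set φ := sliceChart hf hH with hφ
  have hφm := sliceChart_mem_maximalAtlas hf hcs hH
  have hxφ : x ∈ φ.source := hx
  have h1 : MDifferentiableAt (𝓡 n) 𝓘(ℝ, ι → ℝ) f x := (hsm x).mdifferentiableAt (by simp)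
  have h2 : MDifferentiableAt 𝓘(ℝ, ι → ℝ) (𝓡 n) (fun t => (H t).1) (f x) :=
    (((contDiff_fst.comp_contDiffOn hH.contDiffOn).contDiffAt
      (H.open_source.mem_nhds hx)).contMDiffAt).mdifferentiableAt (by simp)
  have h3 : MDifferentiableAt (𝓡 n) (𝓡 n) φ.symm ((H (f x)).1) :=
    (((contMDiffOn_symm_of_mem_maximalAtlas hφm).contMDiffAt
      (φ.open_target.mem_nhds (φ.map_source hxφ))).mdifferentiableAt (by simp))
  have h4 : MDifferentiableAt 𝓘(ℝ, ι → ℝ) (𝓡 n) (φ.symm ∘ fun t => (H t).1) (f x) :=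
    MDifferentiableAt.comp (f x) h3 h2
  have h5 : mfderiv (𝓡 n) (𝓡 n) ((φ.symm ∘ fun t => (H t).1) ∘ f) x =
      (mfderiv 𝓘(ℝ, ι → ℝ) (𝓡 n) (φ.symm ∘ fun t => (H t).1) (f x)).comp
        (mfderiv (𝓡 n) 𝓘(ℝ, ι → ℝ) f x) := mfderiv_comp x h4 h1
  have h6 : mfderiv (𝓡 n) (𝓡 n) ((φ.symm ∘ fun t => (H t).1) ∘ f) x =
      mfderiv (𝓡 n) (𝓡 n) (id : X → X) x := by
    refine Filter.EventuallyEq.mfderiv_eq ?_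
    filter_upwards [φ.open_source.mem_nhds hxφ] with x' hx'
    exact φ.left_inv hx'
  intro v w hvw
  have h7 : ∀ v, mfderiv 𝓘(ℝ, ι → ℝ) (𝓡 n) (φ.symm ∘ fun t => (H t).1) (f x)
      (mfderiv (𝓡 n) 𝓘(ℝ, ι → ℝ) f x v) = v := fun v =>
    DFunLike.congr_fun (h5.symm.trans (h6.trans mfderiv_id)) v
  rw [← h7 v, hvw, h7 w]

end Natural

end Slices

end CirclePacking

namespace CirclePacking

/-! ## The cross ratio map is an embedding -/

/-- A submersion is straightened by a local diffeomorphism. -/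
theorem exists_straightening {E F V : Type*} [NormedAddCommGroup E] [NormedSpace ℝ E]
    [FiniteDimensional ℝ E] [NormedAddCommGroup F] [NormedSpace ℝ F] [FiniteDimensional ℝ F]
    [NormedAddCommGroup V] [NormedSpace ℝ V] [FiniteDimensional ℝ V] {g : E → V}
    (hg : ContDiff ℝ ∞ g) {t₀ : E} (hs : Function.Surjective (fderiv ℝ g t₀))
    (hdim : Module.finrank ℝ E = Module.finrank ℝ F + Module.finrank ℝ V) :
    ∃ H : OpenPartialHomeomorph E (F × V), t₀ ∈ H.source ∧ ContDiffOn ℝ ∞ H H.source ∧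
      ContDiffOn ℝ ∞ H.symm H.target ∧ ∀ t, (H t).2 = g t - g t₀ := by
  set L := (fderiv ℝ g t₀).toLinearMap with hL
  have hker : Module.finrank ℝ (LinearMap.ker L) = Module.finrank ℝ F := by
    have h1 := L.finrank_range_add_finrank_ker
    rw [LinearMap.range_eq_top.2 hs, finrank_top] at h1
    omega
  -- A projection onto the kernel of the derivative `L` supplies the missing coordinates: together
  -- with `L` it identifies `E` with `F × V`.
  obtain ⟨P, hP⟩ := LinearMap.exists_leftInverse_of_injective (LinearMap.ker L).subtype
    (Submodule.ker_subtype _)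
  let e₁ : LinearMap.ker L ≃ₗ[ℝ] F := LinearEquiv.ofFinrankEq _ _ hker
  let π : E →ₗ[ℝ] F := e₁.toLinearMap ∘ₗ P
  have hinj : Function.Injective (π.prod L) := by
    rw [← LinearMap.ker_eq_bot, LinearMap.ker_eq_bot']
    intro x hx
    have h1 : L x = 0 := congrArg Prod.snd hx
    have h2 : π x = 0 := congrArg Prod.fst hx
    have h3 : P x = 0 := e₁.injective (by rw [map_zero]; exact h2)
    have h4 := LinearMap.congr_fun hP ⟨x, h1⟩
    rw [LinearMap.comp_apply, Submodule.subtype_apply, h3] at h4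
    exact (congrArg Subtype.val h4).symm
  let e₂ : E ≃L[ℝ] F × V := (LinearEquiv.ofInjectiveOfFinrankEq (π.prod L) hinj (by
    rw [Module.finrank_prod, hdim])).toContinuousLinearEquiv
  let Ψ : E → F × V := fun t => (π t, g t - g t₀)
  have hπ : ContDiff ℝ ∞ π := π.toContinuousLinearMap.contDiff
  have hΨ : ContDiff ℝ ∞ Ψ := hπ.prodMk (hg.sub contDiff_const)
  have hder : HasFDerivAt Ψ (e₂ : E →L[ℝ] F × V) t₀ := by
    have h1 : HasFDerivAt π π.toContinuousLinearMap t₀ := π.toContinuousLinearMap.hasFDerivAt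
    have h2 := (hg.differentiable (by simp) t₀).hasFDerivAt.sub_const (g t₀)
    refine (h1.prodMk h2).congr_fderiv ?_
    ext x <;> rfl
  let H₀ := hΨ.contDiffAt.toOpenPartialHomeomorph Ψ hder (by simp)
  -- Restricting to the open set where the derivative is invertible makes the inverse smooth on the
  -- whole target, not only at one point.
  let O : Set E := {t | fderiv ℝ Ψ t ∈ Set.range ((↑) : (E ≃L[ℝ] F × V) → E →L[ℝ] F × V)}
  have hO : IsOpen O := ContinuousLinearEquiv.isOpen.preimage (hΨ.continuous_fderiv (by simp))
  refine ⟨H₀.restrOpen O hO, ⟨hΨ.contDiffAt.mem_toOpenPartialHomeomorph_source hder (by simp),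
    e₂, hder.fderiv.symm⟩, hΨ.contDiffOn, ?_, fun t => rfl⟩
  intro y hy
  have hy' : H₀.symm y ∈ (H₀.restrOpen O hO).source := (H₀.restrOpen O hO).map_target hy
  obtain ⟨e, he⟩ := hy'.2
  refine ContDiffAt.contDiffWithinAt ?_
  refine (H₀.restrOpen O hO).contDiffAt_symm hy (f₀' := e) ?_ hΨ.contDiffAt
  rw [he]
  exact (hΨ.differentiable (by simp) _).hasFDerivAt

variable {D D' : Type*} {M : Triangulation D} {U : UniversalCovering M D'}

open UniversalCovering Triangulation

/-! ### Smooth functions of developed packings -/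

namespace UniversalCovering.DevelopedPacking

theorem continuous_coord (i : U.CoordIndex) : Continuous fun q : U.DevelopedPacking => q.coord i := by
  have h : Continuous (coord : U.DevelopedPacking → _) := continuous_induced_dom
  exact (continuous_apply i).comp h

namespace SmoothAt

variable {p : U.DevelopedPacking}

theorem congr {F F' : U.DevelopedPacking → ℝ} (h : SmoothAt F p) (h' : F' =ᶠ[𝓝 p] F) :
    SmoothAt F' p := by
  obtain ⟨s, G, hG, hF⟩ := h
  exact ⟨s, G, hG, by filter_upwards [h', hF] with q h1 h2; rw [h1, h2]⟩

theorem continuousAt {F : U.DevelopedPacking → ℝ} (h : SmoothAt F p) : ContinuousAt F p := by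
  obtain ⟨s, G, hG, hF⟩ := h
  refine ContinuousAt.congr (f := fun q => G fun i => q.coord i) ?_ ?_
  · exact (hG.continuous.comp (continuous_pi fun i => continuous_coord _)).continuousAt
  · filter_upwards [hF] with q hq
    exact hq.symm

/-- Smooth functions of smooth functions are smooth. -/
theorem comp {ι : Type*} [Fintype ι] {F : ι → U.DevelopedPacking → ℝ}
    (hF : ∀ i, SmoothAt (F i) p) {O : Set (ι → ℝ)} (hO : IsOpen O) (hp : (fun i => F i p) ∈ O)
    {G : (ι → ℝ) → ℝ} (hG : ContDiffOn ℝ ∞ G O) : SmoothAt (fun q => G fun i => F i q) p := by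
  classical
  choose s K hK hev using hF
  -- `SmoothAt` asks for a globally smooth formula, so the locally defined `G` is replaced by a
  -- global function with the same germ.
  obtain ⟨G', hG', hGG⟩ := exists_contDiff_eventuallyEq hO hp hG
  have hsub : ∀ i, ∀ j ∈ s i, j ∈ Finset.univ.biUnion s := fun i j hj =>
    Finset.mem_biUnion.2 ⟨i, Finset.mem_univ i, hj⟩
  let T : (Finset.univ.biUnion s → ℂ) → ι → ℝ := fun z i => K i fun j => z ⟨j, hsub i j j.2⟩
  have hT : ContDiff ℝ ∞ T := contDiff_pi.2 fun i =>
    (hK i).comp (contDiff_pi.2 fun j => contDiff_apply ℝ ℂ _)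
  refine ⟨Finset.univ.biUnion s, fun z => G' (T z), hG'.comp hT, ?_⟩
  have hall : ∀ᶠ q in 𝓝 p, (fun i => F i q) = T fun j => q.coord j := by
    filter_upwards [Filter.eventually_all.2 hev] with q hq
    exact funext hq
  have hcont : Filter.Tendsto (fun q : U.DevelopedPacking => fun i => F i q) (𝓝 p)
      (𝓝 fun i => F i p) := by
    refine tendsto_pi_nhds.2 fun i => ?_
    exact continuousAt ⟨s i, K i, hK i, hev i⟩
  filter_upwards [hall, hcont.eventually hGG] with q h1 h2
  rw [← h1, h2]

theorem mink_disk (v w : U.cover.Vertex) : SmoothAt (fun q => mink (q.disk v) (q.disk w)) p := by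
  classical
  let ix : Bool × Fin 2 × Fin 2 → U.CoordIndex := fun x => Sum.inl (bif x.1 then v else w, x.2)
  let s : Finset U.CoordIndex := Finset.univ.image ix
  have hs : ∀ x, ix x ∈ s := fun x => Finset.mem_image_of_mem _ (Finset.mem_univ x)
  let Z : Bool → (s → ℂ) → Mat := fun b z => Matrix.of fun i j => z ⟨ix (b, i, j), hs _⟩
  have hZ : ∀ b i j, ContDiff ℝ ∞ fun z => Z b z i j := fun b i j => contDiff_apply ℝ ℂ _
  refine ⟨s, fun z => mink (Z true z) (Z false z), ?_, Filter.Eventually.of_forall fun q => rfl⟩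
  simp only [mink, Matrix.det_fin_two, Matrix.add_apply]
  have h00 := hZ true 0 0
  have h01 := hZ true 0 1
  have h10 := hZ true 1 0
  have h11 := hZ true 1 1
  have k00 := hZ false 0 0
  have k01 := hZ false 0 1
  have k10 := hZ false 1 0
  have k11 := hZ false 1 1
  exact contDiff_const.mul (Complex.reCLM.contDiff.comp
    (((((h00.add k00).mul (h11.add k11)).sub ((h01.add k01).mul (h10.add k10))).sub
      ((h00.mul h11).sub (h01.mul h10))).sub ((k00.mul k11).sub (k01.mul k10))))

end SmoothAt

theorem shape_pos (p : U.DevelopedPacking) (e : D') : 0 < p.shape e := by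
  rw [← crossRatioMap_edge]
  exact p.closing.pos _

/-- Positivity of the shape selects the root in `shape_sq`, and it keeps the square root away from
zero, where it is smooth. -/
theorem shape_eq_sqrt (p : U.DevelopedPacking) (e : D') :
    p.shape e = Real.sqrt ((1 - mink (p.disk (U.cover.head (U.cover.next e)))
      (p.disk (U.cover.head (U.cover.next (U.cover.rev e))))) / 2) := by
  rw [← p.shape_sq, sub_sub_cancel, mul_div_cancel_left₀ _ two_ne_zero,
    Real.sqrt_sq (p.shape_pos e).le]

theorem smoothAt_shape (p : U.DevelopedPacking) (e : D') : SmoothAt (fun q => q.shape e) p := by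
  simp only [shape_eq_sqrt]
  refine SmoothAt.comp (ι := Unit) (F := fun _ q => mink (q.disk (U.cover.head (U.cover.next e)))
      (q.disk (U.cover.head (U.cover.next (U.cover.rev e))))) (fun _ => SmoothAt.mink_disk _ _)
    (O := {x | x () < 1}) (isOpen_lt (continuous_apply _) continuous_const) ?_
    (G := fun x => Real.sqrt ((1 - x ()) / 2)) ?_
  · have h1 := p.shape_sq e
    have h2 := p.shape_pos e
    have h3 : 0 < p.shape e ^ 2 := by positivity
    rw [Set.mem_ofPred_eq]
    linarith
  · refine ContDiffOn.sqrt ?_ fun x hx => ?_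
    · exact ((contDiff_const.sub (contDiff_apply ℝ ℝ ())).div_const 2).contDiffOn
    · have hx' : x () < 1 := hx
      have : 0 < (1 - x ()) / 2 := by linarith
      exact this.ne'

theorem smoothAt_crossRatioMap (p : U.DevelopedPacking) (ε : M.Edge) :
    SmoothAt (fun q => U.crossRatioMap q.toSpace ε) p := by
  obtain ⟨d, rfl⟩ := M.edge_surjective ε
  obtain ⟨e, rfl⟩ := U.proj_surjective d
  simp only [crossRatioMap_edge]
  exact p.smoothAt_shape e

theorem continuous_toSpace : Continuous (toSpace : U.DevelopedPacking → U.PackingSpace) :=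
  continuous_quot_mk

theorem toSpace_surjective : Function.Surjective (toSpace : U.DevelopedPacking → U.PackingSpace) :=
  Quotient.exists_rep

end UniversalCovering.DevelopedPacking

open DevelopedPacking

theorem continuous_crossRatioMap : Continuous U.crossRatioMap := by
  refine (Topology.IsQuotientMap.continuous_iff (f := (toSpace : U.DevelopedPacking → _))
    isQuotientMap_quot_mk).2 ?_
  refine continuous_pi fun ε => continuous_iff_continuousAt.2 fun p => ?_
  exact (p.smoothAt_crossRatioMap ε).continuousAt

theorem toSpace_out (x : U.PackingSpace) : toSpace (Quotient.out x) = x := Quotient.out_eq x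

/-! ### Normalized packings and the inverse of the cross ratio map -/

section Embedding

variable [Finite D] (e₀ : D')

/-- A developed packing representing a given point, normalized at the triangle on the left
of `e₀`. -/
def normalized (x : U.PackingSpace) : U.DevelopedPacking :=
  develop (Quotient.out x).closing e₀ (nonElementary_holonomy (Quotient.out x) e₀)

theorem toSpace_normalized (x : U.PackingSpace) : (normalized e₀ x).toSpace = x :=
  (develop_crossRatioMap _ e₀).trans (toSpace_out x)

theorem coord_normalized (x : U.PackingSpace) :
    (normalized e₀ x).coord = devCoord U e₀ (U.crossRatioMap x) := by
  rw [normalized, coord_develop, toSpace_out]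

/-- The coordinates of the normalized packing are continuous functions of the cross ratios alone. -/
theorem tendsto_normalized (x : U.PackingSpace) : Filter.Tendsto (normalized (U := U) e₀)
    ((𝓝 (U.crossRatioMap x)).comap U.crossRatioMap) (𝓝 (normalized e₀ x)) := by
  rw [nhds_induced, Filter.tendsto_comap_iff]
  have h1 : coord ∘ normalized (U := U) e₀ = devCoord U e₀ ∘ U.crossRatioMap :=
    funext fun y => coord_normalized e₀ y
  have h2 : Continuous (devCoord U e₀) := continuous_pi fun i => (contDiff_devCoord e₀ i).continuous
  rw [h1, coord_normalized]
  exact (h2.tendsto _).comp Filter.tendsto_comap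

include e₀ in
-- Normalization is a section of the quotient map that is continuous for the topology pulled back by
-- the cross ratios. Hence the quotient topology is not finer than the pulled back one.
theorem isEmbedding_crossRatioMap : Topology.IsEmbedding U.crossRatioMap := by
  have : Nonempty D' := ⟨e₀⟩
  refine ⟨Topology.isInducing_iff_nhds.2 fun x => le_antisymm
    (continuous_crossRatioMap.tendsto x).le_comap ?_, crossRatioMap_injective⟩
  have h1 := (continuous_toSpace.tendsto _).comp (tendsto_normalized e₀ x)
  rw [toSpace_normalized] at h1
  have h2 : toSpace ∘ normalized (U := U) e₀ = id := funext (toSpace_normalized e₀)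
  rwa [h2] at h1

/-- Substituting the normalized packing into the local formula expresses `u` by the cross ratios,
through the smooth functions `devCoord`. -/
theorem smoothExt_of_smoothAt {u : U.PackingSpace → ℝ} {x : U.PackingSpace}
    (h : SmoothAt (fun q => u q.toSpace) (normalized e₀ x)) : SmoothExt U.crossRatioMap u x := by
  obtain ⟨s, G, hG, hev⟩ := h
  obtain ⟨N, hN, hNs⟩ := Filter.mem_comap.1 ((tendsto_normalized e₀ x).eventually hev)
  obtain ⟨O, hON, hO, hx⟩ := mem_nhds_iff.1 hN
  refine ⟨O, hO, hx, fun t => G fun i => devCoord U e₀ t i,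
    (hG.comp (contDiff_pi.2 fun i => contDiff_devCoord e₀ _)).contDiffOn, fun x' hx' => ?_⟩
  have h1 : u (normalized e₀ x').toSpace = G fun i => (normalized e₀ x').coord i := hNs (hON hx')
  rw [toSpace_normalized, coord_normalized] at h1
  exact h1

end Embedding

theorem smoothAt_of_smoothExt [Finite D] {u : U.PackingSpace → ℝ} {p : U.DevelopedPacking}
    (h : SmoothExt U.crossRatioMap u p.toSpace) : SmoothAt (fun q => u q.toSpace) p := by
  obtain ⟨O, hO, hp, G, hG, hu⟩ := h
  refine SmoothAt.congr (SmoothAt.comp (F := fun ε q => U.crossRatioMap q.toSpace ε)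
    p.smoothAt_crossRatioMap hO hp hG) ?_
  filter_upwards [(hO.preimage (continuous_crossRatioMap.comp continuous_toSpace)).mem_nhds hp]
    with q hq
  exact hu _ hq

theorem forall_smoothAt_iff [Finite D] (e₀ : D') {u : U.PackingSpace → ℝ}
    {W : Set U.PackingSpace} :
    (∀ p : U.DevelopedPacking, p.toSpace ∈ W → SmoothAt (fun q => u q.toSpace) p) ↔
      ∀ x ∈ W, SmoothExt U.crossRatioMap u x := by
  constructor
  · intro h x hx
    exact smoothExt_of_smoothAt e₀ (h _ (by rwa [toSpace_normalized]))
  · intro h p hp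
    exact smoothAt_of_smoothExt (h _ hp)

/-! ## Slices -/

theorem Triangulation.Closing.vertexMap_eq {t : M.Edge → ℝ} (h : M.Closing t) :
    M.vertexMap t = fun _ => ![-1, 0, 0] := by
  funext v
  rw [vertexMap, (h _).1]
  simp

/-- At the base dart the determinant recovers the fourth entry. Moving on to the next dart
conjugates the product by a frieze matrix, and `-1` is central. -/
theorem transport_valence_eq_neg_one {t : M.Edge → ℝ}
    (h : M.vertexMap t = fun _ => ![-1, 0, 0]) (d : D) : M.transport t d (M.valence d) = -1 := by
  have hbase : ∀ v, M.transport t (M.baseDart v) (M.valence (M.baseDart v)) = -1 := by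
    intro v
    have h1 := congrFun h v
    rw [vertexMap] at h1
    have e0 := congrFun h1 0
    have e1 := congrFun h1 1
    have e2 := congrFun h1 2
    simp at e0 e1 e2
    have hdet := det_transport t (M.baseDart v) (M.valence (M.baseDart v))
    rw [Matrix.det_fin_two, e0, e1, e2] at hdet
    ext i j
    fin_cases i <;> fin_cases j <;> simp [e0, e1, e2]
    linarith
  have hstep : ∀ d, M.transport t d (M.valence d) = -1 →
      M.transport t (M.rot d) (M.valence (M.rot d)) = -1 := by
    intro d hd
    have h1 := transport_succ' t d (M.valence d)
    rw [transport_succ, hd, Function.iterate_succ_apply', rot_iterate_valence] at h1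
    have h2 : frieze (t (M.edge (M.rot d))) * !![0, 1; -1, t (M.edge (M.rot d))] = 1 := by
      ext i j
      fin_cases i <;> fin_cases j <;> simp [frieze, Matrix.mul_apply, Fin.sum_univ_two]
    rw [valence_rot]
    calc M.transport t (M.rot d) (M.valence d)
        = M.transport t (M.rot d) (M.valence d) * (frieze (t (M.edge (M.rot d))) *
          !![0, 1; -1, t (M.edge (M.rot d))]) := by rw [h2, mul_one]
      _ = -1 := by rw [← mul_assoc, ← h1, mul_neg, mul_one, neg_mul, h2]
  obtain ⟨i, -, hi⟩ := M.exists_rot_of_tail_eq (M.tail_baseDart (M.tail d))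
  rw [← hi]
  clear hi
  induction i with
  | zero => exact hbase _
  | succ i ih =>
    rw [Function.iterate_succ_apply']
    exact hstep _ ih

/-- The positivity conditions are finitely many open conditions, so only the equations need to be
imposed nearby. -/
theorem eventually_closing [Finite D] {t₀ : M.Edge → ℝ} (h : M.Closing t₀) :
    ∀ᶠ t in 𝓝 t₀, M.vertexMap t = M.vertexMap t₀ → M.Closing t := by
  have h1 : ∀ᶠ t in 𝓝 t₀, ∀ d : D, ∀ i : Fin (M.valence d),
      (i : ℕ) + 1 < M.valence d → 0 < M.transport t d i 0 0 := by
    refine Filter.eventually_all.2 fun d => Filter.eventually_all.2 fun i => ?_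
    by_cases hi : (i : ℕ) + 1 < M.valence d
    · filter_upwards [(contDiff_transport d i 0 0).continuous.continuousAt.eventually
        (lt_mem_nhds ((h d).2 i hi))] with t ht _
      exact ht
    · exact Filter.Eventually.of_forall fun t ht => (hi ht).elim
  filter_upwards [h1] with t ht hv d
  rw [h.vertexMap_eq] at hv
  exact ⟨transport_valence_eq_neg_one hv d, fun i hi => ht d ⟨i, by omega⟩ hi⟩

/-- Near the cross ratios of a packing every solution of the closing equations keeps the positivity
and a non-elementary holonomy, and therefore develops to a packing. -/
theorem eventually_mem_range_iff [Finite D] (x : U.PackingSpace) :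
    ∀ᶠ t in 𝓝 (U.crossRatioMap x), t ∈ Set.range U.crossRatioMap ↔
      M.vertexMap t = M.vertexMap (U.crossRatioMap x) := by
  obtain ⟨p, rfl⟩ := toSpace_surjective x
  by_cases hD : Nonempty D'
  · obtain ⟨e₀⟩ := hD
    obtain ⟨C, hC, hCiff⟩ := exists_isClosed_nonElementary_iff U e₀
    have hp : U.crossRatioMap p.toSpace ∉ C :=
      (hCiff _ p.closing).1 (nonElementary_holonomy p e₀)
    filter_upwards [eventually_closing p.closing, hC.isOpen_compl.mem_nhds hp] with t h1 h2
    constructor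
    · rintro ⟨y, rfl⟩
      obtain ⟨q, rfl⟩ := toSpace_surjective y
      rw [q.closing.vertexMap_eq, p.closing.vertexMap_eq]
    · intro h3
      exact ⟨_, crossRatioMap_develop (h1 h3) e₀ ((hCiff t _).2 h2)⟩
  · have : IsEmpty D := ⟨fun d => hD ⟨(U.proj_surjective d).choose⟩⟩
    have hE : IsEmpty M.Edge := ⟨fun ε => by obtain ⟨d, -⟩ := M.edge_surjective ε; exact isEmptyElim d⟩
    refine Filter.Eventually.of_forall fun t => ?_
    rw [Subsingleton.elim t (U.crossRatioMap p.toSpace)]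
    exact ⟨fun _ => rfl, fun _ => ⟨_, rfl⟩⟩

theorem finrank_edge [Finite D] {g : ℕ} (hg : 2 ≤ g) (hM : M.IsClosedOfGenus g) :
    Module.finrank ℝ (M.Edge → ℝ) = Module.finrank ℝ (EuclideanSpace ℝ (Fin (6 * g - 6))) +
      Module.finrank ℝ (M.Vertex → Fin 3 → ℝ) := by
  have := Fintype.ofFinite D
  have h := hM.card_edge.1
  rw [Nat.card_eq_fintype_card, Nat.card_eq_fintype_card] at h
  rw [Module.finrank_pi, finrank_euclideanSpace_fin, Module.finrank_pi_fintype]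
  simp only [Module.finrank_pi, Fintype.card_fin, Finset.sum_const, Finset.card_univ, smul_eq_mul]
  omega

theorem exists_isSlice [Finite D] {g : ℕ} (hg : 2 ≤ g) (hM : M.IsClosedOfGenus g)
    (hU : U.cover.IsSimplicial) (x : U.PackingSpace) :
    ∃ H : OpenPartialHomeomorph (M.Edge → ℝ)
      (EuclideanSpace ℝ (Fin (6 * g - 6)) × (M.Vertex → Fin 3 → ℝ)),
      IsSlice U.crossRatioMap H ∧ U.crossRatioMap x ∈ H.source := by
  obtain ⟨p, hp⟩ := toSpace_surjective x
  have hcl : M.Closing (U.crossRatioMap x) := hp ▸ p.closing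
  obtain ⟨H, h1, h2, h3, h4⟩ := exists_straightening
    (F := EuclideanSpace ℝ (Fin (6 * g - 6))) contDiff_vertexMap
    (hcl.fderiv_vertexMap_surjective hg hM U hU) (finrank_edge hg hM)
  obtain ⟨O, hOs, hO, hx⟩ := mem_nhds_iff.1 (eventually_mem_range_iff x)
  refine ⟨H.restrOpen O hO, ⟨h2.mono Set.inter_subset_left, h3.mono fun y hy => hy.1,
    fun t ht => ?_⟩, h1, hx⟩
  have h5 : t ∈ Set.range U.crossRatioMap ↔
    M.vertexMap t = M.vertexMap (U.crossRatioMap x) := hOs ht.2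
  rw [h5, OpenPartialHomeomorph.coe_restrOpen, h4, sub_eq_zero]

/-- An empty surface has Euler characteristic zero, which is excluded by `2 ≤ g`. -/
theorem nonempty_cover {g : ℕ} (hg : 2 ≤ g) (hM : M.IsClosedOfGenus g)
    (U : UniversalCovering M D') : Nonempty D' := by
  by_contra h
  rw [not_nonempty_iff] at h
  have hD : IsEmpty D := ⟨fun d => isEmptyElim (U.proj_surjective d).choose⟩
  have h1 : IsEmpty M.Vertex := ⟨fun v => isEmptyElim (M.tail_surjective v).choose⟩
  have h2 : IsEmpty M.Edge := ⟨fun v => isEmptyElim (M.edge_surjective v).choose⟩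
  have h3 : IsEmpty M.Face := ⟨fun v => isEmptyElim (M.face_surjective v).choose⟩
  have h4 := hM.2.2
  simp at h4
  omega

theorem exists_isNaturalManifoldStructure [Finite D] {g : ℕ} (hg : 2 ≤ g)
    (hM : M.IsClosedOfGenus g) (hU : U.cover.IsSimplicial) :
    ∃ cs, U.IsNaturalManifoldStructure (6 * g - 6) cs := by
  obtain ⟨e₀⟩ := nonempty_cover hg hM U
  have hemb := isEmbedding_crossRatioMap (U := U) e₀
  refine ⟨sliceChartedSpace _ hemb (exists_isSlice hg hM hU), hemb.t2Space,
    hemb.secondCountableTopology, isManifold_sliceChartedSpace hemb (exists_isSlice hg hM hU),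
    fun W u hW => ?_⟩
  rw [forall_smoothAt_iff e₀]
  exact contMDiffOn_sliceChartedSpace_iff hemb (exists_isSlice hg hM hU) W u hW

theorem IsNaturalManifoldStructure.contMDiffOn_iff [Finite D] (e₀ : D') {n : ℕ}
    {cs : ChartedSpace (EuclideanSpace ℝ (Fin n)) U.PackingSpace}
    (h : U.IsNaturalManifoldStructure n cs) (W : Set U.PackingSpace) (u : U.PackingSpace → ℝ)
    (hW : IsOpen W) :
    ContMDiffOn (𝓡 n) 𝓘(ℝ, ℝ) ∞ u W ↔ ∀ x ∈ W, SmoothExt U.crossRatioMap u x := by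
  rw [h.2.2.2 W u hW, forall_smoothAt_iff e₀]

theorem isImmersion_crossRatioMap [Finite D] {g : ℕ} (hg : 2 ≤ g)
    (hM : M.IsClosedOfGenus g) (hU : U.cover.IsSimplicial)
    {cs : ChartedSpace (EuclideanSpace ℝ (Fin (6 * g - 6))) U.PackingSpace}
    (h : U.IsNaturalManifoldStructure (6 * g - 6) cs) :
    Manifold.IsImmersion (𝓡 (6 * g - 6)) 𝓘(ℝ, M.Edge → ℝ) ∞ U.crossRatioMap := by
  obtain ⟨e₀⟩ := nonempty_cover hg hM U
  have := h.2.2.1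
  refine isImmersion_of_slices (isEmbedding_crossRatioMap e₀)
    (IsNaturalManifoldStructure.contMDiffOn_iff e₀ h)
    (ContinuousLinearEquiv.ofFinrankEq ?_) (exists_isSlice hg hM hU)
  rw [Module.finrank_prod, finrank_edge hg hM]

theorem mfderiv_crossRatioMap_injective [Finite D] {g : ℕ} (hg : 2 ≤ g)
    (hM : M.IsClosedOfGenus g) (hU : U.cover.IsSimplicial)
    {cs : ChartedSpace (EuclideanSpace ℝ (Fin (6 * g - 6))) U.PackingSpace}
    (h : U.IsNaturalManifoldStructure (6 * g - 6) cs) (x : U.PackingSpace) :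
    Function.Injective (mfderiv (𝓡 (6 * g - 6)) 𝓘(ℝ, M.Edge → ℝ) U.crossRatioMap x) := by
  obtain ⟨e₀⟩ := nonempty_cover hg hM U
  have := h.2.2.1
  obtain ⟨H, hH, hx⟩ := exists_isSlice hg hM hU x
  exact mfderiv_injective_of_slice (isEmbedding_crossRatioMap e₀)
    (IsNaturalManifoldStructure.contMDiffOn_iff e₀ h) hH hx

theorem contMDiff_crossRatioMap [Finite D] (e₀ : D') {n : ℕ}
    {cs : ChartedSpace (EuclideanSpace ℝ (Fin n)) U.PackingSpace}
    (h : U.IsNaturalManifoldStructure n cs) :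
    ContMDiff (𝓡 n) 𝓘(ℝ, M.Edge → ℝ) ∞ U.crossRatioMap :=
  contMDiff_of_forall_smoothExt (IsNaturalManifoldStructure.contMDiffOn_iff e₀ h)

/-- The differential of the cross ratio map is onto the space of solutions of the linearized closing
equations. -/
theorem range_mfderiv_crossRatioMap [Finite D] {g : ℕ} (hg : 2 ≤ g)
    (hM : M.IsClosedOfGenus g) (hU : U.cover.IsSimplicial)
    {cs : ChartedSpace (EuclideanSpace ℝ (Fin (6 * g - 6))) U.PackingSpace}
    (h : U.IsNaturalManifoldStructure (6 * g - 6) cs) (x : U.PackingSpace) (q : M.Edge → ℝ) :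
    (∃ X, mfderiv (𝓡 (6 * g - 6)) 𝓘(ℝ, M.Edge → ℝ) U.crossRatioMap x X = q) ↔
      fderiv ℝ M.vertexMap (U.crossRatioMap x) q = 0 := by
  obtain ⟨e₀⟩ := nonempty_cover hg hM U
  obtain ⟨p, hp⟩ := toSpace_surjective x
  have hcl : M.Closing (U.crossRatioMap x) := hp ▸ p.closing
  set A : EuclideanSpace ℝ (Fin (6 * g - 6)) →ₗ[ℝ] (M.Edge → ℝ) :=
    (mfderiv (𝓡 (6 * g - 6)) 𝓘(ℝ, M.Edge → ℝ) U.crossRatioMap x).toLinearMap with hA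
  set B : (M.Edge → ℝ) →ₗ[ℝ] (M.Vertex → Fin 3 → ℝ) :=
    (fderiv ℝ M.vertexMap (U.crossRatioMap x)).toLinearMap with hB
  have hinj : Function.Injective A := mfderiv_crossRatioMap_injective hg hM hU h x
  have hsurj : Function.Surjective B := hcl.fderiv_vertexMap_surjective hg hM U hU
  have hle : LinearMap.range A ≤ LinearMap.ker B := by
    rintro _ ⟨X, rfl⟩
    have h1 : MDifferentiableAt (𝓡 (6 * g - 6)) 𝓘(ℝ, M.Edge → ℝ) U.crossRatioMap x :=
      (contMDiff_crossRatioMap e₀ h x).mdifferentiableAt (by simp)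
    have h2 : MDifferentiableAt 𝓘(ℝ, M.Edge → ℝ) 𝓘(ℝ, M.Vertex → Fin 3 → ℝ) M.vertexMap
        (U.crossRatioMap x) :=
      (contDiff_vertexMap.contMDiff _).mdifferentiableAt (by simp)
    have h3 := mfderiv_comp x h2 h1
    have h4 : M.vertexMap ∘ U.crossRatioMap = fun _ => fun _ => ![-1, 0, 0] := by
      funext y
      obtain ⟨q, rfl⟩ := toSpace_surjective y
      exact q.closing.vertexMap_eq
    rw [h4, mfderiv_const, mfderiv_eq_fderiv] at h3
    exact (DFunLike.congr_fun h3 X).symm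
  -- Both spaces have dimension `6g - 6`: `A` is injective, and `B` is onto a space of dimension
  -- `3V`.
  have heq : LinearMap.range A = LinearMap.ker B := by
    refine Submodule.eq_of_le_of_finrank_eq hle ?_
    have h1 := B.finrank_range_add_finrank_ker
    rw [LinearMap.range_eq_top.2 hsurj, finrank_top, finrank_edge hg hM] at h1
    rw [LinearMap.finrank_range_of_inj hinj]
    omega
  exact (SetLike.ext_iff.1 heq q)

end CirclePacking

namespace CirclePacking

/-! ## Infinitesimal motions of disks -/

theorem Ad_inv_Ad (A : PSL(2, ℂ)) (X : Mat) : Ad A⁻¹ (Ad A X) = X := by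
  rw [← Module.End.mul_apply, ← map_mul, inv_mul_cancel, map_one, Module.End.one_apply]

theorem Ad_Ad_inv (A : PSL(2, ℂ)) (X : Mat) : Ad A (Ad A⁻¹ X) = X := by
  rw [← Module.End.mul_apply, ← map_mul, mul_inv_cancel, map_one, Module.End.one_apply]

theorem trace_Ad (A : PSL(2, ℂ)) (X : Mat) : (Ad A X).trace = X.trace := by
  obtain ⟨B, rfl⟩ := psl_surjective A
  rw [Ad_psl, Matrix.trace_mul_comm, ← Matrix.mul_assoc, ← Matrix.SpecialLinearGroup.coe_mul,
    inv_mul_cancel, Matrix.SpecialLinearGroup.coe_one, Matrix.one_mul]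

theorem conjMat_mul (X Y : Mat) : conjMat (X * Y) = conjMat X * conjMat Y := by
  ext i j
  simp [conjMat, Matrix.mul_apply]

theorem inv_mul_coe (B : SL(2, ℂ)) : ((B⁻¹ : SL(2, ℂ)) : Mat) * (B : Mat) = 1 := by
  rw [← Matrix.SpecialLinearGroup.coe_mul, inv_mul_cancel, Matrix.SpecialLinearGroup.coe_one]

theorem infAct_Ad_act (A : PSL(2, ℂ)) (X Y : Mat) :
    infAct (Ad A X) (act A Y) = act A (infAct X Y) := by
  obtain ⟨B, rfl⟩ := psl_surjective A
  set P : Mat := ((B⁻¹ : SL(2, ℂ)) : Mat) with hP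
  set Q : Mat := (B : Mat) with hQ
  have h : P * Q = 1 := inv_mul_coe B
  have h1 : Qᵀ * Pᵀ = 1 := by rw [← Matrix.transpose_mul, h, Matrix.transpose_one]
  have h2 : conjMat P * conjMat Q = 1 := by
    rw [← conjMat_mul, h]
    simp [conjMat]
  rw [infAct, infAct, Ad_psl, act_psl, act_psl, ← hP, ← hQ]
  simp only [Matrix.transpose_mul, conjMat_mul, Matrix.mul_neg, Matrix.neg_mul, Matrix.mul_add,
    Matrix.add_mul, Matrix.mul_assoc]
  rw [← Matrix.mul_assoc Qᵀ, h1, Matrix.one_mul, ← Matrix.mul_assoc (conjMat P) (conjMat Q), h2,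
    Matrix.one_mul]

theorem mink_eq (X Y : Mat) : mink X Y =
    -(1 / 2) * (X 0 0 * Y 1 1 + X 1 1 * Y 0 0 - X 0 1 * Y 1 0 - X 1 0 * Y 0 1).re := by
  rw [mink, Matrix.det_fin_two, Matrix.det_fin_two, Matrix.det_fin_two]
  congr 2
  simp only [Matrix.add_apply]
  ring

theorem mink_self {X : Mat} (h : X ∈ deSitter) : mink X X = 1 := by
  have h1 := h.2
  rw [Matrix.det_fin_two] at h1
  rw [mink_eq, show X 0 0 * X 1 1 + X 1 1 * X 0 0 - X 0 1 * X 1 0 - X 1 0 * X 0 1 =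
    2 * (X 0 0 * X 1 1 - X 0 1 * X 1 0) by ring, h1]
  simp

/-- Trace-free matrices generate isometries of the Minkowski product. -/
theorem mink_infAct {A : Mat} (hA : A.trace = 0) (X Y : Mat) :
    mink (infAct A X) Y + mink X (infAct A Y) = 0 := by
  rw [Matrix.trace_fin_two] at hA
  have h11 : A 1 1 = -A 0 0 := by linear_combination hA
  rw [mink_eq, mink_eq, ← mul_add, ← Complex.add_re]
  convert mul_zero _
  convert Complex.zero_re
  simp [infAct, conjMat, Matrix.mul_apply, Fin.sum_univ_two, h11]
  ring

theorem infAct_sub (A B X : Mat) : infAct (A - B) X = infAct A X - infAct B X := by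
  have h : conjMat (A - B) = conjMat A - conjMat B := by
    ext i j
    simp [conjMat]
  rw [infAct, infAct, infAct, h, Matrix.transpose_sub, Matrix.sub_mul, Matrix.mul_sub]
  abel

theorem mink_sub (X Y Z : Mat) : mink X (Y - Z) = mink X Y - mink X Z := by
  simp only [mink_eq, ← mul_sub, ← Complex.sub_re, Matrix.sub_apply]
  congr 2
  ring

/-- The infinitesimal translation. -/
def translation : Mat := !![0, 1; 0, 0]

theorem infAct_mk (a b c d x y z w : ℂ) : infAct !![a, b; c, d] !![x, y; z, w] =
    !![-(a * x + c * z + x * star a + y * star c), -(a * y + c * w + x * star b + y * star d);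
      -(b * x + d * z + z * star a + w * star c), -(b * y + d * w + z * star b + w * star d)] := by
  ext i j
  fin_cases i <;> fin_cases j <;>
    simp [infAct, conjMat, Matrix.mul_apply, Matrix.vecMul, dotProduct, Fin.sum_univ_two] <;> ring

/-- The six linear conditions are the derivatives of the norm and tangency relations. On twelve real
parameters they leave the six dimensions of `sl(2, ℂ)`, and the entries of `A` can be solved for
explicitly. -/
theorem exists_infAct {dU dL dT : Mat} (hU : dU.IsHermitian) (hL : dL.IsHermitian)
    (hT : dT.IsHermitian) (h1 : mink upperHalfPlane dU = 0) (h2 : mink lowerHalfPlane dL = 0)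
    (h3 : mink (tangentDisk 0) dT = 0)
    (h4 : mink upperHalfPlane dL + mink lowerHalfPlane dU = 0)
    (h5 : mink lowerHalfPlane dT + mink (tangentDisk 0) dL = 0)
    (h6 : mink (tangentDisk 0) dU + mink upperHalfPlane dT = 0) :
    ∃ A : Mat, A.trace = 0 ∧ infAct A upperHalfPlane = dU ∧ infAct A lowerHalfPlane = dL ∧
      infAct A (tangentDisk 0) = dT := by
  obtain ⟨a1, d1, b1, rfl⟩ := exists_of_isHermitian hU
  obtain ⟨a2, d2, b2, rfl⟩ := exists_of_isHermitian hL
  obtain ⟨a3, d3, b3, rfl⟩ := exists_of_isHermitian hT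
  simp only [upperHalfPlane_eq, lowerHalfPlane_eq, tangentDisk_eq, mink_eq_of_mk] at h1 h2 h3 h4 h5 h6
  simp at h1 h2 h3 h4 h5 h6
  refine ⟨!![⟨(d1 + d2) / 4, b1.re / 2⟩, ⟨-(b1.re + b3.re) / 2, d1 / 2⟩;
    ⟨-(b1.re + b2.re) / 2, -a1 / 2⟩, -⟨(d1 + d2) / 4, b1.re / 2⟩],
    by simp [Matrix.trace_fin_two], ?_, ?_, ?_⟩
  · rw [upperHalfPlane, infAct_mk]
    apply mat_congr <;> refine Complex.ext ?_ ?_ <;> simp <;> linarith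
  · rw [lowerHalfPlane, infAct_mk]
    apply mat_congr <;> refine Complex.ext ?_ ?_ <;> simp <;> linarith
  · rw [tangentDisk, infAct_mk]
    apply mat_congr <;> refine Complex.ext ?_ ?_ <;> simp <;> linarith

/-- Only the real translations preserve two half-planes that touch at infinity. -/
theorem eq_translation_of_infAct {A : Mat} (h : A.trace = 0) (hU : infAct A upperHalfPlane = 0)
    (hL : infAct A lowerHalfPlane = 0) : ∃ b : ℝ, A = b • translation := by
  rw [Matrix.trace_fin_two] at h
  have h11 : A 1 1 = -A 0 0 := by linear_combination h
  rw [Matrix.eta_fin_two A, upperHalfPlane, infAct_mk] at hU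
  rw [Matrix.eta_fin_two A, lowerHalfPlane, infAct_mk] at hL
  have u00 := congrArg Complex.re (congrFun (congrFun hU 0) 0)
  have u01 := congrArg Complex.re (congrFun (congrFun hU 0) 1)
  have u11 := congrArg Complex.re (congrFun (congrFun hU 1) 1)
  have l01 := congrArg Complex.re (congrFun (congrFun hL 0) 1)
  have l11 := congrArg Complex.re (congrFun (congrFun hL 1) 1)
  simp [h11] at u00 u01 u11 l01 l11
  refine ⟨(A 0 1).re, ?_⟩
  ext i j
  fin_cases i <;> fin_cases j <;> refine Complex.ext ?_ ?_ <;> simp [translation, h11] <;> linarith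

theorem mink_tangentDisk_infAct (b t : ℝ) :
    mink (tangentDisk 0) (infAct (b • translation) (tangentDisk t)) = -4 * t * b := by
  have h : b • translation = !![0, (b : ℂ); 0, 0] := by
    ext i j
    fin_cases i <;> fin_cases j <;> simp [translation]
  rw [h, tangentDisk, tangentDisk, infAct_mk, mink_eq]
  simp
  ring

theorem TangentToBoundary.act {A X : Mat} (h : TangentToBoundary A X) (B : PSL(2, ℂ)) :
    TangentToBoundary (Ad B A) (act B X) := by
  obtain ⟨B, rfl⟩ := psl_surjective B
  intro z hz
  set P : Mat := ((B⁻¹ : SL(2, ℂ)) : Mat) with hP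
  have hstar : conjMat P *ᵥ star z = star (P *ᵥ z) := by
    ext i
    fin_cases i <;> simp [conjMat, Matrix.mulVec, dotProduct, Fin.sum_univ_two]
  have hact : CirclePacking.act (psl B) X *ᵥ star z = Pᵀ *ᵥ (X *ᵥ star (P *ᵥ z)) := by
    rw [act_psl, ← hP, ← Matrix.mulVec_mulVec, ← Matrix.mulVec_mulVec, hstar]
  have key : ∀ v : Fin 2 → ℂ, v ⬝ᵥ (CirclePacking.act (psl B) X *ᵥ star z) =
      (P *ᵥ v) ⬝ᵥ (X *ᵥ star (P *ᵥ z)) := fun v => by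
    rw [hact, Matrix.mulVec_transpose, dotProduct_comm, ← Matrix.dotProduct_mulVec, dotProduct_comm]
  rw [hermForm, key] at hz
  rw [key, Ad_psl, ← hP, Matrix.mulVec_mulVec, ← Matrix.mul_assoc, ← Matrix.mul_assoc,
    inv_mul_coe, Matrix.one_mul, ← Matrix.mulVec_mulVec]
  exact h _ hz

theorem eq_translation_of_tangentToBoundary {A : Mat} (h : A.trace = 0)
    (hU : TangentToBoundary A upperHalfPlane) (hL : TangentToBoundary A lowerHalfPlane) :
    ∃ b : ℝ, A = b • translation := by
  rw [Matrix.trace_fin_two] at h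
  have h11 : A 1 1 = -A 0 0 := by linear_combination h
  -- Tangency is tested at `∞`, `0`, `1` on the real line and at `-i`, `1 - i` on the line `Im z =
  -- -1`; this already determines `A` up to a real factor.
  have u1 := hU ![1, 0] (by simp [hermForm, upperHalfPlane, Matrix.vecHead, Matrix.vecTail])
  have u2 := hU ![0, 1] (by simp [hermForm, upperHalfPlane, Matrix.vecHead, Matrix.vecTail])
  have u3 := hU ![1, 1] (by simp [hermForm, upperHalfPlane, Matrix.vecHead, Matrix.vecTail])
  have l1 := hL ![-Complex.I, 1] (by
    simp [hermForm, lowerHalfPlane, Matrix.mulVec, dotProduct, Fin.sum_univ_two]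
    ring)
  have l2 := hL ![1 - Complex.I, 1] (by
    simp [hermForm, lowerHalfPlane, Matrix.mulVec, dotProduct, Fin.sum_univ_two]
    linear_combination 2 * Complex.I_sq)
  simp [upperHalfPlane, lowerHalfPlane, Matrix.mulVec, dotProduct, Fin.sum_univ_two, h11]
    at u1 u2 u3 l1 l2
  refine ⟨(A 0 1).re, ?_⟩
  ext i j
  fin_cases i <;> fin_cases j <;> refine Complex.ext ?_ ?_ <;> simp [translation, h11] <;> linarith

theorem tangentToBoundary_translation_upper : TangentToBoundary translation upperHalfPlane := by
  intro z _
  simp [translation, upperHalfPlane, Matrix.mulVec, dotProduct, Fin.sum_univ_two]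
  ring

theorem tangentToBoundary_translation_lower : TangentToBoundary translation lowerHalfPlane := by
  intro z _
  simp [translation, lowerHalfPlane, Matrix.mulVec, dotProduct, Fin.sum_univ_two]
  ring

theorem Ad_flip_translation (t : ℝ) : Ad (flip t) translation = -translation := by
  rw [flip, Ad_psl, Matrix.SpecialLinearGroup.coe_inv, flipSL, coe_mkSL, translation]
  ext i j
  fin_cases i <;> fin_cases j <;>
    simp [Matrix.adjugate_fin_two, Matrix.mul_apply, Fin.sum_univ_two]

theorem Ad_transport_inv_translation {D : Type*} {M : Triangulation D} (t : M.Edge → ℝ) (d : D)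
    (i : ℕ) : Ad (psl (transportSL t d i))⁻¹ translation =
      (Triangulation.edgeMotion t d i).map Complex.ofReal := by
  rw [← map_inv, Ad_psl, inv_inv, Matrix.SpecialLinearGroup.coe_inv, coe_transportSL, translation,
    Triangulation.edgeMotion_eq]
  ext a b
  fin_cases a <;> fin_cases b <;>
    simp [Matrix.adjugate_fin_two, Matrix.mul_apply, Fin.sum_univ_two] <;> ring

end CirclePacking

namespace CirclePacking

variable {D D' : Type*} {M : Triangulation D} {U : UniversalCovering M D'}

open UniversalCovering Triangulation

namespace UniversalCovering.DevelopedPacking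

/-! ## Discrete one-forms -/

variable (p : U.DevelopedPacking)

/-- The infinitesimal translation along the edge underlying `e` in the frame of `e`. -/
def edgeField (e : D') : Mat := -Ad (p.frame e)⁻¹ translation

theorem edgeField_ne_zero (e : D') : p.edgeField e ≠ 0 := fun h => by
  have h1 := congrArg (Ad (p.frame e)) h
  rw [edgeField, map_neg, Ad_Ad_inv, map_zero] at h1
  simpa [translation] using congrFun (congrFun h1 0) 1

theorem edgeField_rev (e : D') : p.edgeField (U.cover.rev e) = -p.edgeField e := by
  have h : Ad (flip (p.shape e))⁻¹ translation = -translation := by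
    conv_lhs => rw [← neg_neg translation, ← Ad_flip_translation (p.shape e), map_neg, Ad_inv_Ad]
  rw [edgeField, edgeField, frame_rev, mul_inv_rev, map_mul, Module.End.mul_apply, h, map_neg]

theorem edgeField_deck (h : U.Deck) (e : D') :
    p.edgeField ((h : Equiv.Perm D') e) = Ad (p.hol h) (p.edgeField e) := by
  rw [edgeField, edgeField, frame_deck, mul_inv_rev, inv_inv, map_mul, Module.End.mul_apply, map_neg]

theorem edgeField_rot_iterate (e : D') (i : ℕ) : p.edgeField (U.cover.rot^[i] e) =
    -Ad (p.frame e)⁻¹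
      ((edgeMotion (U.crossRatioMap p.toSpace) (U.proj e) i).map Complex.ofReal) := by
  rw [edgeField, p.isFrame.rot_iterate, mul_inv_rev, map_mul, Module.End.mul_apply,
    Ad_transport_inv_translation]

theorem tangentToBoundary_edgeField (e : D') :
    TangentToBoundary (p.edgeField e) (p.disk (U.cover.tail e)) ∧
      TangentToBoundary (p.edgeField e) (p.disk (U.cover.head e)) := by
  have h : p.edgeField e = (-1 : ℝ) • Ad (p.frame e)⁻¹ translation := by
    rw [neg_one_smul, edgeField]
  have h1 := tangentToBoundary_translation_upper.act (p.frame e)⁻¹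
  have h2 := tangentToBoundary_translation_lower.act (p.frame e)⁻¹
  rw [← p.act_frame_tail e, act_inv_act] at h1
  rw [← p.act_frame_head e, act_inv_act] at h2
  rw [h]
  exact ⟨h1.smul _, h2.smul _⟩

theorem exists_smul_edgeField {Q : D' → Mat} (hQ : Q ∈ p.tangentForms) (e : D') :
    ∃ s : ℝ, Q e = s • p.edgeField e := by
  obtain ⟨h1, -, -, -, h5⟩ := hQ
  have hU := (h5 e).1.act (p.frame e)
  have hL := (h5 e).2.act (p.frame e)
  rw [act_frame_tail] at hU
  rw [act_frame_head] at hL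
  obtain ⟨b, hb⟩ := eq_translation_of_tangentToBoundary (by rw [trace_Ad, h1]) hU hL
  refine ⟨-b, ?_⟩
  rw [← Ad_inv_Ad (p.frame e) (Q e), hb, edgeField, smul_neg, neg_smul, neg_neg]
  exact LinearMap.map_smul_of_tower _ b _

/-- The discrete one-form with given coefficients. -/
def edgeForm : (M.Edge → ℝ) →ₗ[ℝ] (D' → Mat) where
  toFun q e := q (M.edge (U.proj e)) • p.edgeField e
  map_add' _ _ := funext fun _ => add_smul _ _ _
  map_smul' _ _ := funext fun _ => mul_smul _ _ _

theorem edgeForm_apply (q : M.Edge → ℝ) (e : D') :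
    p.edgeForm q e = q (M.edge (U.proj e)) • p.edgeField e := rfl

theorem edgeForm_eq_zero_iff (q : M.Edge → ℝ) (e : D') :
    p.edgeForm q e = 0 ↔ q (M.edge (U.proj e)) = 0 := by
  rw [edgeForm_apply, smul_eq_zero, or_iff_left (p.edgeField_ne_zero e)]

theorem edgeForm_injective : Function.Injective p.edgeForm := fun q r h => funext fun ε => by
  obtain ⟨d, rfl⟩ := M.edge_surjective ε
  obtain ⟨e, rfl⟩ := U.proj_surjective d
  exact smul_left_injective ℝ (p.edgeField_ne_zero e) (congrFun h e)

theorem sum_edgeForm (q : M.Edge → ℝ) (e : D') :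
    ∑ i ∈ Finset.range (U.cover.valence e), p.edgeForm q (U.cover.rot^[i] e) = -Ad (p.frame e)⁻¹
      ((motionSum (U.crossRatioMap p.toSpace) q (U.proj e)).map Complex.ofReal) := by
  have h : (motionSum (U.crossRatioMap p.toSpace) q (U.proj e)).map Complex.ofReal =
      ∑ i ∈ Finset.range (U.cover.valence e), q (M.edge (M.rot^[i] (U.proj e))) •
        (edgeMotion (U.crossRatioMap p.toSpace) (U.proj e) i).map Complex.ofReal := by
    ext a b
    rw [motionSum, U.valence_proj, Matrix.map_apply, Matrix.sum_apply, Matrix.sum_apply]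
    simp
  rw [h, map_sum, ← Finset.sum_neg_distrib]
  refine Finset.sum_congr rfl fun i _ => ?_
  rw [edgeForm_apply, U.proj_rot_iterate, edgeField_rot_iterate, smul_neg]
  exact congrArg Neg.neg (LinearMap.map_smul_of_tower _ _ _).symm

/-- In the frame of `e` all fields around its initial vertex are real and equal to `-edgeMotion`, so
that coclosedness at a vertex is the linearized closing equation. -/
theorem sum_edgeForm_eq_zero_iff (q : M.Edge → ℝ) (e : D') :
    ∑ i ∈ Finset.range (U.cover.valence e), p.edgeForm q (U.cover.rot^[i] e) = 0 ↔
      motionSum (U.crossRatioMap p.toSpace) q (U.proj e) = 0 := by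
  rw [sum_edgeForm, neg_eq_zero]
  constructor
  · intro h
    have h1 := congrArg (Ad (p.frame e)) h
    rw [Ad_Ad_inv, map_zero] at h1
    exact Matrix.map_injective Complex.ofReal_injective (h1.trans (by ext i j; simp))
  · intro h
    rw [h, show (0 : Matrix (Fin 2) (Fin 2) ℝ).map Complex.ofReal = 0 by ext i j; simp, map_zero]

omit p in
theorem sum_rot_iterate (F : D' → Mat) (e : D') (k : ℕ) :
    ∑ i ∈ Finset.range (U.cover.valence (U.cover.rot^[k] e)), F (U.cover.rot^[i] (U.cover.rot^[k] e)) =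
      ∑ i ∈ Finset.range (U.cover.valence e), F (U.cover.rot^[i] e) := by
  induction k with
  | zero => rfl
  | succ k ih =>
    rw [← ih, valence_rot_iterate, valence_rot_iterate, Function.iterate_succ_apply']
    have h1 := Finset.sum_range_succ' (fun i => F (U.cover.rot^[i] (U.cover.rot^[k] e)))
      (U.cover.valence e)
    have h2 := U.cover.rot_iterate_valence (U.cover.rot^[k] e)
    rw [valence_rot_iterate] at h2
    rw [Finset.sum_range_succ, h2] at h1
    exact (add_right_cancel h1).symm

/-- All conditions except coclosedness hold for every `q`, by the transformation laws of
`edgeField`. -/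
theorem edgeForm_mem_iff [Finite D] (q : M.Edge → ℝ) : p.edgeForm q ∈ p.tangentForms ↔
    fderiv ℝ M.vertexMap (U.crossRatioMap p.toSpace) q = 0 := by
  rw [p.closing.fderiv_vertexMap_eq_zero_iff]
  constructor
  · rintro ⟨-, -, -, h, -⟩ v
    obtain ⟨e, he⟩ := U.proj_surjective (M.baseDart v)
    rw [← he]
    exact (p.sum_edgeForm_eq_zero_iff q e).1 (h e)
  · intro h
    refine ⟨fun e => ?_, fun e => ?_, fun k e => ?_, fun e => ?_, fun e => ?_⟩
    · rw [edgeForm_apply, Matrix.trace_smul, edgeField, Matrix.trace_neg, trace_Ad]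
      simp [translation, Matrix.trace_fin_two]
    · rw [edgeForm_apply, edgeForm_apply, edgeField_rev, U.proj_rev, edge_rev, smul_neg]
    · rw [edgeForm_apply, edgeForm_apply, edgeField_deck, k.2.2.2]
      exact (LinearMap.map_smul_of_tower _ _ _).symm
    · obtain ⟨k, -, hk⟩ := M.exists_rot_of_tail_eq (M.tail_baseDart (M.tail (U.proj e))).symm
      rw [← sum_rot_iterate _ e k, sum_edgeForm_eq_zero_iff, U.proj_rot_iterate, hk]
      exact h _
    · exact ⟨(p.tangentToBoundary_edgeField e).1.smul _, (p.tangentToBoundary_edgeField e).2.smul _⟩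

/-- Tangency to both circles leaves a real multiple of `edgeField`. The form and the field transform
alike under deck transformations and reversal, so the coefficient depends only on the edge
downstairs. -/
theorem exists_eq_edgeForm {Q : D' → Mat} (hQ : Q ∈ p.tangentForms) : ∃ q, Q = p.edgeForm q := by
  choose s hs using p.exists_smul_edgeField hQ
  have hinj := fun e => smul_left_injective ℝ (p.edgeField_ne_zero e)
  have hdeck : ∀ (k : U.Deck) e, s ((k : Equiv.Perm D') e) = s e := fun k e => by
    apply hinj ((k : Equiv.Perm D') e)
    have h1 := hQ.2.2.1 k e
    rw [hs, hs] at h1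
    dsimp only
    rw [h1, edgeField_deck]
    exact LinearMap.map_smul_of_tower _ _ _
  have hrev : ∀ e, s (U.cover.rev e) = s e := fun e => by
    apply hinj (U.cover.rev e)
    have h1 := hQ.2.1 e
    rw [hs, hs e] at h1
    dsimp only
    rw [h1, edgeField_rev, smul_neg]
  have hs' : ∀ e e', M.edge (U.proj e) = M.edge (U.proj e') → s e = s e' := fun e e' h => by
    rcases M.edge_eq_iff.1 h with h | h
    · obtain ⟨k, rfl⟩ := U.exists_deck h.symm
      rw [hdeck]
    · rw [← U.proj_rev] at h
      obtain ⟨k, rfl⟩ := U.exists_deck h.symm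
      rw [hdeck, hrev]
  refine ⟨fun ε => s (Function.surjInv U.proj_surjective (Quotient.out ε)), funext fun e => ?_⟩
  rw [hs, edgeForm_apply]
  congr 1
  apply hs'
  exact ((congrArg M.edge (Function.surjInv_eq U.proj_surjective _)).trans (Quotient.out_eq _)).symm

end UniversalCovering.DevelopedPacking

open DevelopedPacking

/-- The isomorphism is `edgeForm` after the differential of the cross ratio map. Both are injective,
and the image of the differential is exactly the set of coefficients of tangent forms, namely the
kernel of the linearized closing equations. -/
theorem exists_tangentSpace_equiv [Finite D] {g : ℕ} (hg : 2 ≤ g)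
    (hM : M.IsClosedOfGenus g) (hU : U.cover.IsSimplicial)
    {cs : ChartedSpace (EuclideanSpace ℝ (Fin (6 * g - 6))) U.PackingSpace}
    (h : U.IsNaturalManifoldStructure (6 * g - 6) cs) (p : U.DevelopedPacking) :
    ∃ Φ : TangentSpace (𝓡 (6 * g - 6)) p.toSpace ≃ₗ[ℝ] p.tangentForms,
      ∀ X, (Φ X : D' → Mat) = p.edgeForm
        (mfderiv (𝓡 (6 * g - 6)) 𝓘(ℝ, M.Edge → ℝ) U.crossRatioMap p.toSpace X) := by
  set A : TangentSpace (𝓡 (6 * g - 6)) p.toSpace →ₗ[ℝ] (M.Edge → ℝ) :=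
    (mfderiv (𝓡 (6 * g - 6)) 𝓘(ℝ, M.Edge → ℝ) U.crossRatioMap p.toSpace).toLinearMap with hA
  have hr := range_mfderiv_crossRatioMap hg hM hU h p.toSpace
  have hinj : Function.Injective A := mfderiv_crossRatioMap_injective hg hM hU h p.toSpace
  have hmem : ∀ X, (p.edgeForm ∘ₗ A) X ∈ p.tangentForms := fun X =>
    (p.edgeForm_mem_iff _).2 ((hr _).1 ⟨X, rfl⟩)
  refine ⟨LinearEquiv.ofBijective ((p.edgeForm ∘ₗ A).codRestrict p.tangentForms hmem) ⟨?_, ?_⟩,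
    fun X => rfl⟩
  · intro X Y hXY
    exact hinj (p.edgeForm_injective (congrArg Subtype.val hXY))
  · rintro ⟨Q, hQ⟩
    obtain ⟨q, rfl⟩ := p.exists_eq_edgeForm hQ
    obtain ⟨X, hX⟩ := (hr q).2 ((p.edgeForm_mem_iff q).1 hQ)
    exact ⟨X, Subtype.ext (congrArg p.edgeForm hX)⟩

/-! ## Deformations -/

section Curve

variable {γ : ℝ → U.DevelopedPacking} (hγ : SmoothCurve γ)

include hγ

theorem UniversalCovering.DevelopedPacking.SmoothCurve.continuous : Continuous γ :=
  continuous_induced_rng.2 (continuous_pi fun i => (hγ i).continuous)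

theorem UniversalCovering.DevelopedPacking.SmoothAt.contDiffAt_comp {F : U.DevelopedPacking → ℝ}
    {t : ℝ} (h : SmoothAt F (γ t)) : ContDiffAt ℝ ∞ (fun t => F (γ t)) t := by
  obtain ⟨s, G, hG, hF⟩ := h
  refine ContDiffAt.congr_of_eventuallyEq (f := fun t => G fun i => (γ t).coord i) ?_
    (hγ.continuous.continuousAt.eventually hF)
  exact (hG.comp (contDiff_pi.2 fun i => hγ i)).contDiffAt

/-- The components of a chart are smooth functions on its domain, hence locally smooth functions of
finitely many coordinates, and these are smooth along `γ`. -/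
theorem contMDiffAt_toSpace {n : ℕ} {cs : ChartedSpace (EuclideanSpace ℝ (Fin n)) U.PackingSpace}
    (h : U.IsNaturalManifoldStructure n cs) (t : ℝ) :
    ContMDiffAt 𝓘(ℝ, ℝ) (𝓡 n) ∞ (fun t => (γ t).toSpace) t := by
  have := h.2.2.1
  refine contMDiffAt_iff_target.2
    ⟨(continuous_toSpace.comp hγ.continuous).continuousAt, ?_⟩
  rw [contMDiffAt_iff_contDiffAt, contDiffAt_euclidean]
  intro i
  set φ := extChartAt (𝓡 n) (γ t).toSpace
  have h1 : ContMDiffOn (𝓡 n) 𝓘(ℝ, ℝ) ∞ (fun y => φ y i) (chartAt _ (γ t).toSpace).source :=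
    (EuclideanSpace.proj i : EuclideanSpace ℝ (Fin n) →L[ℝ] ℝ).contMDiff.comp_contMDiffOn
      (contMDiffOn_extChartAt (x := (γ t).toSpace))
  exact SmoothAt.contDiffAt_comp hγ
    ((h.2.2.2 _ _ (chartAt _ (γ t).toSpace).open_source).1 h1 (γ t) (mem_chart_source _ _))

theorem hasDerivAt_shape [Finite D] (e₀ : D') {n : ℕ}
    {cs : ChartedSpace (EuclideanSpace ℝ (Fin n)) U.PackingSpace}
    (h : U.IsNaturalManifoldStructure n cs) (t : ℝ) (e : D') :
    HasDerivAt (fun t => (γ t).shape e)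
      ((mfderiv (𝓡 n) 𝓘(ℝ, M.Edge → ℝ) U.crossRatioMap (γ t).toSpace
        (mfderiv 𝓘(ℝ, ℝ) (𝓡 n) (fun t => (γ t).toSpace) t (1 : ℝ)) : M.Edge → ℝ)
          (M.edge (U.proj e))) t := by
  have h1 := ((contMDiffAt_toSpace hγ h t).mdifferentiableAt (by simp)).hasMFDerivAt
  have h2 := ((contMDiff_crossRatioMap e₀ h (γ t).toSpace).mdifferentiableAt (by simp)).hasMFDerivAt
  set L : ℝ →L[ℝ] (M.Edge → ℝ) :=
    (mfderiv (𝓡 n) 𝓘(ℝ, M.Edge → ℝ) U.crossRatioMap (γ t).toSpace).comp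
      (mfderiv 𝓘(ℝ, ℝ) (𝓡 n) (fun t => (γ t).toSpace) t) with hL
  have h0 := HasMFDerivAt.comp t h2 h1
  have h3 : HasFDerivAt (fun s => U.crossRatioMap (γ s).toSpace) L t := h0.hasFDerivAt
  have h4 := hasDerivAt_pi.1 h3.hasDerivAt (M.edge (U.proj e))
  simp only [crossRatioMap_edge] at h4
  exact h4

end Curve

end CirclePacking

namespace CirclePacking

variable {D D' : Type*} {M : Triangulation D} {U : UniversalCovering M D'}

open UniversalCovering Triangulation DevelopedPacking

/-- The velocity at time zero of a disk along a curve of developed packings. -/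
def diskVelocity (γ : ℝ → U.DevelopedPacking) (v : U.cover.Vertex) : Mat :=
  fun i j => deriv (fun t => (γ t).disk v i j) 0

/-! ### Velocities of disks and infinitesimal motions of triangles -/

section Curve

variable {γ : ℝ → U.DevelopedPacking} (hγ : SmoothCurve γ)

include hγ

theorem hasDerivAt_disk (v : U.cover.Vertex) (i j : Fin 2) :
    HasDerivAt (fun t => (γ t).disk v i j) (diskVelocity γ v i j) 0 :=
  ((hγ (Sum.inl (v, i, j))).differentiable (by simp) 0).hasDerivAt

theorem isHermitian_diskVelocity (v : U.cover.Vertex) : (diskVelocity γ v).IsHermitian := by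
  ext i j
  have h1 := (hasDerivAt_disk hγ v j i).star
  have h2 : (fun t => star ((γ t).disk v j i)) = fun t => (γ t).disk v i j :=
    funext fun t => ((γ t).disk_mem v).1.apply i j
  rw [h2] at h1
  exact h1.unique (hasDerivAt_disk hγ v i j)

theorem hasDerivAt_mink (v w : U.cover.Vertex) :
    HasDerivAt (fun t => mink ((γ t).disk v) ((γ t).disk w))
      (mink ((γ 0).disk v) (diskVelocity γ w) + mink ((γ 0).disk w) (diskVelocity γ v)) 0 := by
  have h := fun i j i' j' => (hasDerivAt_disk hγ v i j).mul (hasDerivAt_disk hγ w i' j')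
  have h1 := (((h 0 0 1 1).add (h 1 1 0 0)).sub (h 0 1 1 0)).sub (h 1 0 0 1)
  have h2 := (Complex.reCLM.hasFDerivAt.comp_hasDerivAt (0 : ℝ) h1).const_mul (-(1 / 2) : ℝ)
  simp only [mink_eq]
  refine h2.congr_deriv ?_
  rw [← mul_add, ← Complex.add_re]
  congr 1
  rw [Complex.reCLM_apply]
  congr 1
  ring

theorem mink_disk_diskVelocity {v w : U.cover.Vertex} {c : ℝ}
    (h : ∀ t, mink ((γ t).disk v) ((γ t).disk w) = c) :
    mink ((γ 0).disk v) (diskVelocity γ w) + mink ((γ 0).disk w) (diskVelocity γ v) = 0 := by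
  have h1 := hasDerivAt_mink hγ v w
  simp only [h] at h1
  exact h1.unique (hasDerivAt_const _ _)

theorem mink_disk_diskVelocity_self (v : U.cover.Vertex) :
    mink ((γ 0).disk v) (diskVelocity γ v) = 0 := by
  have h := mink_disk_diskVelocity hγ fun t => mink_self ((γ t).disk_mem v)
  linarith

/-- Differentiating `mink X X = 1` for the three disks and `mink X Y = -1` for the three pairs
gives, in the frame of `e`, the hypotheses of `exists_infAct`. -/
theorem exists_infAct_disk (e : D') : ∃ R : Mat, R.trace = 0 ∧
    infAct R ((γ 0).disk (U.cover.tail e)) = diskVelocity γ (U.cover.tail e) ∧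
    infAct R ((γ 0).disk (U.cover.head e)) = diskVelocity γ (U.cover.head e) ∧
    infAct R ((γ 0).disk (U.cover.head (U.cover.next e))) =
      diskVelocity γ (U.cover.head (U.cover.next e)) := by
  set A := (γ 0).frame e with hA
  have hH := fun v => isHermitian_act A (isHermitian_diskVelocity hγ v)
  have hm := fun v w => mink_act A ((γ 0).disk v) (diskVelocity γ w)
  obtain ⟨B, h0, h1, h2, h3⟩ := exists_infAct (hH (U.cover.tail e)) (hH (U.cover.head e))
    (hH (U.cover.head (U.cover.next e)))
    (by rw [← (γ 0).act_frame_tail e, hm, mink_disk_diskVelocity_self hγ])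
    (by rw [← (γ 0).act_frame_head e, hm, mink_disk_diskVelocity_self hγ])
    (by rw [← (γ 0).act_frame_third e, hm, mink_disk_diskVelocity_self hγ])
    (by rw [← (γ 0).act_frame_tail e, ← (γ 0).act_frame_head e, hm, hm,
      mink_disk_diskVelocity hγ fun t => (γ t).mink_eq e])
    (by rw [← (γ 0).act_frame_head e, ← (γ 0).act_frame_third e, hm, hm,
      mink_disk_diskVelocity hγ fun t => (γ t).mink_head_next e])
    (by rw [← (γ 0).act_frame_tail e, ← (γ 0).act_frame_third e, hm, hm, add_comm,
      mink_disk_diskVelocity hγ fun t => (γ t).mink_eq_next e])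
  rw [← (γ 0).act_frame_tail e] at h1
  rw [← (γ 0).act_frame_head e] at h2
  rw [← (γ 0).act_frame_third e] at h3
  refine ⟨Ad A⁻¹ B, by rw [trace_Ad, h0], ?_, ?_, ?_⟩ <;> apply act_injective A <;>
    rw [← infAct_Ad_act, Ad_Ad_inv] <;> assumption

theorem exists_faceMotion : ∃ R : U.cover.Face → Mat, (∀ τ, (R τ).trace = 0) ∧
    ∀ e, infAct (R (U.cover.face e)) ((γ 0).disk (U.cover.tail e)) =
      diskVelocity γ (U.cover.tail e) := by
  have h : ∀ τ : U.cover.Face, ∃ R : Mat, R.trace = 0 ∧ ∀ e, U.cover.face e = τ →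
      infAct R ((γ 0).disk (U.cover.tail e)) = diskVelocity γ (U.cover.tail e) := fun τ => by
    obtain ⟨e₀, rfl⟩ := U.cover.face_surjective τ
    obtain ⟨R, h0, h1, h2, h3⟩ := exists_infAct_disk hγ e₀
    refine ⟨R, h0, fun e he => ?_⟩
    rcases U.cover.face_eq_iff.1 he.symm with rfl | rfl | rfl
    · exact h1
    · rw [tail_next]
      exact h2
    · rw [tail_next]
      exact h3
  choose R h1 h2 using h
  exact ⟨R, h1, fun e => h2 _ e rfl⟩

/-- Both motions induce the same velocities at the two ends of `e`, so their difference is a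
multiple of the translation along `e`. The factor comes from differentiating the Minkowski product
`1 - 2 * shape ^ 2` of the two opposite disks. -/
theorem faceMotion_sub {R : U.cover.Face → Mat} (h0 : ∀ τ, (R τ).trace = 0)
    (hR : ∀ e, infAct (R (U.cover.face e)) ((γ 0).disk (U.cover.tail e)) =
      diskVelocity γ (U.cover.tail e)) (e : D') {s : ℝ}
    (hs : HasDerivAt (fun t => (γ t).shape e) s 0) :
    R (U.cover.face e) - R (U.cover.face (U.cover.rev e)) = s • (γ 0).edgeField e := by
  set p := γ 0 with hp
  set R₁ := R (U.cover.face e) with hR₁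
  set R₂ := R (U.cover.face (U.cover.rev e)) with hR₂
  set A := p.frame e with hA
  have hhead : ∀ e, infAct (R (U.cover.face e)) (p.disk (U.cover.head e)) =
      diskVelocity γ (U.cover.head e) := fun e => by
    rw [← tail_next, ← U.cover.face_next, hR]
  have hthird : ∀ e, infAct (R (U.cover.face e)) (p.disk (U.cover.head (U.cover.next e))) =
      diskVelocity γ (U.cover.head (U.cover.next e)) := fun e => by
    rw [← U.cover.face_next, hhead]
  have htail : infAct (R₁ - R₂) (p.disk (U.cover.tail e)) = 0 := by
    have h1 := hhead (U.cover.rev e)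
    rw [head_rev] at h1
    rw [infAct_sub, hR, h1, sub_self]
  have hhd : infAct (R₁ - R₂) (p.disk (U.cover.head e)) = 0 := by
    rw [infAct_sub, hhead, head_eq, hR, sub_self]
  obtain ⟨b, hb⟩ := eq_translation_of_infAct (A := Ad A (R₁ - R₂))
    (by rw [trace_Ad, Matrix.trace_sub, h0, h0, sub_zero])
    (by rw [← p.act_frame_tail e, infAct_Ad_act, htail, map_zero])
    (by rw [← p.act_frame_head e, infAct_Ad_act, hhd, map_zero])
  set X := p.disk (U.cover.head (U.cover.next e)) with hX
  set Y := p.disk (U.cover.head (U.cover.next (U.cover.rev e))) with hY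
  have hd : HasDerivAt (fun t => 1 - 2 * (γ t).shape e ^ 2) (-(4 * p.shape e * s)) 0 := by
    refine (((hs.pow 2).const_mul 2).const_sub 1).congr_deriv ?_
    simp only [← hp]
    ring
  simp only [shape_sq] at hd
  have h1 := hd.unique (hasDerivAt_mink hγ _ _)
  rw [← hthird, ← hthird, ← hp, ← hX, ← hY, ← hR₁, ← hR₂] at h1
  have h2 := mink_infAct (h0 (U.cover.face e)) X Y
  rw [← hR₁, mink_comm] at h2
  have h3 : mink X (infAct (R₁ - R₂) Y) = -4 * p.shape e * b := by
    rw [← mink_act A, ← infAct_Ad_act, hb, hX, p.act_frame_third, hY, p.act_frame_rev_third,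
      mink_tangentDisk_infAct]
  rw [infAct_sub, mink_sub] at h3
  -- Positivity of the shape allows the division. The minus sign is the one built into `edgeField`:
  -- the motion of the right triangle is subtracted from that of the left one.
  have h4 : s = -b := by
    have h5 : p.shape e * (s + b) = 0 := by linarith
    rcases mul_eq_zero.1 h5 with h6 | h6
    · exact ((p.shape_pos e).ne' h6).elim
    · linarith
  rw [← Ad_inv_Ad A (R₁ - R₂), hb, edgeField, h4, smul_neg, neg_smul, neg_neg]
  exact LinearMap.map_smul_of_tower _ b _

end Curve

theorem isInducedByDeformations [Finite D] (e₀ : D') {n : ℕ}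
    {cs : ChartedSpace (EuclideanSpace ℝ (Fin n)) U.PackingSpace}
    (h : U.IsNaturalManifoldStructure n cs)
    {Φ : ∀ p : U.DevelopedPacking, TangentSpace (𝓡 n) p.toSpace ≃ₗ[ℝ] p.tangentForms}
    (hΦ : ∀ p X, (Φ p X : D' → Mat) = p.edgeForm
      (mfderiv (𝓡 n) 𝓘(ℝ, M.Edge → ℝ) U.crossRatioMap p.toSpace X)) :
    U.IsInducedByDeformations n Φ := by
  intro γ hγ
  obtain ⟨R, h0, hR⟩ := exists_faceMotion hγ
  refine ⟨R, h0, fun e i j => ?_, fun e => ?_⟩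
  · rw [hR]
    exact hasDerivAt_disk hγ _ i j
  · rw [hΦ, faceMotion_sub hγ h0 hR e (hasDerivAt_shape hγ e₀ h 0 e)]
    rfl

end CirclePacking
end
theorem mainTheorem5 {D D' : Type*} [Finite D] (M : CirclePacking.Triangulation D) (g : ℕ)
    (hg : 2 ≤ g) (hM : M.IsClosedOfGenus g) (U : CirclePacking.UniversalCovering M D')
    (hU : U.cover.IsSimplicial) :
    (∀ (p : U.DevelopedPacking) (e : D'),
      ((U.crossRatioMap p.toSpace (M.edge (U.proj e)) : ℝ) : ℂ) = p.edgeCrossRatio e) ∧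
    (∃ cs, U.IsNaturalManifoldStructure (6 * g - 6) cs) ∧
    ∀ cs : ChartedSpace (EuclideanSpace ℝ (Fin (6 * g - 6))) U.PackingSpace,
      U.IsNaturalManifoldStructure (6 * g - 6) cs →
        Manifold.IsImmersion (𝓡 (6 * g - 6)) 𝓘(ℝ, M.Edge → ℝ) ∞ U.crossRatioMap ∧
        ∃ Φ : ∀ p : U.DevelopedPacking,
            TangentSpace (𝓡 (6 * g - 6)) p.toSpace ≃ₗ[ℝ] p.tangentForms,
          U.IsInducedByDeformations (6 * g - 6) Φ ∧
          ∀ (p : U.DevelopedPacking) (X : TangentSpace (𝓡 (6 * g - 6)) p.toSpace) (e : D'),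
            (mfderiv (𝓡 (6 * g - 6)) 𝓘(ℝ, M.Edge → ℝ) U.crossRatioMap p.toSpace X :
                M.Edge → ℝ) (M.edge (U.proj e)) = 0 ↔
              (Φ p X : D' → CirclePacking.Mat) e = 0 := by
  obtain ⟨e₀⟩ := CirclePacking.nonempty_cover hg hM U
  refine ⟨CirclePacking.ofReal_crossRatioMap,
    CirclePacking.exists_isNaturalManifoldStructure hg hM hU, fun cs h =>
      ⟨CirclePacking.isImmersion_crossRatioMap hg hM hU h, ?_⟩⟩
  choose Φ hΦ using CirclePacking.exists_tangentSpace_equiv hg hM hU h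
  refine ⟨Φ, CirclePacking.isInducedByDeformations e₀ h hΦ, fun p X e => ?_⟩
  rw [hΦ]
  exact (p.edgeForm_eq_zero_iff _ e).symm
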